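/- **Setting.** Let $K=\{g_-,\dots,g_+\}\subseteq\mathbb Z$ be a nonempty set of consecutive integers ($g_\pm$ finite or infinite), and let candidate spectral data $\{E_{2k-1},E_{2k},\gamma_k,\sigma_k\}_{k\in K}$ be given: the real numbers $E_j$ are strictly increasing in $j$, $\gamma_k\in[E_{2k-1},E_{2k}]$, $\sigma_k\in\{-1,0,1\}$, $R:=\sup_k (E_{2k}-E_{2k-1})<\infty$, and there is $N$ such that the open discs $D_k$ of radius $R$ centred at $(E_{2k-1}+E_{2k})/2$ with $|k|\ge N$ are pairwise disjoint. The gaps are the intervals $(E_{2k-1},E_{2k})$, $k\in K$; $\Sigma$ is the complement in $\mathbb R$ of their union, and it consists of the bands $[E_{2n-2},E_{2n-1}]$, where $E_{2g_--2}=-\infty$ if $g_-$ is finite and $E_{2g_++1}=+\infty$ if $g_+$ is finite. Put $\mathcal D=\mathbb C\setminus(\mathbb R\cup\bigcup_k\overline D_k)$, and let $\mathcal A_2(\mathcal D)$ be the set of holomorphic $f$ on $\mathcal D$ with $|f(z)|\le Me^{c|z|^2}$ for some $c,M>0$. Let $w_a(z)=(1-z/a)e^{z/a}$ for $a\ne0$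 and $w_0(z)=z$, and $$f^{\pm}(z)=\prod_{\sigma_k=\pm1}w_{\gamma_k}(z),\qquad s(z)=\frac{e^{i\pi/4}}{\sqrt2}\Big(\frac{\prod_{\sigma_k=0}w_{\gamma_k}(z)^2}{\prod_{k\in K}w_{E_{2k-1}}(z)\,w_{E_{2k}}(z)}\Big)^{1/4}.$$ If some $\sigma_k=0$, let $\gamma_*$ be a $\gamma_k$ with $\sigma_k=0$ closest to $0$, and let $m(z)=\#\{k:\sigma_k=0,\ \gamma_*\le\gamma_k\le z\}$ for real $z\ge\gamma_*$, $m(z)=\#\{k:\sigma_k=0,\ z<\gamma_k<\gamma_*\}$ for $z<\gamma_*$; otherwise $m=0$. The branch of $s$ is holomorphic on $\mathbb C\setminus\mathbb R$ with boundary values from above and below related by $s_+=(-1)^{n+m}s_-$ on $(E_{2n-1},E_{2n})$ and $i s_+=(-1)^{n+m}s_-$ on $(E_{2n-2},E_{2n-1})$. Let $B=i\,s\,\mathrm{diag}(f^-,f^+)$ for $\operatorname{Im}z>0$ and $B=s\,\mathrm{diag}(f^+,f^-)$ for $\operatorname{Im}z<0$, let $U=\begin{pmatrix}1&1\\-i&i\end{pmatrix}$,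 and let $\sigma_1=\begin{pmatrix}0&1\\1&0\end{pmatrix}$, $\sigma_3=\mathrm{diag}(1,-1)$ be Pauli matrices. Below, "as $z\to\infty$" means: in each double sector $|\operatorname{Im}z|\ge\varepsilon|z|$, $\varepsilon>0$. For all $x,t\in\mathbb R$ let $\Phi(x,t,\cdot)$ be a solution of the following Riemann–Hilbert problem: (1) $\Phi$ is a $2\times2$ matrix function, holomorphic in $z\in\mathbb C\setminus\mathbb R$; (2) its boundary values $\Phi_\pm$ from above and below are continuous on $\mathbb R\setminus\{E_k\}$, and $\Phi=O(|z-E_k|^{-1/4})$ at each $E_k$; (3) $\Phi_+=\Phi_-V$ with $$V=(-1)^{n+m(z)}\mathrm{diag}\big(f^- /f^+,\,f^+/f^-\big)\ \text{on}\ (E_{2n-2},E_{2n-1}),\qquad V=(-1)^{n+m(z)}\,i\,e^{-2izx\sigma_3-4iz^2t\sigma_3}\sigma_1\ \text{on}\ (E_{2n-1},E_{2n});$$ (4) $\Phi=U(I+O(1/z))B(z)$ as $z\to\infty$; (5) the entries satisfy $|\Phi_{ij}|\le Me^{c|z|^2}$ on $\mathcal D$ for some $c,M>0$. Suppose that $\Phi$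 determines $q(x,t)$ through $$\begin{pmatrix}0&q(x,t)\\ \overline{q(x,t)}&0\end{pmatrix}=\lim_{z\to\infty}iz\,\big[\sigma_3,\;U^{-1}\Phi(x,t,z)B(z)^{-1}\big]\qquad\text{for all }x,t\in\mathbb R .$$ **Theorem.** Let $L_2>0$, and suppose that there is a function $r_2$ such that 1. $r_2$ is holomorphic and has no zeros in $\mathbb C\setminus\bigcup_k[E_{2k-1},E_{2k}]$, and has boundary values $r_{2\pm}$ from above and below that are continuous on the closed gaps $[E_{2k-1},E_{2k}]$; 2. $r_{2+}=r_{2-}^{-1}$ on $\mathbb R\setminus\Sigma$ (in particular $r_{2\pm}\neq0$ there); 3. $r_2(z)=e^{2iz^2L_2}(1+O(1/z))$ as $z\to\infty$; 4. $r_2\in\mathcal A_2(\mathcal D)$. Then $q(x,t+L_2)=q(x,t)$ for all $x,t\in\mathbb R$. -/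

import Mathlib

open Filter Topology Complex

noncomputable section

namespace NLSPeriodic

/-- Candidate spectral data `{E_{2k-1}, E_{2k}, γ_k, σ_k}`, indexed by a nonempty set `K` of
consecutive integers, `K = {g_-, …, g_+}` with `g_±` finite or infinite. -/
structure CandidateData where
  K : Set ℤ
  E : ℤ → ℝ
  γ : ℤ → ℝ
  σ : ℤ → SignType
  consecutive : K.OrdConnected
  nonempty : K.Nonempty
  gap_lt : ∀ k ∈ K, E (2 * k - 1) < E (2 * k)
  band_lt : ∀ k, k ∈ K → k + 1 ∈ K → E (2 * k) < E (2 * k + 1)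
  γ_mem : ∀ k ∈ K, γ k ∈ Set.Icc (E (2 * k - 1)) (E (2 * k))
  bdd_gaps : BddAbove ((fun k => E (2 * k) - E (2 * k - 1)) '' K)
  discs_disjoint : ∃ N : ℕ, ∀ k ∈ K, ∀ l ∈ K, (N : ℤ) ≤ |k| → (N : ℤ) ≤ |l| → k ≠ l →
    Disjoint
      (Metric.ball (((E (2 * k) + E (2 * k - 1)) / 2 : ℝ) : ℂ)
        (sSup ((fun k => E (2 * k) - E (2 * k - 1)) '' K)))
      (Metric.ball (((E (2 * l) + E (2 * l - 1)) / 2 : ℝ) : ℂ)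
        (sSup ((fun k => E (2 * k) - E (2 * k - 1)) '' K)))

/-- The first Pauli matrix. -/
def pauli1 : Matrix (Fin 2) (Fin 2) ℂ := !![0, 1; 1, 0]

def pauli3 : Matrix (Fin 2) (Fin 2) ℂ := !![1, 0; 0, -1]

def U : Matrix (Fin 2) (Fin 2) ℂ := !![1, 1; -I, I]

/-- `exp (w σ₃)`. -/
def expPauli3 (w : ℂ) : Matrix (Fin 2) (Fin 2) ℂ := !![exp w, 0; 0, exp (-w)]

def upperHalf : Set ℂ := {z | 0 < z.im}

def lowerHalf : Set ℂ := {z | z.im < 0}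

/-- The closed double sector `{z : |Im z| ≥ ε |z|}` around the imaginary axis. -/
def sector (ε : ℝ) : Set ℂ := {z | ε * ‖z‖ ≤ |z.im|}

/-- The Phragmén–Lindelöf algebra `𝒜_p(Ω)`. -/
def MemPL (p : ℝ) (Ω : Set ℂ) (f : ℂ → ℂ) : Prop :=
  DifferentiableOn ℂ f Ω ∧
    ∃ c > 0, ∃ M > 0, ∀ z ∈ Ω, ‖f z‖ ≤ M * Real.exp (c * ‖z‖ ^ p)

/-- The primary factor `(1 - z/a) e^{z/a}`, read as `z` when `a = 0`. -/
def primary (a : ℝ) (z : ℂ) : ℂ := if a = 0 then z else (1 - z / a) * exp (z / a)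

/-- A logarithm of `primary a z`; for nonreal `z` it is a holomorphic branch. -/
def logPrimary (a : ℝ) (z : ℂ) : ℂ := if a = 0 then log z else log (1 - z / a) + z / a

namespace CandidateData

variable (D : CandidateData)

/-- The set of all band edges `E_k`. -/
def edges : Set ℝ := {x | ∃ k ∈ D.K, x = D.E (2 * k - 1) ∨ x = D.E (2 * k)}

/-- The open spectral gap number `n`. -/
def gap (n : ℤ) : Set ℝ := Set.Ioo (D.E (2 * n - 1)) (D.E (2 * n))

/-- The closure of the union of the spectral gaps, as a subset of the plane. -/
def closedGaps : Set ℂ := {z | ∃ k ∈ D.K, ∃ x ∈ Set.Icc (D.E (2 * k - 1)) (D.E (2 * k)), z = (x : ℂ)}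

/-- `IsBand n`: the index `n` belongs to a spectral band `[E_{2n-2}, E_{2n-1}]`, one of whose ends
is infinite if `n` is the least index, or one more than the greatest index, of the gaps. -/
def IsBand (n : ℤ) : Prop := n ∈ D.K ∨ n - 1 ∈ D.K

/-- The interior of the spectral band number `n`. -/
def band (n : ℤ) : Set ℝ :=
  {x | (n - 1 ∈ D.K → D.E (2 * n - 2) < x) ∧ (n ∈ D.K → x < D.E (2 * n - 1))}

/-- The largest gap length `R`. -/
def R : ℝ := sSup ((fun k => D.E (2 * k) - D.E (2 * k - 1)) '' D.K)

/-- The domain `𝒟`: the plane without the real axis and without the closed discs of radius `R`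
around the midpoints of the gaps. -/
def domain : Set ℂ :=
  {z | z.im ≠ 0 ∧
    ∀ k ∈ D.K, z ∉ Metric.closedBall (((D.E (2 * k) + D.E (2 * k - 1)) / 2 : ℝ) : ℂ) D.R}

open Classical in
/-- `f^+`, the product over the `γ_k` with `σ_k = 1`. -/
def fPlus (z : ℂ) : ℂ := ∏' k : {k // k ∈ D.K ∧ D.σ k = 1}, primary (D.γ k) z

open Classical in
/-- `f^-`, the product over the `γ_k` with `σ_k = -1`. -/
def fMinus (z : ℂ) : ℂ := ∏' k : {k // k ∈ D.K ∧ D.σ k = -1}, primary (D.γ k) z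

/-- `k` is the index of a `γ_k` with `σ_k = 0` that is closest to zero among these. -/
def IsStar (k : ℤ) : Prop :=
  k ∈ D.K ∧ D.σ k = 0 ∧ ∀ j ∈ D.K, D.σ j = 0 → |D.γ k| ≤ |D.γ j|

open Classical in
/-- The counting function `m`. -/
def m (x : ℝ) : ℕ :=
  if h : ∃ k, D.IsStar k then
    if D.γ h.choose ≤ x then
      Set.ncard {k | k ∈ D.K ∧ D.σ k = 0 ∧ D.γ h.choose ≤ D.γ k ∧ D.γ k ≤ x}
    else
      Set.ncard {k | k ∈ D.K ∧ D.σ k = 0 ∧ x < D.γ k ∧ D.γ k < D.γ h.choose}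
  else 0

/-- The jump matrix on the band number `n`. -/
def jumpBand (n : ℤ) (z : ℝ) : Matrix (Fin 2) (Fin 2) ℂ :=
  ((-1 : ℂ) ^ (n + (D.m z : ℤ))) •
    !![D.fMinus z / D.fPlus z, 0; 0, D.fPlus z / D.fMinus z]

/-- The jump matrix on the gap number `n`. -/
def jumpGap (n : ℤ) (x t z : ℝ) : Matrix (Fin 2) (Fin 2) ℂ :=
  ((-1 : ℂ) ^ (n + (D.m z : ℤ)) * I) •
    (expPauli3 (-2 * I * z * x - 4 * I * z ^ 2 * t) * pauli1)

/-- A branch, holomorphic in each open half-plane and continuous across the real axis just to the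
right of the origin, of the fourth root of
`∏_{σ_k = 0} ((1-z/γ_k) e^{z/γ_k})² / ∏_k ((1-z/E_{2k-1}) e^{z/E_{2k-1}} (1-z/E_{2k}) e^{z/E_{2k}})`. -/
def rootRatio (z : ℂ) : ℂ :=
  exp (∑' k : D.K, ((if D.σ k = 0 then logPrimary (D.γ k) z / 2 else 0)
    - logPrimary (D.E (2 * k - 1)) z / 4 - logPrimary (D.E (2 * k)) z / 4))

open Classical in
/-- The constant by which `rootRatio` is multiplied in the lower half-plane. It selects the branch
`s` of the fourth root with `s₊ = (-1)^{n+m} s₋` on gap `n`, and with `i s₊ = (-1)^{n+m} s₋` on band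
`n`: the two relations are read off just to the right of the origin, and then hold everywhere. -/
def branchConst : ℂ :=
  if h : ∃ n ∈ D.K, D.E (2 * n - 1) ≤ 0 ∧ 0 < D.E (2 * n) then
    (-1 : ℂ) ^ (h.choose + (D.m 0 : ℤ))
  else if h : ∃ n, D.IsBand n ∧ (n - 1 ∈ D.K → D.E (2 * n - 2) ≤ 0) ∧
      (n ∈ D.K → 0 < D.E (2 * n - 1)) then
    I * (-1 : ℂ) ^ (h.choose + (D.m 0 : ℤ))
  else 1

/-- The scalar factor `√f⁰ / (Δ² - 1)^{1/4}` of the matrix `B`. -/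
def scalarFactor (z : ℂ) : ℂ :=
  exp (Real.pi * I / 4) / (Real.sqrt 2 : ℂ) *
    ((if 0 < z.im then 1 else D.branchConst) * D.rootRatio z)

/-- The matrix `B(z)` (for nonreal `z`). -/
def B (z : ℂ) : Matrix (Fin 2) (Fin 2) ℂ :=
  if 0 < z.im then (I * D.scalarFactor z) • !![D.fMinus z, 0; 0, D.fPlus z]
  else D.scalarFactor z • !![D.fPlus z, 0; 0, D.fMinus z]

/-- `Φ` solves, for the given `x` and `t`, the time-dependent matrix Riemann–Hilbert problem of the
candidate data. Only the values of `Φ` off the real axis matter. -/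
structure SolvesRHP (x t : ℝ) (Φ : ℂ → Matrix (Fin 2) (Fin 2) ℂ) : Prop where
  holomorphic : ∀ i j, DifferentiableOn ℂ (fun z => Φ z i j) {z | z.im ≠ 0}
  boundary : ∃ Φp Φm : ℝ → Matrix (Fin 2) (Fin 2) ℂ,
    ContinuousOn Φp D.edgesᶜ ∧ ContinuousOn Φm D.edgesᶜ ∧
    (∀ y ∉ D.edges, Tendsto Φ (𝓝[upperHalf] (y : ℂ)) (𝓝 (Φp y))) ∧
    (∀ y ∉ D.edges, Tendsto Φ (𝓝[lowerHalf] (y : ℂ)) (𝓝 (Φm y))) ∧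
    (∀ n, D.IsBand n → ∀ y ∈ D.band n, Φp y = Φm y * D.jumpBand n y) ∧
    (∀ n ∈ D.K, ∀ y ∈ D.gap n, Φp y = Φm y * D.jumpGap n x t y)
  quartic : ∀ e ∈ D.edges, ∃ δ > 0, ∃ C, ∀ z : ℂ, z.im ≠ 0 → ‖z - e‖ < δ →
    ∀ i j, ‖Φ z i j‖ ≤ C * ‖z - e‖ ^ (-(1 / 4) : ℝ)
  asymptotics : ∀ ε > 0, ∃ C ρ : ℝ, 0 < ρ ∧ ∀ z ∈ sector ε, ρ ≤ ‖z‖ →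
    ∃ A : Matrix (Fin 2) (Fin 2) ℂ, (∀ i j, ‖A i j‖ ≤ C / ‖z‖) ∧ Φ z = U * (1 + A) * D.B z
  growth : ∃ c > 0, ∃ M > 0, ∀ z ∈ D.domain, ∀ i j,
    ‖Φ z i j‖ ≤ M * Real.exp (c * ‖z‖ ^ 2)

/-- The reconstruction formula: `q` is the potential with matrix
`Q = lim i z [σ₃, U⁻¹ Φ(z) B(z)⁻¹]`, `Q = (0, q; q*, 0)`. -/
def Reconstructs (Φ : ℂ → Matrix (Fin 2) (Fin 2) ℂ) (q : ℂ) : Prop :=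
  ∀ ε > 0, Tendsto
    (fun z : ℂ => (I * z) •
      (pauli3 * (U⁻¹ * Φ z * (D.B z)⁻¹) - (U⁻¹ * Φ z * (D.B z)⁻¹) * pauli3))
    (Bornology.cobounded ℂ ⊓ 𝓟 (sector ε)) (𝓝 !![0, q; star q, 0])

/-- `r` solves the scalar Riemann–Hilbert problem of temporal period `L`. The plane without
`ℝ ∖ Σ(ℒ)` contains the band edges; the boundary values are continuous up to them. -/
structure SolvesScalarRHP (L : ℝ) (r : ℂ → ℂ) : Prop where
  holomorphic : DifferentiableOn ℂ r D.closedGapsᶜ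
  ne_zero : ∀ z ∉ D.closedGaps, r z ≠ 0
  boundary : ∃ rp rm : ℝ → ℂ, ∀ k ∈ D.K,
    ContinuousOn rp (Set.Icc (D.E (2 * k - 1)) (D.E (2 * k))) ∧
    ContinuousOn rm (Set.Icc (D.E (2 * k - 1)) (D.E (2 * k))) ∧
    (∀ y ∈ Set.Icc (D.E (2 * k - 1)) (D.E (2 * k)),
      Tendsto r (𝓝[upperHalf] (y : ℂ)) (𝓝 (rp y)) ∧
      Tendsto r (𝓝[lowerHalf] (y : ℂ)) (𝓝 (rm y))) ∧
    (∀ y ∈ D.gap k, rm y ≠ 0 ∧ rp y = (rm y)⁻¹)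
  asymptotics : ∀ ε > 0, ∃ C ρ : ℝ, 0 < ρ ∧ ∀ z ∈ sector ε, ρ ≤ ‖z‖ →
    ∃ w : ℂ, ‖w‖ ≤ C / ‖z‖ ∧ r z = exp (2 * I * z ^ 2 * L) * (1 + w)
  growth : MemPL 2 D.domain r

end CandidateData

end NLSPeriodic

end

noncomputable section

namespace NLSPeriodic

/-- Maximum principle: a bound on the boundary limits of the modulus holds inside. -/
theorem norm_le_of_frontier_limsup {V : Set ℂ} (hVo : IsOpen V) (hVb : Bornology.IsBounded V)
    {f : ℂ → ℂ} (hf : DifferentiableOn ℂ f V) {C : ℝ}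
    (hC : ∀ p ∈ frontier V, ∀ C' > C, ∀ᶠ z in 𝓝[V] p, ‖f z‖ ≤ C') :
    ∀ z ∈ V, ‖f z‖ ≤ C := by
  intro z₁ hz₁
  by_contra! hlt
  have compact : ∀ m > C, IsCompact {z ∈ V | m ≤ ‖f z‖} := by
    intro m hm
    refine Metric.isCompact_of_isClosed_isBounded ?_ (hVb.subset fun z hz => hz.1)
    refine isClosed_of_closure_subset fun p hp => ?_
    have hpV : p ∈ closure V := closure_mono (fun z hz => hz.1) hp
    by_cases hp' : p ∈ V
    · refine ⟨hp', ?_⟩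
      have hcont : ContinuousAt (fun z => ‖f z‖) p :=
        ((hf p hp').differentiableAt (hVo.mem_nhds hp')).continuousAt.norm
      by_contra! hlt'
      have hev := hcont.eventually_lt continuousAt_const hlt'
      obtain ⟨z, hz, hz'⟩ := ((mem_closure_iff_frequently.1 hp).and_eventually hev).exists
      exact absurd hz.2 (not_le.2 hz')
    · have hfr : p ∈ frontier V := ⟨hpV, by rwa [hVo.interior_eq]⟩
      have h1 := hC p hfr ((C + m) / 2) (by linarith)
      rw [eventually_nhdsWithin_iff] at h1
      obtain ⟨z, hz, hz'⟩ := ((mem_closure_iff_frequently.1 hp).and_eventually h1).exists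
      have := hz' hz.1
      linarith [hz.2]
  obtain ⟨z₂, hz₂, hmax⟩ := (compact _ hlt).exists_isMaxOn ⟨z₁, hz₁, le_rfl⟩
    (f := fun z => ‖f z‖) (hf.continuousOn.norm.mono fun z hz => hz.1)
  have hge : ‖f z₁‖ ≤ ‖f z₂‖ := hz₂.2
  have hglob : ∀ z ∈ V, ‖f z‖ ≤ ‖f z₂‖ := by
    intro z hz
    by_cases h : ‖f z₁‖ ≤ ‖f z‖
    · exact hmax ⟨hz, h⟩
    · linarith
  obtain ⟨z₃, hz₃, hmax₃⟩ := (compact _ (hlt.trans_le hge)).exists_isMaxOn ⟨z₂, hz₂.1, le_rfl⟩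
    (f := fun z : ℂ => z.re) continuous_re.continuousOn
  have heq : ‖f z₃‖ = ‖f z₂‖ := le_antisymm (hglob _ hz₃.1) hz₃.2
  have hnV : V ∈ 𝓝 z₃ := hVo.mem_nhds hz₃.1
  have hloc : IsLocalMax (norm ∘ f) z₃ := by
    filter_upwards [hnV] with z hz
    simpa [heq] using hglob z hz
  have hconst := Complex.eventually_eq_of_isLocalMax_norm
    (by filter_upwards [hVo.eventually_mem hz₃.1] with z hz
        exact (hf z hz).differentiableAt (hVo.mem_nhds hz)) hloc
  have hline : Tendsto (fun δ : ℝ => z₃ + δ) (𝓝[>] 0) (𝓝 z₃) := by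
    have : Tendsto (fun δ : ℝ => z₃ + δ) (𝓝 0) (𝓝 (z₃ + (0 : ℝ))) :=
      (by fun_prop : Continuous fun δ : ℝ => z₃ + (δ : ℂ)).tendsto 0
    simpa using this.mono_left nhdsWithin_le_nhds
  obtain ⟨δ, ⟨h1, h2⟩, h3⟩ :=
    ((hline.eventually (hconst.and hnV)).and self_mem_nhdsWithin).exists
  have h4 : (z₃ + δ).re ≤ z₃.re := hmax₃ ⟨h2, by rw [h1, heq]⟩
  simp only [add_re, ofReal_re] at h4
  have h3' : 0 < δ := h3
  linarith

/-- A continuous function that is holomorphic off the real axis is holomorphic. -/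
theorem differentiableOn_of_differentiableOn_off_real {Ω : Set ℂ} (hΩ : IsOpen Ω) {f : ℂ → ℂ}
    (hc : ContinuousOn f Ω) (hd : ∀ z ∈ Ω, z.im ≠ 0 → DifferentiableAt ℂ f z) :
    DifferentiableOn ℂ f Ω := by
  refine (isConservativeOn_and_continuousOn_iff_isDifferentiableOn hΩ).1 ⟨?_, hc⟩
  intro z w hzw
  rw [← add_eq_zero_iff_eq_neg, wedgeIntegral_add_wedgeIntegral_eq]
  have hrect : ∀ a b : ℂ, Rectangle a b ⊆ Ω →
      (0 : ℝ) ∉ Set.Ioo (min a.im b.im) (max a.im b.im) →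
      (∫ x : ℝ in a.re..b.re, f (x + a.im * I)) -
      (∫ x : ℝ in a.re..b.re, f (x + b.im * I)) +
      I • (∫ y : ℝ in a.im..b.im, f (b.re + y * I)) -
      I • (∫ y : ℝ in a.im..b.im, f (a.re + y * I)) = 0 := by
    intro a b hab h0
    have hsub : Set.Ioo (min a.re b.re) (max a.re b.re) ×ℂ
        Set.Ioo (min a.im b.im) (max a.im b.im) ⊆ Rectangle a b := by
      intro x hx
      exact ⟨Set.Ioo_subset_Icc_self hx.1, Set.Ioo_subset_Icc_self hx.2⟩
    refine integral_boundary_rect_eq_zero_of_continuousOn_of_differentiableOn f a b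
      (hc.mono hab) fun x hx => (hd x (hab (hsub hx)) ?_).differentiableWithinAt
    intro hx0
    exact h0 (hx0 ▸ hx.2)
  by_cases h0 : (0 : ℝ) ∈ Set.Ioo (min z.im w.im) (max z.im w.im)
  · have h0' : (0 : ℝ) ∈ Set.uIcc z.im w.im := Set.Ioo_subset_Icc_self h0
    have e1 := hrect z ⟨w.re, 0⟩ (fun x hx => hzw ⟨hx.1, by
      exact Set.uIcc_subset_uIcc_left h0' hx.2⟩) (by
        simp only [Set.mem_Ioo, not_and, min_lt_iff, lt_max_iff]; grind)
    have e2 := hrect ⟨z.re, 0⟩ w (fun x hx => hzw ⟨hx.1, by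
      exact Set.uIcc_subset_uIcc_right h0' hx.2⟩) (by
        simp only [Set.mem_Ioo, not_and, min_lt_iff, lt_max_iff]; grind)
    have hint : ∀ r ∈ Set.uIcc z.re w.re, ∀ a ∈ Set.uIcc z.im w.im, ∀ b ∈ Set.uIcc z.im w.im,
        IntervalIntegrable (fun y : ℝ => f (r + y * I)) MeasureTheory.volume a b := by
      intro r hr a ha b hb
      refine ContinuousOn.intervalIntegrable ?_
      refine hc.comp (by fun_prop) fun y hy => hzw ⟨by simpa using hr, ?_⟩
      simpa using Set.uIcc_subset_uIcc ha hb hy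
    have s1 := intervalIntegral.integral_add_adjacent_intervals
      (hint w.re Set.right_mem_uIcc z.im Set.left_mem_uIcc 0 h0')
      (hint w.re Set.right_mem_uIcc 0 h0' w.im Set.right_mem_uIcc)
    have s2 := intervalIntegral.integral_add_adjacent_intervals
      (hint z.re Set.left_mem_uIcc z.im Set.left_mem_uIcc 0 h0')
      (hint z.re Set.left_mem_uIcc 0 h0' w.im Set.right_mem_uIcc)
    rw [← s1, ← s2]
    simp only [smul_eq_mul] at e1 e2 ⊢
    linear_combination e1 + e2
  · exact hrect z w hzw h0

theorem nhdsWithin_im_ne_zero (p : ℂ) :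
    𝓝[{z : ℂ | z.im ≠ 0}] p = 𝓝[upperHalf] p ⊔ 𝓝[lowerHalf] p := by
  rw [← nhdsWithin_union]
  congr 1
  ext z
  simp only [upperHalf, lowerHalf, Set.mem_ofPred_eq, Set.mem_union]
  exact ⟨fun h => (lt_or_gt_of_ne h).symm, fun h => h.elim (fun h => h.ne') fun h => h.ne⟩

theorem isOpen_im_ne_zero : IsOpen {z : ℂ | z.im ≠ 0} :=
  isOpen_ne_fun continuous_im continuous_const

theorem mem_closure_im_ne_zero (p : ℂ) : p ∈ closure {z : ℂ | z.im ≠ 0} := by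
  refine mem_closure_of_tendsto (f := fun n : ℕ => p + ((1 / ((n : ℝ) + 1) : ℝ) : ℂ)
      * I * (if p.im < 0 then -1 else 1))
    (b := atTop) ?_ ?_
  · have h := (continuous_ofReal.tendsto 0).comp tendsto_one_div_add_atTop_nhds_zero_nat
    have h2 : Tendsto (fun n : ℕ => p + ((1 / ((n : ℝ) + 1) : ℝ) : ℂ) * I *
        (if p.im < 0 then -1 else 1)) atTop
            (𝓝 (p + ((0 : ℝ) : ℂ) * I * (if p.im < 0 then -1 else 1))) :=
      tendsto_const_nhds.add ((h.mul_const I).mul_const _)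
    simpa using h2
  · refine Eventually.of_forall fun n => ?_
    have : (0 : ℝ) < 1 / ((n : ℝ) + 1) := by positivity
    have key : (p + ((1 / ((n : ℝ) + 1) : ℝ) : ℂ) * I * (if p.im < 0 then -1 else 1)).im
        = p.im + 1 / ((n : ℝ) + 1) * (if p.im < 0 then -1 else 1) := by
      split_ifs
      · rw [mul_neg_one, add_im, neg_im, im_ofReal_mul]; simp
      · rw [mul_one, add_im, im_ofReal_mul]; simp
    change _ ≠ _
    rw [key]
    split_ifs with hp
    · nlinarith
    · rw [not_lt] at hp; nlinarith

/-- A function that is holomorphic off the real axis, has equal boundary values from both sides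
off a discrete set, and is `O(|z-e|^{-1/2})` at its points, extends to an entire function. -/
theorem exists_entire_extension {f : ℂ → ℂ} (hf : DifferentiableOn ℂ f {z | z.im ≠ 0})
    {S : Set ℝ} (hS : ∀ p : ℂ, ∀ᶠ z in 𝓝[≠] p, ∀ e ∈ S, z ≠ (e : ℂ))
    (hlim : ∀ y : ℝ, y ∉ S → ∃ l, Tendsto f (𝓝[upperHalf] (y : ℂ)) (𝓝 l) ∧
      Tendsto f (𝓝[lowerHalf] (y : ℂ)) (𝓝 l))
    (hbd : ∀ e ∈ S, ∃ δ > 0, ∃ C, ∀ z : ℂ, z.im ≠ 0 → ‖z - e‖ < δ →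
      ‖f z‖ ≤ C * ‖z - e‖ ^ (-(1 / 2) : ℝ)) :
    ∃ F : ℂ → ℂ, Differentiable ℂ F ∧ ∀ z : ℂ, z.im ≠ 0 → F z = f z := by
  set A : Set ℂ := {z | z.im ≠ 0} with hA
  have hAo : IsOpen A := isOpen_im_ne_zero
  set Ω : Set ℂ := {z | ∀ e ∈ S, z ≠ (e : ℂ)} with hΩdef
  have hΩo : IsOpen Ω := by
    rw [isOpen_iff_mem_nhds]
    intro p hp
    have := hS p
    rw [eventually_nhdsWithin_iff] at this
    filter_upwards [this] with z hz
    by_cases hzp : z = p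
    · rw [hzp]; exact hp
    · exact hz hzp
  set f₁ := extendFrom A f with hf₁
  have hcl : ∀ z, z ∈ closure A := mem_closure_im_ne_zero
  have hAe : ∀ z ∈ A, f₁ z = f z := extendFrom_extends hf.continuousOn
  have hc₁ : ContinuousOn f₁ Ω := by
    refine continuousOn_extendFrom (fun z _ => hcl z) fun z hz => ?_
    by_cases hz0 : z.im = 0
    · have hzr : z = ((z.re : ℝ) : ℂ) := by apply Complex.ext <;> simp [hz0]
      obtain ⟨l, h1, h2⟩ := hlim z.re (fun he => hz _ he hzr)
      refine ⟨l, ?_⟩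
      rw [hA, nhdsWithin_im_ne_zero, hzr]
      exact h1.sup h2
    · exact ⟨f z, hf.continuousOn z hz0⟩
  have hd₁ : DifferentiableOn ℂ f₁ Ω := by
    refine differentiableOn_of_differentiableOn_off_real hΩo hc₁ fun z _ hz0 => ?_
    have h1 : DifferentiableAt ℂ f z := (hf z hz0).differentiableAt (hAo.mem_nhds hz0)
    refine h1.congr_of_eventuallyEq ?_
    filter_upwards [hAo.mem_nhds hz0] with w hw using hAe w hw
  have hbd₁ : ∀ e ∈ S, ∀ᶠ z : ℂ in 𝓝[≠] (e : ℂ), ∀ δ > 0, ∀ C : ℝ, (∀ z : ℂ, z.im ≠ 0 →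
        ‖z - e‖ < δ →
      ‖f z‖ ≤ C * ‖z - e‖ ^ (-(1 / 2) : ℝ)) → ‖z - e‖ < δ →
      ‖f₁ z‖ ≤ C * ‖z - e‖ ^ (-(1 / 2) : ℝ) := by
    intro e _
    filter_upwards [hS e, self_mem_nhdsWithin] with z hz hze δ hδ C hC hzδ
    have h1 : Tendsto (fun w => ‖f₁ w‖) (𝓝[A] z) (𝓝 ‖f₁ z‖) :=
      ((hc₁ z hz).continuousAt (hΩo.mem_nhds hz)).norm.mono_left nhdsWithin_le_nhds
    have hne : ‖z - e‖ ≠ 0 := norm_ne_zero_iff.2 (sub_ne_zero.2 hze)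
    have h2 : Tendsto (fun w : ℂ => C * ‖w - e‖ ^ (-(1 / 2) : ℝ)) (𝓝[A] z)
        (𝓝 (C * ‖z - e‖ ^ (-(1 / 2) : ℝ))) := by
      refine Tendsto.mono_left ?_ nhdsWithin_le_nhds
      have hcc : ContinuousAt (fun w : ℂ => ‖w - e‖) z := by fun_prop
      exact (hcc.rpow_const (Or.inl hne)).const_mul C
    have : (𝓝[A] z).NeBot := mem_closure_iff_nhdsWithin_neBot.1 (hcl z)
    refine le_of_tendsto_of_tendsto h1 h2 ?_
    have h3 : ∀ᶠ w : ℂ in 𝓝[A] z, ‖w - e‖ < δ :=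
      nhdsWithin_le_nhds ((by fun_prop : Continuous fun w : ℂ => ‖w - e‖).continuousAt.eventually_lt
        continuousAt_const hzδ)
    filter_upwards [h3, self_mem_nhdsWithin] with w hw hwA
    rw [hAe w hwA]
    exact hC w hwA hw
  refine ⟨fun z => limUnder (𝓝[≠] z) f₁, ?_, ?_⟩
  · have hΩeq : ∀ z ∈ Ω, limUnder (𝓝[≠] z) f₁ = f₁ z := fun z hz =>
      (((hc₁ z hz).continuousAt (hΩo.mem_nhds hz)).tendsto.mono_left nhdsWithin_le_nhds).limUnder_eq
    intro z
    by_cases hz : z ∈ Ω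
    · refine ((hd₁ z hz).differentiableAt (hΩo.mem_nhds hz)).congr_of_eventuallyEq ?_
      filter_upwards [hΩo.mem_nhds hz] with w hw using hΩeq w hw
    · simp only [hΩdef, Set.mem_ofPred_eq, not_forall, not_not] at hz
      obtain ⟨e, he, rfl⟩ := hz
      obtain ⟨δ, hδ, C, hC⟩ := hbd e he
      have hs := hS (e : ℂ)
      rw [eventually_nhdsWithin_iff] at hs
      set s : Set ℂ := {w | w ≠ (e : ℂ) → ∀ e' ∈ S, w ≠ (e' : ℂ)} with hsdef
      have hs' : s ∈ 𝓝 (e : ℂ) := hs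
      have hds : DifferentiableOn ℂ f₁ (s \ {(e : ℂ)}) := hd₁.mono fun w hw => hw.1 hw.2
      have hlo : (fun w => f₁ w - f₁ e) =o[𝓝[≠] (e : ℂ)] fun w => (w - e)⁻¹ := by
        have hinv : Tendsto (fun w : ℂ => ‖w - e‖) (𝓝[≠] (e : ℂ)) (𝓝 0) := by
          have : Tendsto (fun w : ℂ => ‖w - e‖) (𝓝 (e : ℂ)) (𝓝 ‖(e : ℂ) - e‖) :=
            (by fun_prop : Continuous fun w : ℂ => ‖w - e‖).tendsto _
          simpa using this.mono_left nhdsWithin_le_nhds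
        have hhalf : Tendsto (fun w : ℂ => ‖w - e‖ ^ (1 / 2 : ℝ)) (𝓝[≠] (e : ℂ)) (𝓝 0) := by
          have := hinv.rpow_const (p := (1 / 2 : ℝ)) (Or.inr (by norm_num))
          simpa using this
        refine Asymptotics.isLittleO_of_tendsto' ?_ ?_
        · filter_upwards [self_mem_nhdsWithin] with w hw h0
          exact absurd (sub_eq_zero.1 (inv_eq_zero.1 h0)) hw
        · refine squeeze_zero_norm' (a := fun w : ℂ => C * ‖w - e‖ ^ (1 / 2 : ℝ) + ‖f₁ e‖ * ‖w - e‖)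
            ?_ (by simpa using (hhalf.const_mul C).add (hinv.const_mul ‖f₁ e‖))
          filter_upwards [hbd₁ e he, self_mem_nhdsWithin,
            hinv.eventually (gt_mem_nhds hδ)] with w hw hwe hwδ
          have hb := hw δ hδ C hC hwδ
          have hpos : 0 < ‖w - e‖ := norm_pos_iff.2 (sub_ne_zero.2 hwe)
          rw [div_inv_eq_mul, norm_mul]
          calc ‖f₁ w - f₁ e‖ * ‖w - e‖ ≤ (‖f₁ w‖ + ‖f₁ e‖) * ‖w - e‖ := by
                gcongr; exact norm_sub_le _ _
            _ ≤ (C * ‖w - e‖ ^ (-(1 / 2) : ℝ) + ‖f₁ e‖) * ‖w - e‖ := by gcongr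
            _ = C * (‖w - e‖ ^ (-(1 / 2) : ℝ) * ‖w - e‖ ^ (1 : ℝ)) + ‖f₁ e‖ * ‖w - e‖ := by
                rw [Real.rpow_one]; ring
            _ = _ := by rw [← Real.rpow_add hpos]; norm_num
      have hupd := differentiableOn_update_limUnder_of_isLittleO hs' hds hlo
      refine (hupd.differentiableAt hs').congr_of_eventuallyEq ?_
      filter_upwards [hs'] with w hw
      by_cases hwe : w = e
      · subst hwe; simp
      · rw [Function.update_of_ne hwe]
        exact hΩeq w (hw hwe)
  · intro z hz
    have hzΩ : z ∈ Ω := fun e _ h => hz (by simp [h])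
    have : limUnder (𝓝[≠] z) f₁ = f₁ z :=
      (((hc₁ z hzΩ).continuousAt (hΩo.mem_nhds hzΩ)).tendsto.mono_left
        nhdsWithin_le_nhds).limUnder_eq
    simpa [this] using hAe z hz

end NLSPeriodic

namespace NLSPeriodic

/-- Phragmén–Lindelöf in a narrow sector around the positive real axis, for entire functions of
finite order. -/
theorem norm_le_of_abs_arg_le {f : ℂ → ℂ} (hf : Differentiable ℂ f) {n : ℕ} (hn : 1 ≤ n)
    {M c : ℝ} (hg : ∀ z, ‖f z‖ ≤ M * Real.exp (c * ‖z‖ ^ n)) {C : ℝ}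
    (hp : ∀ s : ℝ, 0 ≤ s → ‖f (s * exp ((Real.pi / (8 * n) : ℝ) * I))‖ ≤ C)
    (hm : ∀ s : ℝ, 0 ≤ s → ‖f (s * exp (-(Real.pi / (8 * n) : ℝ) * I))‖ ≤ C)
    {z : ℂ} (hz : |arg z| ≤ Real.pi / (8 * n)) : ‖f z‖ ≤ C := by
  have hn0 : (0 : ℝ) < n := by exact_mod_cast hn
  have hnC : (n : ℂ) ≠ 0 := by exact_mod_cast hn0.ne'
  set θ : ℝ := Real.pi / (8 * n) with hθ
  have hθn : 2 * n * θ = Real.pi / 4 := by rw [hθ]; field_simp; norm_num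
  set α : ℝ := 1 / (2 * n) with hα
  have hα0 : 0 < α := by positivity
  rcases eq_or_ne z 0 with rfl | hz0
  · simpa using hp 0 le_rfl
  set g : ℂ → ℂ := fun w => f (exp (-θ * I) * w ^ (α : ℂ)) with hgdef
  have hnorm1 : ‖exp (-θ * I)‖ = 1 := by
    have := norm_exp_ofReal_mul_I (-θ)
    push_cast at this
    exact this
  have hcl : closure (Set.Ioi 0 ×ℂ Set.Ioi 0) ⊆ {w : ℂ | 0 ≤ w.re} := by
    refine closure_minimal (fun w hw => ?_) (isClosed_le continuous_const continuous_re)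
    have : 0 < w.re := hw.1
    exact this.le
  have hdc : DiffContOnCl ℂ g (Set.Ioi 0 ×ℂ Set.Ioi 0) := by
    constructor
    · intro w hw
      have hw' : w ∈ slitPlane := Or.inl hw.1
      have h1 : DifferentiableAt ℂ (fun w : ℂ => w ^ (α : ℂ)) w :=
        differentiableAt_id.cpow_const hw'
      exact (hf.differentiableAt.comp w (h1.const_mul _)).differentiableWithinAt
    · intro w hw
      have h1 : ContinuousAt (fun w : ℂ => w ^ (α : ℂ)) w :=
        continuousAt_cpow_const_of_re_pos (Or.inl (hcl hw)) (by simpa using hα0)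
      exact (hf.continuous.continuousAt.comp (continuousAt_const.mul h1)).continuousWithinAt
  have hgrow : ∀ w, ‖g w‖ ≤ M * Real.exp (c * ‖w‖ ^ (1 / 2 : ℝ)) := by
    intro w
    have h1 := hg (exp (-θ * I) * w ^ (α : ℂ))
    rw [norm_mul, hnorm1, one_mul, norm_cpow_real, ← Real.rpow_natCast,
        ← Real.rpow_mul (norm_nonneg _)] at h1
    have : α * n = 1 / 2 := by rw [hα]; field_simp
    rw [this] at h1
    exact h1
  have hre : ∀ x : ℝ, 0 ≤ x → ‖g x‖ ≤ C := by
    intro x hx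
    have := hm (x ^ α) (by positivity)
    rw [hgdef]
    simp only
    rw [← ofReal_cpow hx, mul_comm]
    exact this
  have him : ∀ x : ℝ, 0 ≤ x → ‖g (x * I)‖ ≤ C := by
    intro x hx
    have h2 := hp (x ^ α) (by positivity)
    have key : exp (-θ * I) * (x * I) ^ (α : ℂ) = ((x ^ α : ℝ) : ℂ) * exp (θ * I) := by
      rcases hx.eq_or_lt with rfl | hx
      · simp [Real.zero_rpow hα0.ne', zero_cpow (by exact_mod_cast hα0.ne' : (α : ℂ) ≠ 0)]
      · rw [cpow_def_of_ne_zero (by simp [hx.ne']), log_ofReal_mul hx I_ne_zero, log_I,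
          ofReal_cpow hx.le, cpow_def_of_ne_zero (by simp [hx.ne']), ← ofReal_log hx.le, ← exp_add,
          ← exp_add]
        congr 1
        have : (α : ℂ) * Real.pi = 4 * θ := by
          rw [hα, hθ]; push_cast; field_simp; norm_num
        linear_combination (I / 2) * this
    rw [hgdef]
    simp only
    rw [key]
    exact h2
  set u : ℂ := 2 * n * (log z + θ * I) with hu
  have huim : u.im = 2 * n * (arg z + θ) := by
    have : u = ((2 * n : ℝ) : ℂ) * (log z + θ * I) := by rw [hu]; push_cast; ring
    rw [this, im_ofReal_mul]; simp [log_im]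
  obtain ⟨hz1, hz2⟩ := abs_le.1 hz
  have hu0 : 0 ≤ u.im := by rw [huim]; have : 0 ≤ arg z + θ := by linarith
                            positivity
  have hu1 : u.im ≤ Real.pi / 2 := by
    rw [huim]; nlinarith
  have hpi := Real.pi_pos
  have hexp : exp (-θ * I) * (exp u) ^ (α : ℂ) = z := by
    rw [cpow_def_of_ne_zero (exp_ne_zero _), log_exp (by linarith) (by linarith), ← exp_add]
    have : -θ * I + u * α = log z := by
      rw [hu, hα]; push_cast; field_simp; ring
    rw [this, exp_log hz0]
  have hfin := PhragmenLindelof.quadrant_I (f := g) (C := C) (z := exp u) hdc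
    ⟨1 / 2, by norm_num, c, Asymptotics.IsBigO.of_bound M (Eventually.of_forall fun w => by
      rw [Real.norm_of_nonneg (Real.exp_pos _).le]; exact hgrow w)⟩ hre him
    (by rw [exp_re]; exact mul_nonneg (Real.exp_pos _).le
          (Real.cos_nonneg_of_neg_pi_div_two_le_of_le (by linarith) hu1))
    (by rw [exp_im]; exact mul_nonneg (Real.exp_pos _).le
          (Real.sin_nonneg_of_nonneg_of_le_pi hu0 (by linarith)))
  rw [hgdef] at hfin
  simp only [hexp] at hfin
  exact hfin

theorem norm_le_of_re_nonneg {f : ℂ → ℂ} (hf : Differentiable ℂ f) {n : ℕ} (hn : 1 ≤ n)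
    {M c : ℝ} (hg : ∀ z, ‖f z‖ ≤ M * Real.exp (c * ‖z‖ ^ n))
    (hsec : ∀ ε > 0, ∃ C, ∀ z ∈ sector ε, ‖f z‖ ≤ C * Real.exp (C * √‖z‖)) {C : ℝ}
    (him : ∀ y : ℝ, ‖f (y * I)‖ ≤ C) {z : ℂ} (hz : 0 ≤ z.re) : ‖f z‖ ≤ C := by
  have hn0 : (0 : ℝ) < n := by exact_mod_cast hn
  have hn1 : (1 : ℝ) ≤ n := by exact_mod_cast hn
  have hpi := Real.pi_pos
  set θ : ℝ := Real.pi / (8 * n) with hθ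
  have hθ0 : 0 < θ := by positivity
  have hθ1 : θ < Real.pi / 2 := by
    rw [hθ, div_lt_div_iff₀ (by positivity) (by norm_num)]; nlinarith
  have hsin : 0 < Real.sin θ := Real.sin_pos_of_pos_of_lt_pi hθ0 (by linarith)
  have hcos : 0 < Real.cos θ := Real.cos_pos_of_mem_Ioo ⟨by linarith, hθ1⟩
  obtain ⟨C₁, hC₁⟩ := hsec _ hsin
  have hM0 : 0 ≤ M := by
    have := (norm_nonneg _).trans (hg 0)
    exact nonneg_of_mul_nonneg_left this (Real.exp_pos _)
  have hC₁0 : 0 ≤ C₁ := by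
    have := (norm_nonneg _).trans (hC₁ 0 (by simp [sector]))
    exact nonneg_of_mul_nonneg_left this (Real.exp_pos _)
  suffices H : ∀ δ > 0, ‖f z‖ * Real.exp (-δ * z.re) ≤ C by
    have ht : Tendsto (fun δ : ℝ => ‖f z‖ * Real.exp (-δ * z.re)) (𝓝[>] 0) (𝓝 ‖f z‖) := by
      have : Tendsto (fun δ : ℝ => ‖f z‖ * Real.exp (-δ * z.re)) (𝓝 0)
          (𝓝 (‖f z‖ * Real.exp (-0 * z.re))) :=
        (by fun_prop : Continuous fun δ : ℝ => ‖f z‖ * Real.exp (-δ * z.re)).tendsto 0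
      simpa using this.mono_left nhdsWithin_le_nhds
    refine le_of_tendsto ht ?_
    filter_upwards [self_mem_nhdsWithin] with δ hδ using H δ hδ
  intro δ hδ
  set G : ℂ → ℂ := fun z => f z * exp (-δ * z) with hG
  have hGd : Differentiable ℂ G := hf.mul (by fun_prop)
  have hGn : ∀ z, ‖G z‖ = ‖f z‖ * Real.exp (-δ * z.re) := by
    intro z
    rw [hG]
    simp only
    rw [norm_mul, norm_exp]
    congr 2
    have : -(δ : ℂ) * z = ((-δ : ℝ) : ℂ) * z := by push_cast; ring
    rw [this, re_ofReal_mul]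
  rw [← hGn]
  have hGg : ∀ z, ‖G z‖ ≤ M * Real.exp δ * Real.exp ((c + δ) * ‖z‖ ^ n) := by
    intro z
    rw [hGn, mul_assoc, ← Real.exp_add]
    have h1 : ‖z‖ ≤ 1 + ‖z‖ ^ n := by
      rcases le_total ‖z‖ 1 with h | h
      · have : 0 ≤ ‖z‖ ^ n := by positivity
        linarith
      · have := le_self_pow₀ h (by omega : n ≠ 0)
        linarith
    have h2 : -δ * z.re ≤ δ * ‖z‖ := by
      have := neg_le_of_abs_le (abs_re_le_norm z)
      nlinarith
    calc ‖f z‖ * Real.exp (-δ * z.re) ≤ (M * Real.exp (c * ‖z‖ ^ n)) * Real.exp (δ * (1 + ‖z‖ ^ n)) := by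
          have h3 : -δ * z.re ≤ δ * (1 + ‖z‖ ^ n) := h2.trans (by gcongr)
          exact mul_le_mul (hg z) (Real.exp_le_exp.2 h3) (Real.exp_pos _).le
            ((norm_nonneg _).trans (hg z))
      _ = _ := by rw [mul_assoc, ← Real.exp_add]; congr 2; ring
  set C₂ : ℝ := C₁ * Real.exp (C₁ ^ 2 / (4 * (δ * Real.cos θ))) with hC₂
  have hC₂0 : 0 ≤ C₂ := by positivity
  have hray : ∀ (s : ℝ) (w : ℂ), 0 ≤ s → w.re = s * Real.cos θ → |w.im| = s * Real.sin θ →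
      ‖w‖ = s → ‖G w‖ ≤ C₂ := by
    intro s w hs hre him hnorm
    rw [hGn]
    have h1 := hC₁ w (by rw [sector, Set.mem_ofPred_eq, hnorm, him, mul_comm])
    calc _ ≤ C₁ * Real.exp (C₁ * √‖w‖) * Real.exp (-δ * w.re) := by gcongr
      _ = C₁ * Real.exp (C₁ * √s - δ * (s * Real.cos θ)) := by
          rw [mul_assoc, ← Real.exp_add, hre, hnorm]; ring_nf
      _ ≤ C₂ := by
          rw [hC₂]
          gcongr
          have hd : 0 < δ * Real.cos θ := by positivity
          rw [le_div_iff₀ (by positivity)]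
          have hs2 := Real.sq_sqrt hs
          have key : C₁ ^ 2 - (C₁ * √s - δ * (s * Real.cos θ)) * (4 * (δ * Real.cos θ)) =
              (C₁ - 2 * (δ * Real.cos θ) * √s) ^ 2 := by
            linear_combination (-4 * (δ * Real.cos θ) ^ 2) * hs2
          nlinarith [sq_nonneg (C₁ - 2 * (δ * Real.cos θ) * √s)]
  have hsectorG : ∀ w : ℂ, |arg w| ≤ θ → ‖G w‖ ≤ C₂ := by
    intro w hw
    have hpol : ∀ (s φ : ℝ), ((s : ℂ) * exp (φ * I)).re = s * Real.cos φ ∧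
        ((s : ℂ) * exp (φ * I)).im = s * Real.sin φ := by
      intro s φ
      rw [re_ofReal_mul, im_ofReal_mul, exp_ofReal_mul_I_re, exp_ofReal_mul_I_im]
      exact ⟨rfl, rfl⟩
    refine norm_le_of_abs_arg_le hGd hn hGg (fun s hs => ?_) (fun s hs => ?_) hw
    · obtain ⟨h1, h2⟩ := hpol s θ
      refine hray s _ hs h1 ?_ ?_
      · rw [h2, abs_of_nonneg (by positivity)]
      · rw [norm_mul, norm_exp_ofReal_mul_I, mul_one, norm_real, Real.norm_of_nonneg hs]
    · obtain ⟨h1, h2⟩ := hpol s (-θ)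
      push_cast at h1 h2
      refine hray s _ hs (by rw [h1, Real.cos_neg]) ?_ ?_
      · rw [h2, Real.sin_neg, mul_neg, abs_neg, abs_of_nonneg (by positivity)]
      · have := norm_exp_ofReal_mul_I (-θ)
        push_cast at this
        rw [norm_mul, this, mul_one, norm_real, Real.norm_of_nonneg hs]
  refine PhragmenLindelof.right_half_plane_of_bounded_on_real hGd.diffContOnCl
    ⟨1, by norm_num, C₁, ?_⟩ ?_ ?_ hz
  · refine Asymptotics.IsBigO.of_bound (C₂ + C₁ * Real.exp C₁) ?_
    filter_upwards [mem_inf_of_right (mem_principal_self _)] with w hw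
    have hw : 0 < w.re := hw
    rw [Real.norm_of_nonneg (Real.exp_pos _).le, Real.rpow_one]
    have hone : 1 ≤ Real.exp (C₁ * ‖w‖) := Real.one_le_exp (by positivity)
    by_cases hwa : |arg w| ≤ θ
    · calc ‖G w‖ ≤ C₂ * 1 := by simpa using hsectorG w hwa
        _ ≤ (C₂ + C₁ * Real.exp C₁) * Real.exp (C₁ * ‖w‖) := by
          gcongr
          have : 0 ≤ C₁ * Real.exp C₁ := by positivity
          linarith
    · push Not at hwa
      have hlt : |arg w| < Real.pi / 2 := abs_arg_lt_pi_div_two_iff.2 (Or.inl hw)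
      have hws : w ∈ sector (Real.sin θ) := by
        have h1 : w.im = ‖w‖ * Real.sin (arg w) := (norm_mul_sin_arg w).symm
        have h2 : |Real.sin (arg w)| = Real.sin |arg w| := by
          rcases abs_cases (arg w) with ⟨h, h'⟩ | ⟨h, h'⟩
          · rw [h, abs_of_nonneg (Real.sin_nonneg_of_nonneg_of_le_pi h' (by linarith))]
          · rw [h, Real.sin_neg, abs_of_neg]
            exact Real.sin_neg_of_neg_of_neg_pi_lt h' (by linarith)
        rw [sector, Set.mem_ofPred_eq, h1, abs_mul, abs_of_nonneg (norm_nonneg w), h2, mul_comm]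
        gcongr
        exact Real.sin_le_sin_of_le_of_le_pi_div_two (by linarith) hlt.le hwa.le
      have hsq : √‖w‖ ≤ 1 + ‖w‖ := by
        have h1 := Real.sq_sqrt (norm_nonneg w)
        nlinarith [sq_nonneg (√‖w‖ - 1), Real.sqrt_nonneg ‖w‖]
      have hle1 : Real.exp (-δ * w.re) ≤ 1 := Real.exp_le_one_iff.2 (by nlinarith)
      rw [hGn]
      calc ‖f w‖ * Real.exp (-δ * w.re) ≤ C₁ * Real.exp (C₁ * √‖w‖) * 1 := by
            gcongr
            exact hC₁ w hws
        _ ≤ C₁ * Real.exp (C₁ * (1 + ‖w‖)) := by rw [mul_one]; gcongr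
        _ = C₁ * Real.exp C₁ * Real.exp (C₁ * ‖w‖) := by
            rw [mul_assoc, ← Real.exp_add]; congr 2; ring
        _ ≤ _ := by gcongr; linarith
  · refine isBoundedUnder_of_eventually_le (a := C₂) ?_
    filter_upwards [eventually_ge_atTop 0] with x hx
    exact hsectorG x (by rw [arg_ofReal_of_nonneg hx]; simpa using hθ0.le)
  · intro y
    rw [hGn]
    simpa using him y

/-- An entire function of finite order that is `exp (O(√|z|))` in every double sector around the
imaginary axis and bounded on that axis is constant. -/
theorem eq_of_sector_growth {f : ℂ → ℂ} (hf : Differentiable ℂ f) {n : ℕ} (hn : 1 ≤ n)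
    {M c : ℝ} (hg : ∀ z, ‖f z‖ ≤ M * Real.exp (c * ‖z‖ ^ n))
    (hsec : ∀ ε > 0, ∃ C, ∀ z ∈ sector ε, ‖f z‖ ≤ C * Real.exp (C * √‖z‖)) {C : ℝ}
    (him : ∀ y : ℝ, ‖f (y * I)‖ ≤ C) (z w : ℂ) : f z = f w := by
  refine hf.apply_eq_apply_of_bounded ?_ z w
  refine isBounded_iff_forall_norm_le.2 ⟨C, ?_⟩
  rintro _ ⟨u, rfl⟩
  rcases le_total 0 u.re with hu | hu
  · exact norm_le_of_re_nonneg hf hn hg hsec him hu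
  · have := norm_le_of_re_nonneg (f := fun z => f (-z)) (M := M) (c := c) (C := C) (z := -u)
      (hf.comp differentiable_neg) hn
      (fun z => by simpa using hg (-z))
      (fun ε hε => by
        obtain ⟨C, hC⟩ := hsec ε hε
        exact ⟨C, fun z hz => by simpa using hC (-z) (by simpa [sector] using hz)⟩)
      (fun y => by simpa using him (-y)) (by simpa using hu)
    simpa using this

end NLSPeriodic

namespace NLSPeriodic

theorem exists_log_on_ball {f : ℂ → ℂ} {c : ℂ} {r : ℝ} (hr : 0 < r)
    (hf : DifferentiableOn ℂ f (Metric.ball c r)) (h0 : ∀ z ∈ Metric.ball c r, f z ≠ 0) :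
    ∃ g : ℂ → ℂ, DifferentiableOn ℂ g (Metric.ball c r) ∧ ∀ z ∈ Metric.ball c r,
      exp (g z) = f z := by
  have hd : DifferentiableOn ℂ (fun z => deriv f z / f z) (Metric.ball c r) :=
    (hf.deriv Metric.isOpen_ball).div hf h0
  obtain ⟨g, hgc, hg⟩ := hd.isExactOn_ball.with_val_at c (log (f c))
  have hgd : DifferentiableOn ℂ g (Metric.ball c r) := fun z hz =>
    (hg z hz).differentiableAt.differentiableWithinAt
  refine ⟨g, hgd, fun z hz => ?_⟩
  have hfd : ∀ z ∈ Metric.ball c r, HasDerivAt f (deriv f z) z := fun z hz =>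
    ((hf z hz).differentiableAt (Metric.isOpen_ball.mem_nhds hz)).hasDerivAt
  have hconst := Metric.isOpen_ball.is_const_of_deriv_eq_zero
    (f := fun z => f z * exp (-g z)) (convex_ball c r).isPreconnected (hf.mul hgd.neg.cexp)
    (fun w hw => by
      have h1 := (hfd w hw).mul (hg w hw).neg.cexp
      rw [Pi.zero_apply]
      refine h1.deriv.trans ?_
      have := h0 w hw
      field_simp
      ring) hz (Metric.mem_ball_self hr)
  have hc0 := h0 c (Metric.mem_ball_self hr)
  simp only [hgc, exp_neg, exp_log hc0] at hconst
  rw [mul_inv_cancel₀ hc0, mul_inv_eq_one₀ (exp_ne_zero _)] at hconst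
  exact hconst.symm

/-- Borel–Carathéodory lower bound for a zero-free function in the upper half-plane. -/
theorem exists_norm_inv_le {h : ℂ → ℂ} (hd : DifferentiableOn ℂ h upperHalf)
    (h0 : ∀ z ∈ upperHalf, h z ≠ 0) {M c : ℝ} (hc : 0 ≤ c)
    (hg : ∀ z ∈ upperHalf, ‖h z‖ ≤ M * Real.exp (c * ‖z‖ ^ 2))
    {ρ : ℝ} (hs : ∀ z ∈ sector (1 / 2), ρ ≤ ‖z‖ → 1 / 2 ≤ ‖h z‖) :
    ∃ K > 0, ∀ z ∈ upperHalf, ‖(h z)⁻¹‖ ≤ Real.exp (K * (1 + ‖z‖) ^ 3 * (1 + 1 / z.im)) := by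
  set ρ' := max ρ 1 with hρ'
  set M' := max M 1 with hM'
  set A₀ := Real.log (2 * M') + 9 * c with hA₀
  have hM1 : 1 ≤ M' := le_max_right _ _
  have hρ1 : 1 ≤ ρ' := le_max_right _ _
  have hlog : 0 < Real.log (2 * M') := Real.log_pos (by linarith)
  have hA₀0 : 0 < A₀ := by positivity
  have hlog2 : 0 < Real.log 2 := Real.log_pos (by norm_num)
  refine ⟨Real.log 2 + 2 * A₀ * ρ' ^ 3, by positivity, fun z hz => ?_⟩
  have hy : 0 < z.im := hz
  set Y := ‖z‖ + ρ' with hY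
  have hn := norm_nonneg z
  have hY1 : 1 ≤ Y := by linarith
  have hY0 : 0 < Y := by linarith
  set z₀ : ℂ := ⟨z.re, Y⟩ with hz₀
  have hYle : Y ≤ ‖z₀‖ := by
    have := abs_im_le_norm z₀
    simp only [hz₀] at this ⊢
    exact (le_abs_self Y).trans this
  have hz₀le : ‖z₀‖ ≤ 2 * Y := by
    have h1 := norm_le_abs_re_add_abs_im z₀
    have h2 := abs_re_le_norm z
    simp only [hz₀, abs_of_pos hY0] at h1 ⊢
    linarith
  have hz₀s : 1 / 2 ≤ ‖h z₀‖ := by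
    refine hs z₀ ?_ (le_trans (by linarith [le_max_left ρ 1]) hYle)
    have : |z₀.im| = Y := abs_of_pos hY0
    rw [sector, Set.mem_ofPred_eq, this]
    linarith
  have hball : Metric.ball z₀ Y ⊆ upperHalf := by
    intro w hw
    rw [mem_ball_iff_norm] at hw
    have h1 := (abs_im_le_norm (w - z₀)).trans_lt hw
    rw [sub_im, abs_lt] at h1
    change 0 < w.im
    have : z₀.im = Y := rfl
    linarith [h1.1]
  obtain ⟨g, hgd, hge⟩ := exists_log_on_ball hY0 (hd.mono hball) (fun w hw => h0 w (hball hw))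
  have hre : ∀ w ∈ Metric.ball z₀ Y, ‖h w‖ = Real.exp (g w).re := fun w hw => by
    rw [← hge w hw, norm_exp]
  have hself := Metric.mem_ball_self hY0 (x := z₀)
  have hz₀re : -Real.log 2 ≤ (g z₀).re := by
    rw [hre z₀ hself] at hz₀s
    have := Real.log_le_log (by norm_num) hz₀s
    rwa [Real.log_exp, one_div, Real.log_inv] at this
  have hmem : z - z₀ ∈ Metric.ball (0 : ℂ) Y ∧ ‖z - z₀‖ = Y - z.im := by
    have h1 : z - z₀ = ((z.im - Y : ℝ) : ℂ) * I := by
      apply Complex.ext <;> simp [hz₀]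
    have h2 : z.im ≤ Y := by
      have := (le_abs_self _).trans (abs_im_le_norm z)
      linarith
    have h3 : ‖z - z₀‖ = Y - z.im := by
      rw [h1, norm_mul, norm_I, mul_one, norm_real, Real.norm_eq_abs, abs_sub_comm,
        abs_of_nonneg (by linarith)]
    exact ⟨by rw [mem_ball_zero_iff, h3]; linarith, h3⟩
  have hAM : Real.log (2 * M') + 9 * c * Y ^ 2 ≤ A₀ * Y ^ 2 := by
    rw [hA₀]; nlinarith [one_le_pow₀ hY1 (n := 2)]
  have hshift : ∀ w ∈ Metric.ball (0 : ℂ) Y, z₀ + w ∈ Metric.ball z₀ Y := by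
    intro w hw; simpa using hw
  have hBC := borelCaratheodory_zero (f := fun w => g (z₀ + w) - g z₀) (M := A₀ * Y ^ 2) (R := Y)
    (z := z - z₀) (by positivity)
    (((hgd.comp (by fun_prop : DifferentiableOn ℂ (fun w => z₀ + w) (Metric.ball 0 Y)) hshift)).sub
      (differentiableOn_const _))
    (fun w hw => by
      have hb := hshift w hw
      have h1 := hg _ (hball hb)
      rw [hre _ hb] at h1
      have hwn : ‖z₀ + w‖ ≤ 3 * Y := by
        have := norm_add_le z₀ w
        have := mem_ball_zero_iff.1 hw
        linarith
      have h2 : Real.exp (g (z₀ + w)).re ≤ M' * Real.exp (9 * c * Y ^ 2) := by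
        refine h1.trans ?_
        have : c * ‖z₀ + w‖ ^ 2 ≤ 9 * c * Y ^ 2 := by
          have : ‖z₀ + w‖ ^ 2 ≤ (3 * Y) ^ 2 := by gcongr
          nlinarith
        exact mul_le_mul (le_max_left _ _) (Real.exp_le_exp.2 this) (Real.exp_pos _).le (by linarith)
      have h3 := Real.log_le_log (Real.exp_pos _) h2
      rw [Real.log_exp, Real.log_mul (by positivity) (Real.exp_pos _).ne', Real.log_exp] at h3
      rw [Set.mem_ofPred_eq, sub_re]
      rw [Real.log_mul (by norm_num) (by positivity)] at hAM
      linarith) hY0 hmem.1 (by simp)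
  simp only [add_sub_cancel] at hBC
  rw [hmem.2] at hBC
  have hzb : z ∈ Metric.ball z₀ Y := by simpa using hshift _ hmem.1
  have hre2 : (g z₀).re - (g z).re ≤ 2 * A₀ * Y ^ 3 / z.im := by
    have h1 := (neg_le_abs _).trans ((abs_re_le_norm _).trans hBC)
    rw [sub_re] at h1
    have h2 : 2 * (A₀ * Y ^ 2) * (Y - z.im) / (Y - (Y - z.im)) ≤ 2 * A₀ * Y ^ 3 / z.im := by
      rw [sub_sub_cancel]
      refine div_le_div_of_nonneg_right ?_ hy.le
      have : 0 ≤ A₀ * Y ^ 2 * z.im := by positivity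
      nlinarith
    linarith
  rw [norm_inv, hre z hzb, ← Real.exp_neg]
  refine Real.exp_le_exp.2 ?_
  have hYle2 : Y ≤ ρ' * (1 + ‖z‖) := by nlinarith
  have hY3 : Y ^ 3 ≤ ρ' ^ 3 * (1 + ‖z‖) ^ 3 := by
    rw [← mul_pow]; gcongr
  have hz3 : 1 ≤ (1 + ‖z‖) ^ 3 := one_le_pow₀ (by linarith)
  have hinv : 0 < 1 / z.im := by positivity
  calc -(g z).re ≤ Real.log 2 + 2 * A₀ * Y ^ 3 / z.im := by linarith
    _ = Real.log 2 * 1 + 2 * A₀ * Y ^ 3 * (1 / z.im) := by ring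
    _ ≤ Real.log 2 * ((1 + ‖z‖) ^ 3 * (1 + 1 / z.im)) +
        2 * A₀ * (ρ' ^ 3 * (1 + ‖z‖) ^ 3) * (1 + 1 / z.im) := by
      gcongr
      · nlinarith
      · linarith
    _ = _ := by ring

/-- An entire function with the bound `exp (K (1 + |z|)³ (1 + 1 / |Im z|))` off the real axis
has finite order. -/
theorem exists_cubic_growth {T : ℂ → ℂ} (hT : Differentiable ℂ T) {K : ℝ} (hK : 0 < K)
    (hb : ∀ z : ℂ, z.im ≠ 0 → ‖T z‖ ≤ Real.exp (K * (1 + ‖z‖) ^ 3 * (1 + 1 / |z.im|))) :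
    ∃ M c : ℝ, ∀ z, ‖T z‖ ≤ M * Real.exp (c * ‖z‖ ^ 3) := by
  suffices H : ∀ z, ‖T z‖ ≤ Real.exp (40 * K * (1 + ‖z‖) ^ 3) by
    refine ⟨Real.exp (160 * K), 160 * K, fun z => (H z).trans ?_⟩
    rw [← Real.exp_add]
    refine Real.exp_le_exp.2 ?_
    have hn := norm_nonneg z
    have : (1 + ‖z‖) ^ 3 ≤ 4 + 4 * ‖z‖ ^ 3 := by
      nlinarith [mul_nonneg (by linarith : 0 ≤ 1 + ‖z‖) (sq_nonneg (‖z‖ - 1))]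
    nlinarith
  intro z
  by_cases hzim : 1 / 2 ≤ |z.im|
  · have h0 : z.im ≠ 0 := by intro h; rw [h] at hzim; norm_num at hzim
    refine (hb z h0).trans (Real.exp_le_exp.2 ?_)
    have h1 : 1 / |z.im| ≤ 2 := by
      rw [div_le_iff₀ (by linarith)]; linarith
    have h2 : 0 < K * (1 + ‖z‖) ^ 3 := by positivity
    nlinarith
  push Not at hzim
  set x₀ := z.re with hx₀
  set K₁ := K * (2 + |x₀|) ^ 3 with hK₁
  have hK₁0 : 0 < K₁ := by positivity
  set V : Set ℂ := {ζ | |ζ.re| + |ζ.im| < 1} with hV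
  have hcont : Continuous fun ζ : ℂ => |ζ.re| + |ζ.im| := by fun_prop
  have hVo : IsOpen V := isOpen_lt hcont continuous_const
  have hVb : Bornology.IsBounded V := by
    refine isBounded_iff_forall_norm_le.2 ⟨1, fun ζ hζ => ?_⟩
    exact (norm_le_abs_re_add_abs_im ζ).trans (le_of_lt hζ)
  have hre : ∀ ζ : ℂ, (1 - ζ ^ 2).re = 1 - ζ.re ^ 2 + ζ.im ^ 2 := by
    intro ζ; simp [sq, mul_re]; ring
  have him : ∀ ζ : ℂ, (1 - ζ ^ 2).im = -(2 * (ζ.re * ζ.im)) := by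
    intro ζ; simp [sq, mul_im]; ring
  have hVpos : ∀ ζ ∈ V, 0 < (1 - ζ ^ 2).re := by
    intro ζ hζ
    have hζ : |ζ.re| + |ζ.im| < 1 := hζ
    rw [hre]
    have h1 := abs_nonneg ζ.im
    have h2 := abs_nonneg ζ.re
    nlinarith [sq_abs ζ.re, sq_nonneg ζ.im]
  have hVnorm : ∀ ζ ∈ V, normSq (1 - ζ ^ 2) ≤ 2 * (1 - ζ ^ 2).re ^ 2 := by
    intro ζ hζ
    have hpos := hVpos ζ hζ
    have hζ : |ζ.re| + |ζ.im| < 1 := hζ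
    have h1 := abs_nonneg ζ.im
    have h2 := abs_nonneg ζ.re
    have habs : |(1 - ζ ^ 2).im| ≤ (1 - ζ ^ 2).re := by
      rw [him, hre, abs_neg, abs_mul, abs_mul, abs_two]
      nlinarith [sq_abs ζ.re, sq_nonneg ζ.im, sq_nonneg (1 - |ζ.re|)]
    rw [normSq_apply]
    have := sq_le_sq' (by linarith [abs_nonneg (1 - ζ ^ 2).im]) habs
    rw [sq_abs] at this
    nlinarith
  have hne : ∀ ζ ∈ V, 1 - ζ ^ 2 ≠ 0 := by
    intro ζ hζ h0
    have := hVpos ζ hζ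
    rw [h0] at this
    simp at this
  set A := 4 * K₁ with hA
  set f : ℂ → ℂ := fun ζ => T (x₀ + ζ) * exp (-A * (1 - ζ ^ 2)⁻¹) with hf
  have hfn : ∀ ζ, ‖f ζ‖ = ‖T (x₀ + ζ)‖ * Real.exp (-A * ((1 - ζ ^ 2).re / normSq (1 - ζ ^ 2))) := by
    intro ζ
    rw [hf]
    simp only
    rw [norm_mul, norm_exp]
    have : (-(A : ℂ) * (1 - ζ ^ 2)⁻¹).re = -A * ((1 - ζ ^ 2).re / normSq (1 - ζ ^ 2)) := by
      have h1 : -(A : ℂ) * (1 - ζ ^ 2)⁻¹ = ((-A : ℝ) : ℂ) * (1 - ζ ^ 2)⁻¹ := by push_cast; ring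
      rw [h1, re_ofReal_mul, inv_re]
    rw [this]
  have hfd : ∀ ζ, 1 - ζ ^ 2 ≠ 0 → DifferentiableAt ℂ f ζ := by
    intro ζ hζ
    refine (hT.differentiableAt.comp ζ (by fun_prop)).mul ?_
    exact ((((by fun_prop : DifferentiableAt ℂ (fun ζ : ℂ => 1 - ζ ^ 2) ζ).inv hζ)).const_mul _).cexp
  have hfr : ∀ ζ ∈ frontier V, |ζ.re| + |ζ.im| = 1 := by
    intro ζ hζ
    refine le_antisymm ?_ ?_
    · exact closure_minimal (fun w hw => le_of_lt hw) (isClosed_le hcont continuous_const) hζ.1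
    · have := hζ.2
      rw [hVo.interior_eq, hV, Set.mem_ofPred_eq, not_lt] at this
      exact this
  have hbound : ∀ ζ ∈ V, ‖f ζ‖ ≤ Real.exp K₁ := by
    refine norm_le_of_frontier_limsup hVo hVb
      (fun ζ hζ => (hfd ζ (hne ζ hζ)).differentiableWithinAt) ?_
    intro ζ hζ C' hC'
    have h1 := hfr ζ hζ
    by_cases h0 : ζ.im = 0
    · have hzero : 1 - ζ ^ 2 = 0 := by
        have h2 : ζ.re ^ 2 = 1 := by
          rw [h0, abs_zero, add_zero] at h1
          rw [← sq_abs, h1, one_pow]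
        apply Complex.ext
        · rw [hre, h2, h0]; simp
        · rw [him, h0]; simp
      have hct : Continuous fun w : ℂ => ‖T (x₀ + w)‖ * (2 * ‖1 - w ^ 2‖ / A) :=
        (hT.continuous.comp (by fun_prop)).norm.mul (by fun_prop)
      have hev : ∀ᶠ w in 𝓝 ζ, ‖T (x₀ + w)‖ * (2 * ‖1 - w ^ 2‖ / A) < C' := by
        refine hct.continuousAt.eventually_lt continuousAt_const ?_
        rw [hzero]
        simpa using (Real.exp_pos _).trans hC'
      filter_upwards [nhdsWithin_le_nhds hev, self_mem_nhdsWithin] with w hw hwV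
      refine le_trans ?_ hw.le
      rw [hfn]
      refine mul_le_mul_of_nonneg_left ?_ (norm_nonneg _)
      have hpos := hVpos w hwV
      have hnp : 0 < ‖1 - w ^ 2‖ := norm_pos_iff.2 (hne w hwV)
      have hq : 1 / (2 * ‖1 - w ^ 2‖) ≤ (1 - w ^ 2).re / normSq (1 - w ^ 2) := by
        have h3 := hVnorm w hwV
        have h4 : normSq (1 - w ^ 2) = ‖1 - w ^ 2‖ ^ 2 := normSq_eq_norm_sq _
        have h5 := (le_abs_self _).trans (abs_re_le_norm (1 - w ^ 2))
        rw [h4] at h3 ⊢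
        rw [div_le_div_iff₀ (by positivity) (by positivity)]
        nlinarith
      have hA0 : 0 < A := by positivity
      calc Real.exp (-A * ((1 - w ^ 2).re / normSq (1 - w ^ 2)))
          ≤ Real.exp (-(A / (2 * ‖1 - w ^ 2‖))) := by
            refine Real.exp_le_exp.2 ?_
            have : A * (1 / (2 * ‖1 - w ^ 2‖)) ≤ A * ((1 - w ^ 2).re / normSq (1 - w ^ 2)) := by
              gcongr
            rw [mul_one_div] at this
            linarith
        _ ≤ (A / (2 * ‖1 - w ^ 2‖))⁻¹ := by
            rw [Real.exp_neg]
            refine inv_anti₀ (by positivity) ?_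
            linarith [Real.add_one_le_exp (A / (2 * ‖1 - w ^ 2‖))]
        _ = _ := by rw [inv_div]
    · have hη : 0 < |ζ.im| := abs_pos.2 h0
      have hn2 : normSq (1 - ζ ^ 2) ≤ 8 * ζ.im ^ 2 ∧ (1 - ζ ^ 2).re = 2 * |ζ.im| := by
        have hr : |ζ.re| = 1 - |ζ.im| := by linarith
        have hr2 : ζ.re ^ 2 = (1 - |ζ.im|) ^ 2 := by rw [← sq_abs ζ.re, hr]
        have hre' : (1 - ζ ^ 2).re = 2 * |ζ.im| := by
          rw [hre, hr2, ← sq_abs ζ.im]; ring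
        refine ⟨?_, hre'⟩
        rw [normSq_apply, hre', him]
        have : -(2 * (ζ.re * ζ.im)) * -(2 * (ζ.re * ζ.im)) = 4 * (ζ.re ^ 2 * ζ.im ^ 2) := by ring
        rw [this, ← sq_abs ζ.im]
        have h5 : ζ.re ^ 2 ≤ 1 := by
          rw [← sq_abs, hr]; nlinarith [abs_nonneg ζ.re]
        nlinarith [sq_nonneg |ζ.im|]
      have hne' : 1 - ζ ^ 2 ≠ 0 := by
        intro h
        have := hn2.2
        rw [h] at this
        simp only [zero_re] at this
        linarith
      have hval : ‖f ζ‖ ≤ Real.exp K₁ := by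
        rw [hfn]
        have h2 := hb (x₀ + ζ) (by simpa using h0)
        have h3 : (x₀ + ζ).im = ζ.im := by simp
        have h4 : 1 + ‖(x₀ : ℂ) + ζ‖ ≤ 2 + |x₀| := by
          have h5 := norm_add_le (x₀ : ℂ) ζ
          have h6 := norm_le_abs_re_add_abs_im ζ
          rw [norm_real, Real.norm_eq_abs] at h5
          linarith
        rw [h3] at h2
        have hq : 1 / (4 * |ζ.im|) ≤ (1 - ζ ^ 2).re / normSq (1 - ζ ^ 2) := by
          rw [hn2.2, div_le_div_iff₀ (by positivity) (normSq_pos.2 hne')]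
          have := hn2.1
          rw [← sq_abs ζ.im] at this
          nlinarith
        calc _ ≤ Real.exp (K₁ * (1 + 1 / |ζ.im|)) * Real.exp (-A * (1 / (4 * |ζ.im|))) := by
              refine mul_le_mul (h2.trans (Real.exp_le_exp.2 ?_)) (Real.exp_le_exp.2 ?_)
                (Real.exp_pos _).le (Real.exp_pos _).le
              · rw [hK₁]; gcongr
              · have : 0 < A := by positivity
                nlinarith
          _ = Real.exp K₁ := by
              rw [← Real.exp_add, hA]
              congr 1
              field_simp
              ring
      exact nhdsWithin_le_nhds
        (((hfd ζ hne').continuousAt.norm.eventually_lt continuousAt_const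
          (hval.trans_lt hC')).mono fun w hw => hw.le)
  have hzV : (z.im * I : ℂ) ∈ V := by
    change |(z.im * I : ℂ).re| + |(z.im * I : ℂ).im| < 1
    simp only [mul_re, mul_im, ofReal_re, ofReal_im, I_re, I_im]
    simp
    linarith
  have h1 := hbound _ hzV
  rw [hfn, re_add_im, hre] at h1
  have h2 : (z.im * I : ℂ).re = 0 := by simp
  have h3 : (z.im * I : ℂ).im = z.im := by simp
  have h4 : normSq (1 - (z.im * I : ℂ) ^ 2) = (1 + z.im ^ 2) ^ 2 := by
    rw [normSq_apply, hre, him, h2, h3]; ring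
  rw [h4, h2, h3] at h1
  have h5 : Real.exp (-A) ≤ Real.exp (-A * ((1 - 0 ^ 2 + z.im ^ 2) / (1 + z.im ^ 2) ^ 2)) := by
    refine Real.exp_le_exp.2 ?_
    have h6 : (1 - 0 ^ 2 + z.im ^ 2) / (1 + z.im ^ 2) ^ 2 ≤ 1 := by
      rw [div_le_one (by positivity)]; nlinarith [sq_nonneg z.im, sq_nonneg (z.im ^ 2)]
    have : 0 < A := by positivity
    nlinarith
  have h7 : ‖T z‖ * Real.exp (-A) ≤ Real.exp K₁ := le_trans (by gcongr) h1
  rw [Real.exp_neg, ← div_eq_mul_inv, div_le_iff₀ (Real.exp_pos _), ← Real.exp_add] at h7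
  refine h7.trans (Real.exp_le_exp.2 ?_)
  have h8 : 2 + |x₀| ≤ 2 * (1 + ‖z‖) := by
    have := abs_re_le_norm z
    have := norm_nonneg z
    rw [hx₀]; linarith
  have h9 : K₁ ≤ K * (8 * (1 + ‖z‖) ^ 3) := by
    rw [hK₁]
    gcongr
    calc (2 + |x₀|) ^ 3 ≤ (2 * (1 + ‖z‖)) ^ 3 := by gcongr
      _ = _ := by ring
  rw [hA]; linarith

end NLSPeriodic

namespace NLSPeriodic

/-- Points at distance at least `R` from all centres exist to the right of any given point. -/
theorem exists_far_point_right {K : Set ℤ} {c : ℤ → ℝ} {R ρ : ℝ} {N : ℤ} (hR : 0 < R) (hρ : 0 ≤ ρ)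
    (hfar : ∀ j ∈ K, ∀ k ∈ K, N ≤ |j| → N ≤ |k| → j ≠ k → 2 * R ≤ |c j - c k|)
    (hnear : ∀ k ∈ K, |k| < N → |c k| + R ≤ ρ) (x : ℝ) :
    ∃ y, x < y ∧ (∀ k ∈ K, R ≤ |y - c k|) ∧ |y| ≤ |x| + (ρ + 1 + 2 * R) := by
  set x' := max x ρ + 1 with hx'
  have h1 : x < x' := by rw [hx']; linarith [le_max_left x ρ]
  have h2 : ρ < x' := by rw [hx']; linarith [le_max_right x ρ]
  have h3 : x' ≤ |x| + ρ + 1 := by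
    rw [hx']
    have := abs_nonneg x
    have : max x ρ ≤ |x| + ρ := max_le (by linarith [le_abs_self x]) (by linarith)
    linarith
  by_cases hgood : ∀ k ∈ K, R ≤ |x' - c k|
  · exact ⟨x', h1, hgood, by rw [abs_of_nonneg (by linarith)]; linarith⟩
  · push Not at hgood
    obtain ⟨k, hk, hkR⟩ := hgood
    rw [abs_lt] at hkR
    have hnear' : ∀ j ∈ K, |j| < N → c j + R ≤ ρ := fun j hj hjN => by
      linarith [hnear j hj hjN, le_abs_self (c j)]
    have hkN : N ≤ |k| := by
      by_contra! h
      linarith [hnear' k hk h]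
    refine ⟨c k + R, by linarith, fun j hj => ?_, by rw [abs_of_nonneg (by linarith)]; linarith⟩
    by_cases hjk : j = k
    · rw [hjk, add_sub_cancel_left, abs_of_pos hR]
    by_cases hjN : N ≤ |j|
    · have h4 := hfar k hk j hj hkN hjN (Ne.symm hjk)
      rcases abs_cases (c k - c j) with ⟨h5, h6⟩ | ⟨h5, h6⟩
      · exact le_trans (by linarith) (le_abs_self _)
      · exact le_trans (by linarith) (neg_le_abs _)
    · exact le_trans (by linarith [hnear' j hj (not_le.1 hjN)]) (le_abs_self _)

namespace CandidateData

variable (D : CandidateData)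

/-- The midpoint of the gap number `k`. -/
def mid (k : ℤ) : ℝ := (D.E (2 * k) + D.E (2 * k - 1)) / 2

variable {D}

theorem gap_le_R {k : ℤ} (hk : k ∈ D.K) : D.E (2 * k) - D.E (2 * k - 1) ≤ D.R :=
  le_csSup D.bdd_gaps ⟨k, hk, rfl⟩

theorem R_pos : 0 < D.R := by
  obtain ⟨k, hk⟩ := D.nonempty
  linarith [D.gap_lt k hk, gap_le_R hk]

theorem E_lt_of_lt {j k : ℤ} (hj : j ∈ D.K) (hk : k ∈ D.K) (hjk : j < k) :
    D.E (2 * j) < D.E (2 * k - 1) := by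
  have key : ∀ n : ℕ, j + n + 1 ∈ D.K → D.E (2 * j) < D.E (2 * (j + n + 1) - 1) := by
    intro n
    induction n with
    | zero =>
      intro h
      have := D.band_lt j hj (by simpa using h)
      convert this using 2
      push_cast; ring
    | succ n ih =>
      intro h
      have hm : j + n + 1 ∈ D.K := D.consecutive.out hj h ⟨by omega, by push_cast; omega⟩
      have h1 := ih hm
      have h2 := D.gap_lt _ hm
      have h3 := D.band_lt _ hm (by convert h using 1; push_cast; ring)
      have h4 : 2 * (j + ((n + 1 : ℕ) : ℤ) + 1) - 1 = 2 * (j + n + 1) + 1 := by push_cast; ring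
      rw [h4]
      linarith
  obtain ⟨n, hn⟩ := Int.eq_ofNat_of_zero_le (by omega : 0 ≤ k - j - 1)
  have hk' : j + n + 1 = k := by omega
  have := key n (by rwa [hk'])
  rwa [hk'] at this

theorem mid_lt_mid {j k : ℤ} (hj : j ∈ D.K) (hk : k ∈ D.K) (hjk : j < k) : D.mid j < D.mid k := by
  have h1 := E_lt_of_lt hj hk hjk
  have h2 := D.gap_lt j hj
  have h3 := D.gap_lt k hk
  unfold mid
  linarith

variable (D) in
theorem exists_two_R_le : ∃ N : ℤ, 0 ≤ N ∧ ∀ j ∈ D.K, ∀ k ∈ D.K, N ≤ |j| → N ≤ |k| → j < k →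
    2 * D.R ≤ D.mid k - D.mid j := by
  obtain ⟨N, hN⟩ := D.discs_disjoint
  refine ⟨N, by positivity, fun j hj k hk hjN hkN hjk => ?_⟩
  have h1 := hN j hj k hk hjN hkN hjk.ne
  have h2 := (disjoint_ball_ball_iff (R_pos (D := D)) (R_pos (D := D))).1 h1
  rw [dist_comm, dist_eq, ← ofReal_sub, norm_real, Real.norm_eq_abs] at h2
  change D.R + D.R ≤ |D.mid k - D.mid j| at h2
  rw [abs_of_pos (sub_pos.2 (mid_lt_mid hj hk hjk))] at h2
  linarith

theorem mem_Icc_of_abs_sub_mid {k : ℤ} (hk : k ∈ D.K) {x : ℝ}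
    (hx : x ∈ Set.Icc (D.E (2 * k - 1)) (D.E (2 * k))) : |x - D.mid k| ≤ D.R / 2 := by
  have := gap_le_R hk
  unfold mid
  rw [abs_le]
  constructor <;> linarith [hx.1, hx.2]

variable (D) in
theorem exists_linear_bound : ∃ η > 0, ∀ k ∈ D.K,
    ∀ x ∈ Set.Icc (D.E (2 * k - 1)) (D.E (2 * k)), η * (1 + |(k : ℝ)|) ≤ 1 + |x| := by
  obtain ⟨N, hN0, hN⟩ := D.exists_two_R_le
  have hR := R_pos (D := D)
  have hpos : ∃ C, ∀ k ∈ D.K, N ≤ k → 2 * D.R * |(k : ℝ)| ≤ |D.mid k| + C := by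
    by_cases h : ∃ k₀ ∈ D.K, N ≤ k₀
    · obtain ⟨k₀, hk₀, hNk₀⟩ := h
      refine ⟨2 * D.R * |(k₀ : ℝ)| + |D.mid k₀|, fun k hk hNk => ?_⟩
      have hka : |(k : ℝ)| = k := abs_of_nonneg (by exact_mod_cast hN0.trans hNk)
      have hk₀a : |(k₀ : ℝ)| = k₀ := abs_of_nonneg (by exact_mod_cast hN0.trans hNk₀)
      rw [hka, hk₀a]
      rcases le_or_gt k k₀ with hle | hlt
      · have : (k : ℝ) ≤ k₀ := by exact_mod_cast hle
        have h1 := abs_nonneg (D.mid k)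
        have h2 := abs_nonneg (D.mid k₀)
        nlinarith
      · have key : ∀ n : ℕ, k₀ + n ∈ D.K → 2 * D.R * n ≤ D.mid (k₀ + n) - D.mid k₀ := by
          intro n
          induction n with
          | zero => simp
          | succ n ih =>
            intro h
            have hm : k₀ + n ∈ D.K := D.consecutive.out hk₀ h ⟨by omega, by omega⟩
            have h1 := ih hm
            have h2 := hN _ hm _ h (by rw [abs_of_nonneg] <;> omega)
              (by rw [abs_of_nonneg] <;> push_cast <;> omega) (by push_cast; omega)
            push_cast at h2 ⊢
            linarith
        obtain ⟨n, hn⟩ := Int.eq_ofNat_of_zero_le (by omega : 0 ≤ k - k₀)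
        have hk' : k₀ + n = k := by omega
        have h1 := key n (by rwa [hk'])
        rw [hk'] at h1
        have h2 : (n : ℝ) = k - k₀ := by
          have : ((n : ℤ) : ℝ) = ((k - k₀ : ℤ) : ℝ) := by rw [hn]
          simpa using this
        rw [h2] at h1
        linarith [le_abs_self (D.mid k), neg_le_abs (D.mid k₀)]
    · push Not at h
      exact ⟨0, fun k hk hNk => absurd (h k hk) (not_lt.2 hNk)⟩
  have hneg : ∃ C, ∀ k ∈ D.K, k ≤ -N → 2 * D.R * |(k : ℝ)| ≤ |D.mid k| + C := by
    by_cases h : ∃ k₀ ∈ D.K, k₀ ≤ -N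
    · obtain ⟨k₀, hk₀, hNk₀⟩ := h
      refine ⟨2 * D.R * |(k₀ : ℝ)| + |D.mid k₀|, fun k hk hNk => ?_⟩
      have hka : |(k : ℝ)| = -k := abs_of_nonpos (by exact_mod_cast (by omega : k ≤ 0))
      have hk₀a : |(k₀ : ℝ)| = -k₀ := abs_of_nonpos (by exact_mod_cast (by omega : k₀ ≤ 0))
      rw [hka, hk₀a]
      rcases le_or_gt k₀ k with hle | hlt
      · have : (k₀ : ℝ) ≤ k := by exact_mod_cast hle
        have h1 := abs_nonneg (D.mid k)
        have h2 := abs_nonneg (D.mid k₀)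
        nlinarith
      · have key : ∀ n : ℕ, k₀ - n ∈ D.K → 2 * D.R * n ≤ D.mid k₀ - D.mid (k₀ - n) := by
          intro n
          induction n with
          | zero => simp
          | succ n ih =>
            intro h
            have hm : k₀ - n ∈ D.K := D.consecutive.out h hk₀ ⟨by omega, by omega⟩
            have h1 := ih hm
            have h2 := hN _ h _ hm (by rw [abs_of_nonpos] <;> push_cast <;> omega)
              (by rw [abs_of_nonpos] <;> omega) (by push_cast; omega)
            push_cast at h2 ⊢
            linarith
        obtain ⟨n, hn⟩ := Int.eq_ofNat_of_zero_le (by omega : 0 ≤ k₀ - k)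
        have hk' : k₀ - n = k := by omega
        have h1 := key n (by rwa [hk'])
        rw [hk'] at h1
        have h2 : (n : ℝ) = k₀ - k := by
          have : ((n : ℤ) : ℝ) = ((k₀ - k : ℤ) : ℝ) := by rw [hn]
          simpa using this
        rw [h2] at h1
        linarith [le_abs_self (D.mid k₀), neg_le_abs (D.mid k)]
    · push Not at h
      exact ⟨0, fun k hk hNk => absurd (h k hk) (not_lt.2 hNk)⟩
  obtain ⟨C₁, hC₁⟩ := hpos
  obtain ⟨C₂, hC₂⟩ := hneg
  set C := |C₁| + |C₂| + 2 * D.R * N with hC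
  have hN0' : (0 : ℝ) ≤ N := by exact_mod_cast hN0
  have hC0 : 0 ≤ C := by positivity
  have hall : ∀ k ∈ D.K, 2 * D.R * |(k : ℝ)| ≤ |D.mid k| + C := by
    intro k hk
    have a1 := abs_nonneg C₁
    have a2 := abs_nonneg C₂
    have a3 : 0 ≤ 2 * D.R * N := by positivity
    rcases le_or_gt N k with h | h
    · linarith [hC₁ k hk h, le_abs_self C₁]
    rcases le_or_gt k (-N) with h' | h'
    · linarith [hC₂ k hk h', le_abs_self C₂]
    · have : |(k : ℝ)| ≤ N := by
        rw [abs_le]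
        constructor
        · have : -N ≤ k := h'.le
          exact_mod_cast this
        · exact_mod_cast h.le
      have : 2 * D.R * |(k : ℝ)| ≤ 2 * D.R * N := by gcongr
      linarith [abs_nonneg (D.mid k)]
  set Q := 1 + C + D.R with hQ
  refine ⟨1 / (1 + Q / (2 * D.R)), by positivity, fun k hk x hx => ?_⟩
  have h1 := hall k hk
  have h2 := mem_Icc_of_abs_sub_mid hk hx
  have h3 : |D.mid k| ≤ |x| + D.R / 2 := by
    have := abs_sub_abs_le_abs_sub (D.mid k) x
    rw [abs_sub_comm] at this
    linarith
  have h4 : |(k : ℝ)| ≤ Q / (2 * D.R) * (1 + |x|) := by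
    rw [div_mul_eq_mul_div, le_div_iff₀ (by positivity)]
    nlinarith [abs_nonneg x]
  rw [div_mul_eq_mul_div, one_mul, div_le_iff₀ (by positivity)]
  nlinarith [abs_nonneg x]

variable (D) in
theorem finite_gaps_meeting (ρ : ℝ) :
    {k | k ∈ D.K ∧ ∃ x ∈ Set.Icc (D.E (2 * k - 1)) (D.E (2 * k)), |x| ≤ ρ}.Finite := by
  obtain ⟨η, hη, h⟩ := D.exists_linear_bound
  refine (Set.finite_Icc (-⌈(1 + ρ) / η⌉) ⌈(1 + ρ) / η⌉).subset ?_
  rintro k ⟨hk, x, hx, hxρ⟩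
  have h1 := h k hk x hx
  have h2 : |(k : ℝ)| ≤ (1 + ρ) / η := by
    rw [le_div_iff₀ hη]; nlinarith
  have h3 := h2.trans (Int.le_ceil _)
  rw [abs_le] at h3
  exact ⟨by exact_mod_cast h3.1, by exact_mod_cast h3.2⟩

theorem E_left_mem {k : ℤ} (hk : k ∈ D.K) :
    D.E (2 * k - 1) ∈ Set.Icc (D.E (2 * k - 1)) (D.E (2 * k)) := ⟨le_rfl, (D.gap_lt k hk).le⟩

theorem E_right_mem {k : ℤ} (hk : k ∈ D.K) :
    D.E (2 * k) ∈ Set.Icc (D.E (2 * k - 1)) (D.E (2 * k)) := ⟨(D.gap_lt k hk).le, le_rfl⟩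

variable (D) in
theorem isClosed_closedGaps : IsClosed D.closedGaps := by
  have heq : D.closedGaps = ⋃ k : D.K,
      ofReal '' Set.Icc (D.E (2 * k.1 - 1)) (D.E (2 * k.1)) := by
    ext z
    simp only [closedGaps, Set.mem_ofPred_eq, Set.mem_iUnion, Set.mem_image, Subtype.exists]
    constructor
    · rintro ⟨k, hk, x, hx, rfl⟩; exact ⟨k, hk, x, hx, rfl⟩
    · rintro ⟨k, hk, x, hx, rfl⟩; exact ⟨k, hk, x, hx, rfl⟩
  rw [heq]
  refine LocallyFinite.isClosed_iUnion ?_ fun k => (isCompact_Icc.image continuous_ofReal).isClosed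
  intro p
  refine ⟨Metric.ball p 1, Metric.ball_mem_nhds p one_pos, ?_⟩
  refine Set.Finite.of_finite_image ((D.finite_gaps_meeting (‖p‖ + 1)).subset ?_)
    Subtype.val_injective.injOn
  rintro _ ⟨k, ⟨z, ⟨x, hx, rfl⟩, hz⟩, rfl⟩
  refine ⟨k.2, x, hx, ?_⟩
  rw [mem_ball_iff_norm] at hz
  have := norm_sub_norm_le (x : ℂ) p
  rw [norm_real, Real.norm_eq_abs] at this
  linarith

variable (D) in
theorem eventually_ne_edge (p : ℂ) : ∀ᶠ z in 𝓝[≠] p, ∀ e ∈ D.edges, z ≠ (e : ℂ) := by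
  have hfin : {e : ℂ | (∃ x ∈ D.edges, (x : ℂ) = e) ∧ ‖e‖ ≤ ‖p‖ + 1 ∧ e ≠ p}.Finite := by
    have h1 := D.finite_gaps_meeting (‖p‖ + 1)
    refine ((h1.image fun k => (D.E (2 * k - 1) : ℂ)).union
      (h1.image fun k => (D.E (2 * k) : ℂ))).subset ?_
    rintro _ ⟨⟨x, ⟨k, hk, rfl | rfl⟩, rfl⟩, hn, -⟩
    · rw [norm_real, Real.norm_eq_abs] at hn
      exact Or.inl ⟨k, ⟨hk, _, E_left_mem hk, hn⟩, rfl⟩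
    · rw [norm_real, Real.norm_eq_abs] at hn
      exact Or.inr ⟨k, ⟨hk, _, E_right_mem hk, hn⟩, rfl⟩
  have hn := hfin.isClosed.isOpen_compl.mem_nhds (x := p) (fun h => h.2.2 rfl)
  filter_upwards [nhdsWithin_le_nhds hn, nhdsWithin_le_nhds (Metric.ball_mem_nhds p one_pos),
    self_mem_nhdsWithin] with z hz hzb hzp e he hze
  refine hz ⟨⟨e, he, hze.symm⟩, ?_, hzp⟩
  rw [mem_ball_iff_norm] at hzb
  linarith [norm_sub_norm_le z p]

theorem exists_gap_or_band {y : ℝ} (hy : y ∉ D.edges) :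
    (∃ n ∈ D.K, y ∈ D.gap n) ∨ ∃ n, D.IsBand n ∧ y ∈ D.band n := by
  by_cases hgap : ∃ n ∈ D.K, y ∈ D.gap n
  · exact Or.inl hgap
  right
  push Not at hgap
  have hsplit : ∀ k ∈ D.K, D.E (2 * k) < y ∨ y < D.E (2 * k - 1) := by
    intro k hk
    by_contra! h
    refine hgap k hk ⟨lt_of_le_of_ne h.2 ?_, lt_of_le_of_ne h.1 ?_⟩
    · intro he; exact hy ⟨k, hk, Or.inl he.symm⟩
    · intro he; exact hy ⟨k, hk, Or.inr he⟩
  by_cases hA : ∃ a ∈ D.K, D.E (2 * a) < y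
  · obtain ⟨a, ha, hay⟩ := hA
    have hfin : {k | k ∈ D.K ∧ a ≤ k ∧ D.E (2 * k) < y}.Finite := by
      refine (D.finite_gaps_meeting (|D.E (2 * a)| + |y|)).subset ?_
      rintro k ⟨hk, hak, hky⟩
      refine ⟨hk, _, E_right_mem hk, ?_⟩
      have h1 : D.E (2 * a) ≤ D.E (2 * k) := by
        rcases hak.eq_or_lt with rfl | hlt
        · exact le_rfl
        · linarith [E_lt_of_lt ha hk hlt, D.gap_lt k hk]
      rw [abs_le]
      constructor
      · linarith [neg_abs_le (D.E (2 * a)), abs_nonneg y]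
      · linarith [le_abs_self y, abs_nonneg (D.E (2 * a))]
    obtain ⟨n, hn⟩ := hfin.exists_maximal ⟨a, ha, le_rfl, hay⟩
    obtain ⟨hnK, han, hny⟩ := hn.prop
    refine ⟨n + 1, Or.inr (by simpa using hnK), fun _ => ?_, fun hK => ?_⟩
    · convert hny using 2; ring
    · rcases hsplit _ hK with h | h
      · have := hn.le_of_ge ⟨hK, by omega, h⟩ (by omega)
        omega
      · exact h
  · push Not at hA
    have hB : ∀ k ∈ D.K, y < D.E (2 * k - 1) := fun k hk =>
      (hsplit k hk).resolve_left (not_lt.2 (hA k hk))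
    obtain ⟨b, hb⟩ := D.nonempty
    have hfin : {k | k ∈ D.K ∧ k ≤ b}.Finite := by
      refine (D.finite_gaps_meeting (|D.E (2 * b)| + |y|)).subset ?_
      rintro k ⟨hk, hkb⟩
      refine ⟨hk, _, E_left_mem hk, ?_⟩
      have h1 : D.E (2 * k - 1) ≤ D.E (2 * b) := by
        rcases hkb.eq_or_lt with rfl | hlt
        · exact (D.gap_lt k hk).le
        · linarith [E_lt_of_lt hk hb hlt, D.gap_lt k hk, D.gap_lt b hb]
      rw [abs_le]
      constructor
      · linarith [neg_abs_le y, hB k hk, abs_nonneg (D.E (2 * b))]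
      · linarith [le_abs_self (D.E (2 * b)), abs_nonneg y]
    obtain ⟨n, hn⟩ := hfin.exists_minimal ⟨b, hb, le_rfl⟩
    obtain ⟨hnK, hnb⟩ := hn.prop
    refine ⟨n, Or.inl hnK, fun h => ?_, fun h => hB n h⟩
    have := hn.le_of_le ⟨h, by omega⟩ (by omega)
    omega

/-- `IsFar x`: the point `x` lies in none of the open discs. -/
def IsFar (D : CandidateData) (x : ℝ) : Prop := ∀ k ∈ D.K, D.R ≤ |x - D.mid k|

theorem IsFar.mem_domain {x : ℝ} (hx : D.IsFar x) {z : ℂ} (hz : z.re = x) (hz0 : z.im ≠ 0) :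
    z ∈ D.domain := by
  refine ⟨hz0, fun k hk h => ?_⟩
  rw [mem_closedBall_iff_norm] at h
  have hR := R_pos (D := D)
  have h1 := hx k hk
  have h2 : ‖z - (D.mid k : ℂ)‖ ^ 2 = (x - D.mid k) ^ 2 + z.im ^ 2 := by
    rw [← normSq_eq_norm_sq, normSq_apply]
    simp [hz]; ring
  have h3 : ‖z - (D.mid k : ℂ)‖ ^ 2 ≤ D.R ^ 2 := by
    gcongr; exact h
  have h4 : D.R ^ 2 ≤ (x - D.mid k) ^ 2 := by rw [← sq_abs (x - D.mid k)]; gcongr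
  have h5 : 0 < z.im ^ 2 := by positivity
  linarith

theorem mem_domain_of_R_lt {z : ℂ} (hz : D.R < |z.im|) : z ∈ D.domain := by
  have hR := R_pos (D := D)
  refine ⟨fun h => by rw [h, abs_zero] at hz; linarith, fun k hk h => ?_⟩
  rw [mem_closedBall_iff_norm] at h
  have h1 := abs_im_le_norm (z - (((D.E (2 * k) + D.E (2 * k - 1)) / 2 : ℝ) : ℂ))
  rw [sub_im, ofReal_im, sub_zero] at h1
  linarith

variable (D) in
theorem exists_isFar_near : ∃ C₀, 0 ≤ C₀ ∧ ∀ x : ℝ, ∃ x₁ x₂, x₁ < x ∧ x < x₂ ∧ D.IsFar x₁ ∧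
    D.IsFar x₂ ∧ |x₁| ≤ |x| + C₀ ∧ |x₂| ≤ |x| + C₀ := by
  obtain ⟨N, hN0, hN⟩ := D.exists_two_R_le
  have hR := R_pos (D := D)
  have hfar : ∀ j ∈ D.K, ∀ k ∈ D.K, N ≤ |j| → N ≤ |k| → j ≠ k →
      2 * D.R ≤ |D.mid j - D.mid k| := by
    intro j hj k hk hjN hkN hjk
    rcases lt_or_gt_of_ne hjk with h | h
    · rw [abs_sub_comm]
      exact (hN j hj k hk hjN hkN h).trans (le_abs_self _)
    · exact (hN k hk j hj hkN hjN h).trans (le_abs_self _)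
  obtain ⟨ρ, hρ0, hρ⟩ : ∃ ρ, 0 ≤ ρ ∧ ∀ k ∈ D.K, |k| < N → |D.mid k| + D.R ≤ ρ := by
    have hfin : {k : ℤ | |k| < N}.Finite :=
      (Set.finite_Ioo (-N) N).subset fun k hk => abs_lt.1 hk
    obtain ⟨ρ, hρ⟩ := (hfin.image fun k => |D.mid k| + D.R).bddAbove
    exact ⟨max ρ 0, le_max_right _ _, fun k _ hk => (hρ ⟨k, hk, rfl⟩).trans (le_max_left _ _)⟩
  refine ⟨ρ + 1 + 2 * D.R, by positivity, fun x => ?_⟩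
  obtain ⟨x₂, h1, h2, h3⟩ := exists_far_point_right hR hρ0 hfar hρ x
  obtain ⟨y, h4, h5, h6⟩ := exists_far_point_right (c := fun k => -D.mid k) hR hρ0
    (fun j hj k hk a b c => by
      have := hfar j hj k hk a b c
      rwa [neg_sub_neg, abs_sub_comm]) (fun k hk h => by simpa using hρ k hk h) (-x)
  refine ⟨-y, x₂, by linarith, h1, fun k hk => ?_, h2, by simpa using h6, h3⟩
  have := h5 k hk
  rwa [sub_neg_eq_add, ← abs_neg, neg_add, ← sub_eq_add_neg] at this

/-- A growth bound on the domain `𝒟` extends to the plane, for functions holomorphic off a closed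
set at which their modulus is at most one in the limit. -/
theorem exists_growth_of_domain {X : Set ℂ} (hX : IsClosed X) {f : ℂ → ℂ}
    (hf : DifferentiableOn ℂ f Xᶜ)
    (hfX : ∀ p ∈ X, ∀ C' > 1, ∀ᶠ z in 𝓝[Xᶜ] p, ‖f z‖ ≤ C')
    {M c : ℝ} (hg : ∀ z ∈ D.domain, z ∉ X → ‖f z‖ ≤ M * Real.exp (c * ‖z‖ ^ 2)) :
    ∃ M' c' : ℝ, 0 ≤ c' ∧ ∀ z ∉ X, ‖f z‖ ≤ M' * Real.exp (c' * ‖z‖ ^ 2) := by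
  obtain ⟨C₀, hC₀, hfar⟩ := D.exists_isFar_near
  have hR := R_pos (D := D)
  set A := C₀ + D.R + 1 with hA
  set M₁ := max M 1 with hM₁
  set c₁ := max c 0 with hc₁
  have hM1 : 1 ≤ M₁ := le_max_right _ _
  have hc0 : 0 ≤ c₁ := le_max_right _ _
  have hA0 : 0 < A := by positivity
  have hg₁ : ∀ z ∈ D.domain, z ∉ X → ‖f z‖ ≤ M₁ * Real.exp (c₁ * ‖z‖ ^ 2) := by
    intro z hz hzX
    refine (hg z hz hzX).trans ?_
    have : c * ‖z‖ ^ 2 ≤ c₁ * ‖z‖ ^ 2 := by gcongr; exact le_max_left _ _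
    exact mul_le_mul (le_max_left _ _) (Real.exp_le_exp.2 this) (Real.exp_pos _).le (by linarith)
  refine ⟨M₁ * Real.exp (8 * c₁ * A ^ 2), 8 * c₁, by positivity, fun z hzX => ?_⟩
  obtain ⟨x₁, x₂, hx₁, hx₂, hf₁, hf₂, ha₁, ha₂⟩ := hfar z.re
  set H := |z.im| + D.R + 1 with hH
  set V₀ : Set ℂ := Set.Ioo x₁ x₂ ×ℂ Set.Ioo (-H) H with hV₀
  have hV₀o : IsOpen V₀ := isOpen_Ioo.reProdIm isOpen_Ioo
  set V := V₀ ∩ Xᶜ with hV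
  have hVo : IsOpen V := hV₀o.inter hX.isOpen_compl
  have hV₀b : Bornology.IsBounded V₀ :=
    (Metric.isBounded_Ioo x₁ x₂).reProdIm (Metric.isBounded_Ioo (-H) H)
  have hH0 : 0 < H := by positivity
  have hcl : closure V₀ = Set.Icc x₁ x₂ ×ℂ Set.Icc (-H) H := by
    rw [hV₀, closure_reProdIm, closure_Ioo (by linarith : x₁ < x₂).ne,
      closure_Ioo (by linarith : -H < H).ne]
  have hbig : 1 ≤ M₁ * Real.exp (8 * c₁ * A ^ 2) * Real.exp (8 * c₁ * ‖z‖ ^ 2) := by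
    rw [mul_assoc, ← Real.exp_add]
    have : 1 ≤ Real.exp (8 * c₁ * A ^ 2 + 8 * c₁ * ‖z‖ ^ 2) := Real.one_le_exp (by positivity)
    nlinarith
  refine norm_le_of_frontier_limsup hVo (hV₀b.subset Set.inter_subset_left)
    (hf.mono Set.inter_subset_right) ?_ z
    ⟨⟨⟨hx₁, hx₂⟩, ⟨by linarith [neg_abs_le z.im], by linarith [le_abs_self z.im]⟩⟩, hzX⟩
  intro p hp C' hC'
  by_cases hpX : p ∈ X
  · exact (hfX p hpX C' (by linarith)).filter_mono (nhdsWithin_mono _ Set.inter_subset_right)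
  have hpc : p ∈ Set.Icc x₁ x₂ ×ℂ Set.Icc (-H) H := by
    rw [← hcl]; exact closure_mono Set.inter_subset_left hp.1
  have hpV : p ∉ V₀ := fun h => hp.2 (by rw [hVo.interior_eq]; exact ⟨h, hpX⟩)
  have hcont : ContinuousAt f p :=
    ((hf p hpX).differentiableAt (hX.isOpen_compl.mem_nhds hpX)).continuousAt
  have hpn : c₁ * ‖p‖ ^ 2 ≤ 8 * c₁ * A ^ 2 + 8 * c₁ * ‖z‖ ^ 2 := by
    have h1 : |p.re| ≤ |z.re| + C₀ := by
      have h3 : p.re ∈ Set.Icc x₁ x₂ := hpc.1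
      rw [abs_le]
      constructor
      · linarith [h3.1, neg_abs_le x₁]
      · linarith [h3.2, le_abs_self x₂]
    have h2 : |p.im| ≤ H := abs_le.2 hpc.2
    have h3 := norm_le_abs_re_add_abs_im p
    have h4 := abs_re_le_norm z
    have h5 := abs_im_le_norm z
    have h6 : ‖p‖ ≤ 2 * ‖z‖ + A := by rw [hA]; linarith
    have h7 : ‖p‖ ^ 2 ≤ (2 * ‖z‖ + A) ^ 2 := by gcongr
    have h8 : ‖p‖ ^ 2 ≤ 8 * A ^ 2 + 8 * ‖z‖ ^ 2 := by
      nlinarith [sq_nonneg (2 * ‖z‖ - A), sq_nonneg A]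
    nlinarith
  have hle : ‖f p‖ ≤ M₁ * Real.exp (c₁ * ‖p‖ ^ 2) := by
    by_cases hpD : p ∈ D.domain
    · exact hg₁ p hpD hpX
    have hfarp : D.IsFar p.re := by
      by_contra hnf
      have h1 : x₁ ≠ p.re := fun h => hnf (h ▸ hf₁)
      have h2 : p.re ≠ x₂ := fun h => hnf (h ▸ hf₂)
      have h3 : |p.im| < H := by
        by_contra! h
        exact hpD (mem_domain_of_R_lt (by linarith [abs_nonneg z.im]))
      exact hpV ⟨⟨lt_of_le_of_ne hpc.1.1 h1, lt_of_le_of_ne hpc.1.2 h2⟩, abs_lt.1 h3⟩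
    have him : p.im = 0 := by
      by_contra h
      exact hpD (hfarp.mem_domain rfl h)
    have hline : Tendsto (fun t : ℝ => p + t * I) (𝓝[>] 0) (𝓝 p) := by
      have : Tendsto (fun t : ℝ => p + t * I) (𝓝 0) (𝓝 (p + (0 : ℝ) * I)) :=
        (by fun_prop : Continuous fun t : ℝ => p + (t : ℂ) * I).tendsto 0
      simpa using this.mono_left nhdsWithin_le_nhds
    have hexp : Continuous fun w : ℂ => M₁ * Real.exp (c₁ * ‖w‖ ^ 2) := by fun_prop
    refine le_of_tendsto_of_tendsto (hcont.norm.tendsto.comp hline)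
      ((hexp.tendsto p).comp hline) ?_
    filter_upwards [self_mem_nhdsWithin,
      hline.eventually (hX.isOpen_compl.mem_nhds hpX)] with t ht htX
    have ht : 0 < t := ht
    exact hg₁ _ (hfarp.mem_domain (by simp) (by simp [him, ht.ne'])) htX
  have hfin : ‖f p‖ < C' := by
    refine lt_of_le_of_lt (hle.trans ?_) hC'
    rw [mul_assoc, ← Real.exp_add]
    gcongr
  exact nhdsWithin_le_nhds ((hcont.norm.eventually_lt continuousAt_const hfin).mono
    fun w hw => hw.le)

end CandidateData

end NLSPeriodic

section
open scoped ComplexConjugate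

namespace NLSPeriodic

theorem exists_bound_of_large {F : ℂ → ℂ} (hF : Continuous F) {S : Set ℂ} {C ρ : ℝ}
    (h : ∀ z ∈ S, ρ ≤ ‖z‖ → ‖F z‖ ≤ C) : ∃ C', 0 ≤ C' ∧ ∀ z ∈ S, ‖F z‖ ≤ C' := by
  obtain ⟨B, hB⟩ := (isCompact_closedBall (0 : ℂ) ρ).exists_bound_of_continuousOn hF.continuousOn
  refine ⟨max (max B C) 0, le_max_right _ _, fun z hz => ?_⟩
  rcases le_total ρ ‖z‖ with h' | h'
  · exact (h z hz h').trans ((le_max_right B C).trans (le_max_left _ _))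
  · exact (hB z (by simpa using h')).trans ((le_max_left B C).trans (le_max_left _ _))

theorem mem_sector_one (y : ℝ) : (y * I : ℂ) ∈ sector 1 := by
  simp [sector]

/-- An entire function of finite order that tends to `v` in every double sector around the
imaginary axis is equal to `v`. -/
theorem eq_of_sector_limit {F : ℂ → ℂ} (hF : Differentiable ℂ F) {n : ℕ} (hn : 1 ≤ n)
    {M c : ℝ} (hg : ∀ z, ‖F z‖ ≤ M * Real.exp (c * ‖z‖ ^ n)) {v : ℂ}
    (hlim : ∀ ε > 0, ∃ C ρ : ℝ, ∀ z ∈ sector ε, ρ ≤ ‖z‖ → ‖F z - v‖ ≤ C / ‖z‖) (z : ℂ) :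
    F z = v := by
  have hbd : ∀ ε > 0, ∃ C, 0 ≤ C ∧ ∀ z ∈ sector ε, ‖F z‖ ≤ C := by
    intro ε hε
    obtain ⟨C, ρ, hC⟩ := hlim ε hε
    refine exists_bound_of_large hF.continuous (C := ‖v‖ + |C|) (ρ := max ρ 1) fun z hz hρ => ?_
    have h1 := hC z hz ((le_max_left _ _).trans hρ)
    have hz1 : 1 ≤ ‖z‖ := (le_max_right _ _).trans hρ
    have h2 : C / ‖z‖ ≤ |C| := by
      rw [div_le_iff₀ (by linarith)]
      nlinarith [le_abs_self C, abs_nonneg C]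
    have h3 := norm_add_le (F z - v) v
    rw [sub_add_cancel] at h3
    linarith
  obtain ⟨C₁, -, hC₁⟩ := hbd 1 one_pos
  have hconst := eq_of_sector_growth hF hn hg (fun ε hε => by
    obtain ⟨C, hC0, hC⟩ := hbd ε hε
    refine ⟨C, fun z hz => (hC z hz).trans ?_⟩
    have : 1 ≤ Real.exp (C * √‖z‖) := Real.one_le_exp (by positivity)
    nlinarith) (fun y => hC₁ _ (mem_sector_one y))
  obtain ⟨C, ρ, hC⟩ := hlim 1 one_pos
  have h1 : Tendsto (fun y : ℝ => C / ‖(y * I : ℂ)‖) atTop (𝓝 0) := by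
    refine tendsto_const_nhds.div_atTop ?_
    simp only [norm_mul, norm_I, mul_one, norm_real]
    exact tendsto_norm_atTop_atTop
  have h2 : ‖F z - v‖ ≤ 0 := by
    refine ge_of_tendsto h1 ?_
    filter_upwards [eventually_ge_atTop (max ρ 0)] with y hy
    rw [hconst z (y * I)]
    refine hC _ (mem_sector_one y) ?_
    rw [norm_mul, norm_I, mul_one, norm_real]
    exact (le_max_left _ _).trans (hy.trans (le_abs_self y))
  exact sub_eq_zero.1 (norm_le_zero_iff.1 h2)

theorem conj_mem_sector {ε : ℝ} {z : ℂ} (hz : z ∈ sector ε) : conj z ∈ sector ε := by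
  simpa [sector] using hz

theorem tendsto_conj_upperHalf (y : ℝ) :
    Tendsto (fun z : ℂ => conj z) (𝓝[upperHalf] (y : ℂ)) (𝓝[lowerHalf] (y : ℂ)) := by
  refine tendsto_nhdsWithin_iff.2 ⟨?_, ?_⟩
  · have := (continuous_conj.tendsto (y : ℂ)).mono_left
      (nhdsWithin_le_nhds (s := upperHalf))
    simpa using this
  · filter_upwards [self_mem_nhdsWithin] with z hz
    have hz : 0 < z.im := hz
    simpa [lowerHalf] using hz

theorem tendsto_conj_lowerHalf (y : ℝ) :
    Tendsto (fun z : ℂ => conj z) (𝓝[lowerHalf] (y : ℂ)) (𝓝[upperHalf] (y : ℂ)) := by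
  refine tendsto_nhdsWithin_iff.2 ⟨?_, ?_⟩
  · have := (continuous_conj.tendsto (y : ℂ)).mono_left
      (nhdsWithin_le_nhds (s := lowerHalf))
    simpa using this
  · filter_upwards [self_mem_nhdsWithin] with z hz
    have hz : z.im < 0 := hz
    simpa [upperHalf] using hz

namespace CandidateData

variable {D : CandidateData} {L : ℝ} {r : ℂ → ℂ}

theorem conj_mem_domain {z : ℂ} (hz : z ∈ D.domain) : conj z ∈ D.domain := by
  refine ⟨by simpa using hz.1, fun k hk h => hz.2 k hk ?_⟩
  rw [mem_closedBall_iff_norm] at h ⊢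
  rw [← norm_conj, map_sub, conj_ofReal]
  exact h

theorem im_eq_zero_of_mem_closedGaps {z : ℂ} (hz : z ∈ D.closedGaps) : z.im = 0 := by
  obtain ⟨k, -, x, -, rfl⟩ := hz
  exact ofReal_im x

theorem conj_notMem_closedGaps {z : ℂ} (hz : z ∉ D.closedGaps) : conj z ∉ D.closedGaps := by
  intro h
  have h1 := im_eq_zero_of_mem_closedGaps h
  have h2 : conj (conj z) = conj z := conj_eq_iff_im.2 h1
  rw [conj_conj] at h2
  exact hz (h2 ▸ h)

/-- The boundary values of a solution of the scalar problem are inverse to each other on the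
closed gaps. -/
theorem SolvesScalarRHP.exists_boundary (hr : D.SolvesScalarRHP L r) {y : ℝ}
    (hy : (y : ℂ) ∈ D.closedGaps) : ∃ a b : ℂ, a * b = 1 ∧
      Tendsto r (𝓝[upperHalf] (y : ℂ)) (𝓝 a) ∧ Tendsto r (𝓝[lowerHalf] (y : ℂ)) (𝓝 b) := by
  obtain ⟨k, hk, x, hx, hxy⟩ := hy
  obtain rfl : y = x := by exact_mod_cast hxy
  obtain ⟨rp, rm, h⟩ := hr.boundary
  obtain ⟨h1, h2, h3, h4⟩ := h k hk
  have heq : Set.EqOn (fun y => rp y * rm y) (fun _ => (1 : ℂ))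
      (Set.Icc (D.E (2 * k - 1)) (D.E (2 * k))) := by
    refine Set.EqOn.of_subset_closure (s := D.gap k) (fun y hy => ?_) (h1.mul h2)
      continuousOn_const Set.Ioo_subset_Icc_self ?_
    · obtain ⟨h5, h6⟩ := h4 y hy
      simp only [h6, inv_mul_cancel₀ h5]
    · rw [gap, closure_Ioo (D.gap_lt k hk).ne]
  exact ⟨rp y, rm y, heq hx, (h3 y hx).1, (h3 y hx).2⟩

/-- A solution of the scalar problem satisfies the symmetry `r(z) conj (r (conj z)) = 1`. -/
theorem SolvesScalarRHP.mul_conj_eq_one (hr : D.SolvesScalarRHP L r) {z : ℂ} (hz : z.im ≠ 0) :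
    r z * conj (r (conj z)) = 1 := by
  set X := D.closedGaps with hX
  have hXc : IsClosed X := D.isClosed_closedGaps
  set h : ℂ → ℂ := fun z => r z * conj (r (conj z)) with hh
  have hnX : ∀ z : ℂ, z.im ≠ 0 → z ∉ X := fun z hz hzX => hz (im_eq_zero_of_mem_closedGaps hzX)
  have hra : ∀ z ∉ X, DifferentiableAt ℂ r z := fun z hz =>
    (hr.holomorphic z hz).differentiableAt (hXc.isOpen_compl.mem_nhds hz)
  have hda : ∀ z ∉ X, DifferentiableAt ℂ h z := by
    intro z hz
    refine (hra z hz).mul ?_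
    have h1 := hra _ (conj_notMem_closedGaps hz)
    have h2 := h1.conj_conj
    rw [conj_conj] at h2
    exact h2
  have hd : DifferentiableOn ℂ h Xᶜ := fun z hz => (hda z hz).differentiableWithinAt
  have h0 : ∀ z ∉ X, h z ≠ 0 := fun z hz => mul_ne_zero (hr.ne_zero z hz)
    ((map_ne_zero _).2 (hr.ne_zero _ (conj_notMem_closedGaps hz)))
  have hconj : ∀ z, ‖h (conj z)‖ = ‖h z‖ := by
    intro z
    simp only [hh, conj_conj, norm_mul, norm_conj]
    ring
  have hbv : ∀ y : ℝ, (y : ℂ) ∈ X → ∃ l : ℂ, ‖l‖ = 1 ∧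
      Tendsto h (𝓝[upperHalf] (y : ℂ)) (𝓝 l) ∧ Tendsto h (𝓝[lowerHalf] (y : ℂ)) (𝓝 l⁻¹) := by
    intro y hy
    obtain ⟨a, b, hab, ha, hb⟩ := hr.exists_boundary hy
    have hb0 : b ≠ 0 := right_ne_zero_of_mul_eq_one hab
    have hab' : a = b⁻¹ := eq_inv_of_mul_eq_one_left hab
    have hcb : conj b ≠ 0 := (map_ne_zero _).2 hb0
    refine ⟨a * conj b, ?_, ?_, ?_⟩
    · rw [norm_mul, norm_conj, ← norm_mul, hab, norm_one]
    · exact ha.mul ((continuous_conj.tendsto b).comp (hb.comp (tendsto_conj_upperHalf y)))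
    · have h1 := hb.mul ((continuous_conj.tendsto a).comp (ha.comp (tendsto_conj_lowerHalf y)))
      have h2 : b * conj a = (a * conj b)⁻¹ := by
        rw [hab', map_inv₀, mul_inv, inv_inv]
      rw [h2] at h1
      exact h1
  have hreal : ∀ z : ℂ, z.im = 0 → z = ((z.re : ℝ) : ℂ) := fun z hz => by
    apply Complex.ext <;> simp [hz]
  have hfX : ∀ p ∈ X, ∀ C' > 1, ∀ᶠ z in 𝓝[Xᶜ] p, ‖h z‖ ≤ C' := by
    intro p hp C' hC'
    have hpr := hreal p (im_eq_zero_of_mem_closedGaps hp)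
    obtain ⟨l, hl, h1, h2⟩ := hbv p.re (by rw [← hpr]; exact hp)
    rw [← hpr] at h1 h2
    have hev : ∀ᶠ z in 𝓝[{z : ℂ | z.im ≠ 0}] p, ‖h z‖ < C' := by
      rw [nhdsWithin_im_ne_zero, eventually_sup]
      refine ⟨h1.norm.eventually_lt tendsto_const_nhds (by rw [hl]; exact hC'),
        h2.norm.eventually_lt tendsto_const_nhds (by rw [norm_inv, hl, inv_one]; exact hC')⟩
    rw [eventually_nhdsWithin_iff] at hev ⊢
    filter_upwards [hev.eventually_nhds] with z hz hzX
    by_cases him : z.im = 0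
    · have := mem_closure_iff_nhdsWithin_neBot.1 (mem_closure_im_ne_zero z)
      refine le_of_tendsto ((hda z hzX).continuousAt.norm.mono_left
        (nhdsWithin_le_nhds (s := {z : ℂ | z.im ≠ 0}))) ?_
      rw [eventually_nhdsWithin_iff]
      filter_upwards [hz] with w hw hwim using (hw hwim).le
    · exact (hz.self_of_nhds him).le
  obtain ⟨c₀, hc₀, M₀, hM₀, hgr⟩ := hr.growth.2
  have hgD : ∀ z ∈ D.domain, z ∉ X → ‖h z‖ ≤ M₀ ^ 2 * Real.exp (2 * c₀ * ‖z‖ ^ 2) := by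
    intro z hz _
    have e1 := hgr z hz
    have e2 := hgr _ (conj_mem_domain hz)
    rw [norm_conj] at e2
    rw [Real.rpow_two] at e1 e2
    simp only [hh, norm_mul, norm_conj]
    calc _ ≤ (M₀ * Real.exp (c₀ * ‖z‖ ^ 2)) * (M₀ * Real.exp (c₀ * ‖z‖ ^ 2)) := by gcongr
      _ = M₀ ^ 2 * (Real.exp (c₀ * ‖z‖ ^ 2) * Real.exp (c₀ * ‖z‖ ^ 2)) := by ring
      _ = _ := by rw [← Real.exp_add]; ring_nf
  obtain ⟨M, c, hc, hg⟩ := exists_growth_of_domain hXc hd hfX hgD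
  have hsec : ∀ ε > 0, ∃ C ρ : ℝ, 1 ≤ ρ ∧ 0 ≤ C ∧ ∀ z ∈ sector ε, ρ ≤ ‖z‖ →
      ‖h z - 1‖ ≤ C / ‖z‖ := by
    intro ε hε
    obtain ⟨C, ρ, hρ, hC⟩ := hr.asymptotics ε hε
    refine ⟨2 * |C| + |C| ^ 2, max ρ 1, le_max_right _ _, by positivity, fun z hz hzρ => ?_⟩
    have hz1 : 1 ≤ ‖z‖ := (le_max_right _ _).trans hzρ
    have hzρ' : ρ ≤ ‖z‖ := (le_max_left _ _).trans hzρ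
    obtain ⟨w, hw, hw'⟩ := hC z hz hzρ'
    obtain ⟨v, hv, hv'⟩ := hC _ (conj_mem_sector hz) (by rwa [norm_conj])
    rw [norm_conj] at hv
    have hle : C / ‖z‖ ≤ |C| / ‖z‖ := by gcongr; exact le_abs_self C
    have hval : h z = (1 + w) * (1 + conj v) := by
      simp only [hh]
      rw [hw', hv', map_mul, ← exp_conj]
      simp only [map_mul, map_pow, conj_conj, conj_I, conj_ofReal, map_add, map_one, map_ofNat]
      have : exp (2 * I * z ^ 2 * L) * exp (2 * -I * z ^ 2 * L) = 1 := by
        rw [← exp_add, ← exp_zero]; ring_nf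
      linear_combination (1 + w) * (1 + conj v) * this
    have hexp : h z - 1 = w + conj v + w * conj v := by rw [hval]; ring
    have hw1 := hw.trans hle
    have hv1 := hv.trans hle
    have hCz : |C| / ‖z‖ ≤ |C| := div_le_self (abs_nonneg C) hz1
    rw [hexp]
    calc ‖w + conj v + w * conj v‖ ≤ ‖w‖ + ‖v‖ + ‖w‖ * ‖v‖ := by
          refine (norm_add_le _ _).trans ?_
          have := norm_add_le w (conj v)
          rw [norm_conj] at this
          rw [norm_mul, norm_conj]
          linarith
      _ ≤ |C| / ‖z‖ + |C| / ‖z‖ + (|C| / ‖z‖) * |C| := by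
          gcongr
          exact hv1.trans hCz
      _ = _ := by ring
  have hupX : upperHalf ⊆ Xᶜ := fun z hz => hnX z (ne_of_gt hz)
  obtain ⟨K, hK, hinv⟩ : ∃ K > 0, ∀ z ∈ upperHalf,
      ‖(h z)⁻¹‖ ≤ Real.exp (K * (1 + ‖z‖) ^ 3 * (1 + 1 / z.im)) := by
    obtain ⟨C, ρ, hρ, hC0, hC⟩ := hsec (1 / 2) (by norm_num)
    refine exists_norm_inv_le (hd.mono hupX) (fun z hz => h0 z (hupX hz)) hc
      (fun z hz => hg z (hupX hz)) (ρ := max ρ (2 * C)) fun z hz hzρ => ?_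
    have h1 := hC z hz ((le_max_left _ _).trans hzρ)
    have h2 : 2 * C ≤ ‖z‖ := (le_max_right _ _).trans hzρ
    have h3 : ρ ≤ ‖z‖ := (le_max_left _ _).trans hzρ
    have h4 : C / ‖z‖ ≤ 1 / 2 := by
      rw [div_le_iff₀ (by linarith)]; linarith
    have h5 := norm_sub_norm_le (1 : ℂ) (h z)
    rw [norm_sub_rev, norm_one] at h5
    linarith
  obtain ⟨T, hTd, hT⟩ := exists_entire_extension (f := fun z => h z + (h z)⁻¹) (S := ∅)
    (fun z hz => ((hda z (hnX z hz)).add ((hda z (hnX z hz)).inv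
      (h0 z (hnX z hz)))).differentiableWithinAt)
    (by simp) (fun y _ => by
      by_cases hy : (y : ℂ) ∈ X
      · obtain ⟨l, hl, h1, h2⟩ := hbv y hy
        have hl0 : l ≠ 0 := by rintro rfl; simp at hl
        refine ⟨l + l⁻¹, h1.add (h1.inv₀ hl0), ?_⟩
        have := h2.add (h2.inv₀ (inv_ne_zero hl0))
        rwa [inv_inv, add_comm l⁻¹] at this
      · have hc := (hda _ hy).continuousAt
        have := hc.tendsto.add (hc.tendsto.inv₀ (h0 _ hy))
        exact ⟨_, this.mono_left nhdsWithin_le_nhds, this.mono_left nhdsWithin_le_nhds⟩)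
    (by simp)
  set M' := max M 1 with hM'
  have hM1 : 1 ≤ M' := le_max_right _ _
  have hlogM : 0 ≤ Real.log M' := Real.log_nonneg hM1
  have hlog2 : 0 < Real.log 2 := Real.log_pos (by norm_num)
  obtain ⟨M₃, c₃, hgT⟩ := exists_cubic_growth hTd (K := Real.log 2 + Real.log M' + c + K)
    (by positivity) (fun z hz => by
      have hzi : 0 < |z.im| := abs_pos.2 hz
      have hn := norm_nonneg z
      set Q := (1 + ‖z‖) ^ 3 * (1 + 1 / |z.im|) with hQ
      have hone : 1 ≤ 1 + 1 / |z.im| := by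
        have : 0 < 1 / |z.im| := by positivity
        linarith
      have hcube : 1 + ‖z‖ ^ 2 ≤ (1 + ‖z‖) ^ 3 := by nlinarith [pow_nonneg hn 3, sq_nonneg ‖z‖]
      have hQ1 : 1 + ‖z‖ ^ 2 ≤ Q := by
        rw [hQ]; nlinarith [sq_nonneg ‖z‖]
      have e1 : ‖h z‖ ≤ Real.exp ((Real.log M' + c) * Q) := by
        refine (hg z (hnX z hz)).trans ?_
        calc M * Real.exp (c * ‖z‖ ^ 2) ≤ M' * Real.exp (c * ‖z‖ ^ 2) := by
              gcongr; exact le_max_left _ _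
          _ = Real.exp (Real.log M' + c * ‖z‖ ^ 2) := by
              rw [Real.exp_add, Real.exp_log (by linarith)]
          _ ≤ _ := by
              refine Real.exp_le_exp.2 ?_
              nlinarith [sq_nonneg ‖z‖]
      have e2 : ‖(h z)⁻¹‖ ≤ Real.exp (K * Q) := by
        rcases lt_or_gt_of_ne hz with hlt | hgt
        · have := hinv (conj z) (by simpa [upperHalf] using hlt)
          rw [norm_inv, hconj, norm_conj, conj_im] at this
          rw [norm_inv, hQ, abs_of_neg hlt, ← mul_assoc]
          exact this
        · have := hinv z hgt
          rw [hQ, abs_of_pos hgt, ← mul_assoc]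
          exact this
      rw [hT z hz, mul_assoc, ← hQ]
      refine (norm_add_le _ _).trans ?_
      have hcQ : 0 ≤ c * Q := by nlinarith [sq_nonneg ‖z‖]
      have hlQ : 0 ≤ Real.log M' * Q := by nlinarith [sq_nonneg ‖z‖]
      have hKQ : 0 ≤ K * Q := by nlinarith [sq_nonneg ‖z‖]
      have e3 : Real.exp ((Real.log M' + c) * Q) ≤ Real.exp ((Real.log M' + c + K) * Q) :=
        Real.exp_le_exp.2 (by linarith)
      have e4 : Real.exp (K * Q) ≤ Real.exp ((Real.log M' + c + K) * Q) :=
        Real.exp_le_exp.2 (by linarith)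
      calc ‖h z‖ + ‖(h z)⁻¹‖ ≤ 2 * Real.exp ((Real.log M' + c + K) * Q) := by linarith
        _ = Real.exp (Real.log 2 + (Real.log M' + c + K) * Q) := by
            rw [Real.exp_add, Real.exp_log (by norm_num)]
        _ ≤ _ := by
            refine Real.exp_le_exp.2 ?_
            nlinarith [sq_nonneg ‖z‖])
  have hT2 := eq_of_sector_limit hTd (by norm_num) hgT (v := 2) (fun ε hε => by
    obtain ⟨C, ρ, hρ, hC0, hC⟩ := hsec ε hε
    refine ⟨2 * C ^ 2, max ρ (2 * C), fun w hw hwρ => ?_⟩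
    have h1 : ρ ≤ ‖w‖ := (le_max_left _ _).trans hwρ
    have h2 : 2 * C ≤ ‖w‖ := (le_max_right _ _).trans hwρ
    have hw0 : 0 < ‖w‖ := by linarith
    have hw : ε * ‖w‖ ≤ |w.im| := hw
    have him : w.im ≠ 0 := by
      intro h
      rw [h, abs_zero] at hw
      nlinarith
    have h3 := hC w hw h1
    have h4 : C / ‖w‖ ≤ 1 / 2 := by rw [div_le_iff₀ hw0]; linarith
    have h5 := norm_sub_norm_le (1 : ℂ) (h w)
    rw [norm_sub_rev, norm_one] at h5
    have h6 : 1 / 2 ≤ ‖h w‖ := by linarith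
    have hne := h0 w (hnX w him)
    rw [hT w him]
    have h7 : h w + (h w)⁻¹ - 2 = (h w - 1) ^ 2 / h w := by field_simp; ring
    rw [h7, norm_div, norm_pow, div_le_div_iff₀ (norm_pos_iff.2 hne) hw0]
    have h8 : ‖h w - 1‖ ^ 2 ≤ (C / ‖w‖) ^ 2 := by gcongr
    have h9 : (C / ‖w‖) ^ 2 * ‖w‖ ≤ C ^ 2 := by
      rw [div_pow, div_mul_eq_mul_div, div_le_iff₀ (by positivity)]
      nlinarith [sq_nonneg C, sq_nonneg ‖w‖, mul_nonneg (sq_nonneg C) hw0.le]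
    nlinarith [sq_nonneg C]) z
  rw [hT z hz] at hT2
  have hne := h0 z (hnX z hz)
  have hsq : (h z - 1) ^ 2 = 0 := by
    field_simp at hT2
    linear_combination hT2
  exact sub_eq_zero.1 (pow_eq_zero_iff (by norm_num) |>.1 hsq)

/-- The reciprocal of a solution of the scalar problem has the same growth. -/
theorem SolvesScalarRHP.exists_growth_inv (hr : D.SolvesScalarRHP L r) :
    ∃ c > 0, ∃ M > 0, ∀ z ∈ D.domain, ‖r z‖ ≤ M * Real.exp (c * ‖z‖ ^ 2) ∧
      ‖(r z)⁻¹‖ ≤ M * Real.exp (c * ‖z‖ ^ 2) := by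
  obtain ⟨c, hc, M, hM, h⟩ := hr.growth.2
  refine ⟨c, hc, M, hM, fun z hz => ⟨by simpa using h z hz, ?_⟩⟩
  rw [inv_eq_of_mul_eq_one_right (hr.mul_conj_eq_one hz.1), norm_conj]
  simpa using h _ (conj_mem_domain hz)

end CandidateData

end NLSPeriodic

end

namespace NLSPeriodic

theorem log_one_add_sq_div_convex {y p e e' : ℝ} (hp : 0 < p) (he' : 0 < e')
    (hmid : 2 * e = p + e') :
    2 * Real.log (1 + y ^ 2 / e ^ 2) ≤
      Real.log (1 + y ^ 2 / p ^ 2) + Real.log (1 + y ^ 2 / e' ^ 2) := by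
  have he : 0 < e := by linarith
  rw [← Real.log_mul (by positivity) (by positivity), two_mul,
    ← Real.log_mul (by positivity) (by positivity)]
  refine Real.log_le_log (by positivity) ?_
  have hpe : p * e' ≤ e ^ 2 := by nlinarith [sq_nonneg (p - e')]
  set u := 1 / p
  set v := 1 / e'
  set w := 1 / e
  have h1 : w ^ 2 ≤ u * v := by
    simp only [u, v, w]
    rw [one_div_mul_one_div, div_pow, one_pow]
    exact one_div_le_one_div_of_le (by positivity) hpe
  have e1 : y ^ 2 / p ^ 2 = y ^ 2 * u ^ 2 := by simp only [u]; ring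
  have e2 : y ^ 2 / e' ^ 2 = y ^ 2 * v ^ 2 := by simp only [v]; ring
  have e3 : y ^ 2 / e ^ 2 = y ^ 2 * w ^ 2 := by simp only [w]; ring
  rw [e1, e2, e3]
  have h2 : 2 * w ^ 2 ≤ u ^ 2 + v ^ 2 := by nlinarith [sq_nonneg (u - v)]
  have h3 : w ^ 2 * w ^ 2 ≤ u ^ 2 * v ^ 2 := by
    have := mul_le_mul h1 h1 (sq_nonneg w) ((sq_nonneg w).trans h1)
    nlinarith
  nlinarith [mul_le_mul_of_nonneg_left h2 (sq_nonneg y),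
    mul_le_mul_of_nonneg_left h3 (sq_nonneg (y ^ 2))]

theorem log_one_add_sq_div_anti {y a b : ℝ} (ha : 0 < a) (hab : a ≤ b) :
    Real.log (1 + y ^ 2 / b ^ 2) ≤ Real.log (1 + y ^ 2 / a ^ 2) := by
  have hb : 0 < b := by linarith
  refine Real.log_le_log (by positivity) ?_
  gcongr

/-- Intervals `[e, e']` that are separated by at least their lengths. -/
theorem sum_log_sub_le {ι : Type*} [LinearOrder ι] {e e' : ι → ℝ} (y : ℝ) (s : Finset ι) :
    (∀ k ∈ s, e k ≤ e' k ∧ 1 ≤ 2 * e k - e' k) →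
    (∀ j ∈ s, ∀ k ∈ s, j < k → e' j ≤ 2 * e k - e' k) →
    ∀ x, 1 ≤ x → (∀ k ∈ s, e' k ≤ x) →
    ∑ k ∈ s, 2 * (Real.log (1 + y ^ 2 / e k ^ 2) - Real.log (1 + y ^ 2 / e' k ^ 2)) ≤
      Real.log (1 + y ^ 2) - Real.log (1 + y ^ 2 / x ^ 2) := by
  induction s using Finset.induction_on_max with
  | empty =>
    intro _ _ x hx _
    have := log_one_add_sq_div_anti (y := y) one_pos hx
    simpa using this
  | insert a s hmax ih =>
    intro h1 h2 x hx hxe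
    have has : a ∉ s := fun h => lt_irrefl _ (hmax a h)
    obtain ⟨ha1, ha2⟩ := h1 a (Finset.mem_insert_self a s)
    have := ih (fun k hk => h1 k (Finset.mem_insert_of_mem hk))
      (fun j hj k hk => h2 j (Finset.mem_insert_of_mem hj) k (Finset.mem_insert_of_mem hk))
      (2 * e a - e' a) ha2
      (fun k hk => h2 k (Finset.mem_insert_of_mem hk) a (Finset.mem_insert_self a s) (hmax k hk))
    rw [Finset.sum_insert has]
    have h3 := log_one_add_sq_div_convex (y := y) (p := 2 * e a - e' a) (e := e a) (e' := e' a)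
      (by linarith) (by linarith) (by ring)
    have h4 := log_one_add_sq_div_anti (y := y) (a := e' a) (b := x) (by linarith)
      (hxe a (Finset.mem_insert_self a s))
    linarith

theorem sum_log_sub_le_half {ι : Type*} [LinearOrder ι] {e e' : ι → ℝ} (y : ℝ) (s : Finset ι)
    (h1 : ∀ k ∈ s, e k ≤ e' k ∧ 1 ≤ 2 * e k - e' k)
    (h2 : ∀ j ∈ s, ∀ k ∈ s, j < k → e' j ≤ 2 * e k - e' k) :
    ∑ k ∈ s, (Real.log (1 + y ^ 2 / e k ^ 2) - Real.log (1 + y ^ 2 / e' k ^ 2)) ≤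
      Real.log (1 + y ^ 2) / 2 := by
  obtain ⟨x, hx⟩ := (s.image e').bddAbove
  have := sum_log_sub_le y s h1 h2 (max x 1) (le_max_right _ _) (fun k hk =>
    (hx (Finset.mem_coe.2 (Finset.mem_image_of_mem e' hk))).trans (le_max_left _ _))
  rw [← Finset.mul_sum] at this
  have h3 : 0 ≤ Real.log (1 + y ^ 2 / max x 1 ^ 2) := by
    refine Real.log_nonneg ?_
    have : 0 ≤ y ^ 2 / max x 1 ^ 2 := by positivity
    linarith
  linarith

theorem exp_logPrimary {a : ℝ} {z : ℂ} (h : z ≠ a) : exp (logPrimary a z) = primary a z := by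
  unfold logPrimary primary
  split_ifs with ha
  · exact exp_log (by simpa [ha] using h)
  · rw [exp_add, exp_log]
    intro h0
    have ha' : (a : ℂ) ≠ 0 := by exact_mod_cast ha
    apply h
    field_simp at h0
    linear_combination -h0

/-- The logarithm of the modulus of the primary factor without its exponential. -/
def logMod (a : ℝ) (z : ℂ) : ℝ := if a = 0 then Real.log ‖z‖ else Real.log ‖1 - z / a‖

theorem re_logPrimary (a : ℝ) (z : ℂ) : (logPrimary a z).re = logMod a z + z.re * a⁻¹ := by
  unfold logPrimary logMod
  split_ifs with ha
  · simp [ha, log_re]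
  · rw [add_re, log_re, ← ofReal_inv_mul_re a z]
where
  ofReal_inv_mul_re (a : ℝ) (z : ℂ) : (z / a).re = z.re * a⁻¹ := by
    rw [div_ofReal_re, div_eq_mul_inv]

theorem logMod_mul_I {a : ℝ} (ha : a ≠ 0) (y : ℝ) :
    logMod a (y * I) = Real.log (1 + y ^ 2 / a ^ 2) / 2 := by
  rw [logMod, if_neg ha]
  have h1 : ‖1 - (y * I : ℂ) / a‖ ^ 2 = 1 + y ^ 2 / a ^ 2 := by
    have h2 : 1 - (y * I : ℂ) / a = ((1 : ℝ) : ℂ) + ((-(y / a) : ℝ) : ℂ) * I := by push_cast; ring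
    rw [h2, ← normSq_eq_norm_sq, normSq_add_mul_I]; ring
  rw [← h1, Real.log_pow]; push_cast; ring

theorem norm_le_of_mem_sector {ε : ℝ} {z : ℂ} (hz : z ∈ sector ε) (a : ℝ) :
    ε * ‖z‖ ≤ ‖(a : ℂ) - z‖ := by
  have h1 := abs_im_le_norm ((a : ℂ) - z)
  rw [sub_im, ofReal_im, zero_sub, abs_neg] at h1
  exact le_trans hz h1

theorem exists_abs_logMod_sub_le (a : ℝ) {ε : ℝ} (hε : 0 < ε) : ∃ C, 0 ≤ C ∧ ∀ z ∈ sector ε,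
    1 ≤ ‖z‖ → |logMod a z - Real.log ‖z‖| ≤ C := by
  by_cases ha : a = 0
  · exact ⟨0, le_rfl, fun z _ _ => by simp [logMod, ha]⟩
  · have hapos : 0 < |a| := abs_pos.2 ha
    refine ⟨|Real.log (ε / |a|)| + |Real.log ((1 + |a|) / |a|)|, by positivity, fun z hz hz1 => ?_⟩
    have hz0 : 0 < ‖z‖ := by linarith
    have h1 : ‖1 - z / a‖ = ‖(a : ℂ) - z‖ / |a| := by
      have ha' : (a : ℂ) ≠ 0 := by exact_mod_cast ha
      have h2 : 1 - z / a = ((a : ℂ) - z) / a := by field_simp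
      rw [h2, norm_div, norm_real, Real.norm_eq_abs]
    have h2 := norm_le_of_mem_sector hz a
    have h3 : ‖(a : ℂ) - z‖ ≤ (1 + |a|) * ‖z‖ := by
      have := norm_sub_le (a : ℂ) z
      rw [norm_real, Real.norm_eq_abs] at this
      nlinarith
    have h4 : ε / |a| * ‖z‖ ≤ ‖1 - z / a‖ := by
      rw [h1, div_mul_eq_mul_div]; gcongr
    have h5 : ‖1 - z / a‖ ≤ (1 + |a|) / |a| * ‖z‖ := by
      rw [h1, div_mul_eq_mul_div]; gcongr
    have h6 := Real.log_le_log (by positivity) h4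
    have h7 := Real.log_le_log (lt_of_lt_of_le (by positivity) h4) h5
    rw [Real.log_mul (by positivity) (by positivity)] at h6 h7
    rw [logMod, if_neg ha, abs_le]
    have h8 := neg_abs_le (Real.log (ε / |a|))
    have h9 := le_abs_self (Real.log ((1 + |a|) / |a|))
    have h10 := abs_nonneg (Real.log (ε / |a|))
    have h11 := abs_nonneg (Real.log ((1 + |a|) / |a|))
    constructor <;> linarith

theorem logMod_sub_le {ε : ℝ} (hε : 0 < ε) {z : ℂ} (hz : z ∈ sector ε) (hz1 : 1 ≤ ‖z‖) {γ e : ℝ}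
    (hγ : γ ≠ 0) (he : e ≠ 0) :
    logMod γ z - logMod e z ≤ 2 / ε * |γ - e| * (|γ|⁻¹ * (√|e|)⁻¹) * √‖z‖ := by
  have hz0 : 0 < ‖z‖ := by linarith
  have hε1 : ε ≤ 1 := by
    have h1 : ε * ‖z‖ ≤ |z.im| := hz
    have h2 := abs_im_le_norm z
    nlinarith
  have hγC : (γ : ℂ) ≠ 0 := by exact_mod_cast hγ
  have heC : (e : ℂ) ≠ 0 := by exact_mod_cast he
  have hne : ∀ a : ℝ, 0 < ‖(a : ℂ) - z‖ := fun a =>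
    lt_of_lt_of_le (by positivity) (norm_le_of_mem_sector hz a)
  have hform : ∀ a : ℝ, a ≠ 0 → 1 - z / a = ((a : ℂ) - z) / a := by
    intro a ha
    have : (a : ℂ) ≠ 0 := by exact_mod_cast ha
    field_simp
  have hγ0 : 0 < ‖1 - z / γ‖ := by
    rw [hform γ hγ, norm_div]; exact div_pos (hne γ) (norm_pos_iff.2 hγC)
  have he0 : 0 < ‖1 - z / e‖ := by
    rw [hform e he, norm_div]; exact div_pos (hne e) (norm_pos_iff.2 heC)
  rw [logMod, if_neg hγ, logMod, if_neg he, ← Real.log_div hγ0.ne' he0.ne']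
  have h1 := Real.log_le_sub_one_of_pos (div_pos hγ0 he0)
  refine h1.trans ?_
  have h2 : ‖1 - z / γ‖ / ‖1 - z / e‖ - 1 ≤ ‖(1 - z / γ) - (1 - z / e)‖ / ‖1 - z / e‖ := by
    rw [sub_le_iff_le_add, div_add_one he0.ne']
    gcongr
    exact norm_le_norm_sub_add _ _
  refine h2.trans ?_
  have h3 : ‖(1 - z / γ) - (1 - z / e)‖ / ‖1 - z / e‖ = ‖z‖ * |γ - e| / (|γ| * ‖(e : ℂ) - z‖) := by
    rw [← norm_div]
    have h4 : (1 - z / γ - (1 - z / e)) / (1 - z / e) =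
        z * ((γ - e : ℝ) : ℂ) / (γ * ((e : ℂ) - z)) := by
      have : (e : ℂ) - z ≠ 0 := norm_pos_iff.1 (hne e)
      rw [hform e he]
      push_cast
      field_simp
      ring
    rw [h4, norm_div, norm_mul, norm_mul, norm_real, norm_real, Real.norm_eq_abs, Real.norm_eq_abs]
  rw [h3]
  have hsq : ε / 2 * (√‖z‖ * √|e|) ≤ ‖(e : ℂ) - z‖ := by
    have h5 := norm_le_of_mem_sector hz e
    have h6 : |e| ≤ ‖(e : ℂ) - z‖ + ‖z‖ := by
      have := norm_le_norm_sub_add (e : ℂ) z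
      rwa [norm_real, Real.norm_eq_abs] at this
    have h7 : ε * |e| ≤ 2 * ‖(e : ℂ) - z‖ := by nlinarith [hne e]
    refine abs_le_of_sq_le_sq' ?_ (norm_nonneg _) |>.2
    rw [mul_pow, mul_pow, Real.sq_sqrt hz0.le, Real.sq_sqrt (abs_nonneg e)]
    have h8 := mul_le_mul h5 h7 (by positivity) (norm_nonneg _)
    nlinarith
  have he' : 0 < √|e| := Real.sqrt_pos.2 (abs_pos.2 he)
  have hz' : 0 < √‖z‖ := Real.sqrt_pos.2 hz0
  have hγ' : 0 < |γ| := abs_pos.2 hγ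
  calc ‖z‖ * |γ - e| / (|γ| * ‖(e : ℂ) - z‖)
      ≤ ‖z‖ * |γ - e| / (|γ| * (ε / 2 * (√‖z‖ * √|e|))) := by gcongr
    _ = _ := by
        have : ‖z‖ = √‖z‖ * √‖z‖ := (Real.mul_self_sqrt hz0.le).symm
        generalize √‖z‖ = q at *
        rw [this]
        field_simp

namespace CandidateData

variable {D : CandidateData}

variable (D) in
theorem summable_rpow {s : ℝ} (hs : 1 < s) :
    Summable fun k : D.K => (1 + |((k : ℤ) : ℝ)|) ^ (-s) := by
  have h1 : Summable fun n : ℤ => (1 + |(n : ℝ)|) ^ (-s) := by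
    refine Summable.of_norm_bounded_eventually (Real.summable_abs_int_rpow hs) ?_
    have : ∀ᶠ n : ℤ in cofinite, n ≠ 0 := by
      rw [eventually_cofinite]; simp
    filter_upwards [this] with n hn
    have hn' : 0 < |(n : ℝ)| := abs_pos.2 (by exact_mod_cast hn)
    rw [Real.norm_of_nonneg (by positivity)]
    exact Real.rpow_le_rpow_of_nonpos hn' (by linarith) (by linarith)
  exact h1.comp_injective Subtype.val_injective

variable (D) in
theorem eventually_le_abs (ρ : ℝ) : ∀ᶠ k : D.K in cofinite,
    ∀ x ∈ Set.Icc (D.E (2 * k - 1)) (D.E (2 * k)), ρ ≤ |x| := by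
  have h := (D.finite_gaps_meeting ρ).preimage (Subtype.val_injective (p := (· ∈ D.K))).injOn
  rw [eventually_cofinite]
  refine h.subset fun k hk => ?_
  simp only [Set.mem_ofPred_eq, not_forall, not_le] at hk
  obtain ⟨x, hx, hxρ⟩ := hk
  exact ⟨k.2, x, hx, hxρ.le⟩

variable (D) in
theorem eventually_linear_bound : ∃ η > 0, ∀ᶠ k : D.K in cofinite,
    ∀ x ∈ Set.Icc (D.E (2 * k - 1)) (D.E (2 * k)), η * (1 + |((k : ℤ) : ℝ)|) ≤ |x| := by
  obtain ⟨η, hη, h⟩ := D.exists_linear_bound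
  refine ⟨η / 2, by positivity, ?_⟩
  filter_upwards [D.eventually_le_abs 1] with k hk x hx
  linarith [h k k.2 x hx, hk x hx]

theorem summable_logPrimary {a : ℤ → ℝ}
    (ha : ∀ k ∈ D.K, a k ∈ Set.Icc (D.E (2 * k - 1)) (D.E (2 * k))) (z : ℂ) :
    Summable fun k : D.K => logPrimary (a k) z := by
  obtain ⟨η, hη, h⟩ := D.eventually_linear_bound
  refine Summable.of_norm_bounded_eventually
    ((D.summable_rpow (s := 2) (by norm_num)).mul_left (‖z‖ ^ 2 / η ^ 2)) ?_
  filter_upwards [h, D.eventually_le_abs (2 * ‖z‖ + 1)] with k hk hk2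
  have h1 := hk _ (ha k k.2)
  have h2 := hk2 _ (ha k k.2)
  have hn := norm_nonneg z
  have hapos : 0 < |a k| := by linarith
  have ha0 : a k ≠ 0 := abs_pos.1 hapos
  have hw : ‖-(z / (a k : ℂ))‖ ≤ 1 / 2 := by
    rw [norm_neg, norm_div, norm_real, Real.norm_eq_abs, div_le_iff₀ hapos]; linarith
  have h3 := norm_log_one_add_sub_self_le (z := -(z / (a k : ℂ))) (by linarith)
  have h4 : ‖-(z / (a k : ℂ))‖ ^ 2 * (1 - ‖-(z / (a k : ℂ))‖)⁻¹ / 2 ≤ ‖-(z / (a k : ℂ))‖ ^ 2 := by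
    have : (1 - ‖-(z / (a k : ℂ))‖)⁻¹ ≤ 2 := by
      rw [inv_le_comm₀ (by linarith) (by norm_num)]; linarith
    nlinarith [sq_nonneg ‖-(z / (a k : ℂ))‖]
  rw [logPrimary, if_neg ha0]
  have h5 : log (1 - z / (a k : ℂ)) + z / (a k : ℂ) =
      log (1 + -(z / (a k : ℂ))) - -(z / (a k : ℂ)) := by rw [sub_neg_eq_add, ← sub_eq_add_neg]
  rw [h5]
  refine (h3.trans h4).trans ?_
  rw [norm_neg, norm_div, norm_real, Real.norm_eq_abs, Real.rpow_neg (by positivity), Real.rpow_two,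
    div_pow, ← div_eq_mul_inv, div_div, ← mul_pow]
  gcongr

theorem tprod_primary_eq_exp {p : ℤ → Prop} {z : ℂ} (hz : ∀ k ∈ D.K, z ≠ D.γ k) :
    ∏' k : {k // k ∈ D.K ∧ p k}, primary (D.γ k) z =
      exp (∑' k : {k // k ∈ D.K ∧ p k}, logPrimary (D.γ k) z) := by
  have hs : Summable fun k : {k // k ∈ D.K ∧ p k} => logPrimary (D.γ k) z :=
    (summable_logPrimary D.γ_mem z).comp_injective
      (i := fun k : {k // k ∈ D.K ∧ p k} => (⟨k.1, k.2.1⟩ : D.K))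
      (fun j k h => Subtype.ext (congrArg (fun x : D.K => (x : ℤ)) h))
  have h1 := hs.hasSum.cexp
  have h2 : (exp ∘ fun k : {k // k ∈ D.K ∧ p k} => logPrimary (D.γ k) z) =
      fun k : {k // k ∈ D.K ∧ p k} => primary (D.γ k) z := by
    funext k
    exact exp_logPrimary (hz k k.2.1)
  rw [h2] at h1
  exact h1.tprod_eq

theorem fPlus_ne_zero {z : ℂ} (hz : ∀ k ∈ D.K, z ≠ D.γ k) : D.fPlus z ≠ 0 := by
  rw [fPlus, tprod_primary_eq_exp (p := fun k => D.σ k = 1) hz]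
  exact exp_ne_zero _

theorem fMinus_ne_zero {z : ℂ} (hz : ∀ k ∈ D.K, z ≠ D.γ k) : D.fMinus z ≠ 0 := by
  rw [fMinus, tprod_primary_eq_exp (p := fun k => D.σ k = -1) hz]
  exact exp_ne_zero _

theorem tsum_subtype_eq {p : ℤ → Prop} [DecidablePred p] (f : ℤ → ℂ) :
    ∑' k : {k // k ∈ D.K ∧ p k}, f k = ∑' k : D.K, if p k then f k else 0 := by
  refine (tsum_subtype {k | k ∈ D.K ∧ p k} f).trans ?_
  rw [tsum_subtype D.K fun k => if p k then f k else 0]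
  congr 1
  funext k
  by_cases h1 : k ∈ D.K <;> by_cases h2 : p k <;> simp [Set.indicator, h1, h2]

/-- The summand of `log |det B|` without the exponential factors. -/
def logTerm (D : CandidateData) (k : ℤ) (z : ℂ) : ℝ :=
  logMod (D.γ k) z - logMod (D.E (2 * k - 1)) z / 2 - logMod (D.E (2 * k)) z / 2

/-- The coefficient of `z` in the exponential factors. -/
def expCoeff (D : CandidateData) (k : ℤ) : ℝ :=
  (D.γ k)⁻¹ - (D.E (2 * k - 1))⁻¹ / 2 - (D.E (2 * k))⁻¹ / 2

theorem norm_branchConst (D : CandidateData) : ‖D.branchConst‖ = 1 := by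
  unfold branchConst
  split_ifs <;> simp

theorem abs_sub_le_R {k : ℤ} (hk : k ∈ D.K) {x y : ℝ}
    (hx : x ∈ Set.Icc (D.E (2 * k - 1)) (D.E (2 * k)))
    (hy : y ∈ Set.Icc (D.E (2 * k - 1)) (D.E (2 * k))) : |x - y| ≤ D.R := by
  have := gap_le_R hk
  rw [abs_le]
  constructor <;> linarith [hx.1, hx.2, hy.1, hy.2]

variable (D) in
theorem summable_expCoeff : Summable fun k : D.K => D.expCoeff k := by
  obtain ⟨η, hη, h⟩ := D.eventually_linear_bound
  have hR := R_pos (D := D)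
  refine Summable.of_norm_bounded_eventually
    ((D.summable_rpow (s := 2) (by norm_num)).mul_left (D.R / η ^ 2)) ?_
  filter_upwards [h] with k hk
  have key : ∀ e ∈ Set.Icc (D.E (2 * k - 1)) (D.E (2 * k)), |(D.γ k)⁻¹ - e⁻¹| ≤
      D.R / η ^ 2 * (1 + |((k : ℤ) : ℝ)|) ^ (-2 : ℝ) := by
    intro e he
    have hγ := D.γ_mem k k.2
    have h1 := hk _ hγ
    have h2 := hk _ he
    have hpos : 0 < η * (1 + |((k : ℤ) : ℝ)|) := by positivity
    have hγ0 : D.γ k ≠ 0 := abs_pos.1 (hpos.trans_le h1)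
    have he0 : e ≠ 0 := abs_pos.1 (hpos.trans_le h2)
    rw [inv_sub_inv hγ0 he0, abs_div, abs_mul, Real.rpow_neg (by positivity), Real.rpow_two,
      ← div_eq_mul_inv, div_div, ← mul_pow, sq]
    gcongr
    exact abs_sub_le_R k.2 he hγ
  have h1 := key _ (E_left_mem k.2)
  have h2 := key _ (E_right_mem k.2)
  rw [Real.norm_eq_abs]
  have h3 : D.expCoeff k = ((D.γ k)⁻¹ - (D.E (2 * k - 1))⁻¹) / 2 +
      ((D.γ k)⁻¹ - (D.E (2 * k))⁻¹) / 2 := by unfold expCoeff; ring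
  rw [h3]
  rw [abs_le] at h1 h2 ⊢
  constructor <;> linarith [h1.1, h1.2, h2.1, h2.2]

theorem summable_logTerm_add (z : ℂ) :
    Summable fun k : D.K => D.logTerm k z + z.re * D.expCoeff k := by
  have hγ := summable_logPrimary D.γ_mem z
  have h1 := summable_logPrimary (D := D) (a := fun k => D.E (2 * k - 1))
    (fun k hk => E_left_mem hk) z
  have h2 := summable_logPrimary (D := D) (a := fun k => D.E (2 * k))
    (fun k hk => E_right_mem hk) z
  have h3 := reCLM.summable ((hγ.sub (h1.div_const 2)).sub (h2.div_const 2))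
  refine h3.congr fun k => ?_
  rw [reCLM_apply, sub_re, sub_re, re_logPrimary, ← ofReal_ofNat, div_ofReal_re, div_ofReal_re,
    re_logPrimary, re_logPrimary, logTerm, expCoeff]
  ring

theorem summable_logTerm (z : ℂ) : Summable fun k : D.K => D.logTerm k z :=
  ((summable_logTerm_add z).sub (D.summable_expCoeff.mul_left z.re)).congr fun k => by ring

theorem norm_det_B {z : ℂ} (hz : z.im ≠ 0) : ‖(D.B z).det‖ =
    1 / 2 * Real.exp ((∑' k : D.K, D.logTerm k z) + z.re * ∑' k : D.K, D.expCoeff k) := by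
  have hzγ : ∀ k ∈ D.K, z ≠ D.γ k := fun k _ h => hz (by rw [h, ofReal_im])
  have hdet : ‖(D.B z).det‖ = ‖D.scalarFactor z‖ ^ 2 * ‖D.fPlus z‖ * ‖D.fMinus z‖ := by
    unfold B
    split_ifs
    · rw [Matrix.det_smul, Matrix.det_fin_two_of]
      simp; ring
    · rw [Matrix.det_smul, Matrix.det_fin_two_of]
      simp; ring
  have hsc : ‖D.scalarFactor z‖ ^ 2 = 1 / 2 * ‖D.rootRatio z‖ ^ 2 := by
    have h1 : ‖exp (Real.pi * I / 4)‖ = 1 := by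
      have := norm_exp_ofReal_mul_I (Real.pi / 4)
      rw [← this]
      congr 2
      push_cast; ring
    have h2 : ‖(if 0 < z.im then 1 else D.branchConst)‖ = 1 := by
      split_ifs
      · exact norm_one
      · exact norm_branchConst D
    have h3 : ‖((√2 : ℝ) : ℂ)‖ ^ 2 = 2 := by
      rw [norm_real, Real.norm_eq_abs, sq_abs, Real.sq_sqrt (by norm_num)]
    unfold scalarFactor
    rw [norm_mul, norm_div, norm_mul, h1, h2, one_mul, mul_pow, div_pow, h3, one_pow]
  have hγ := summable_logPrimary D.γ_mem z
  have h1 := summable_logPrimary (D := D) (a := fun k => D.E (2 * k - 1))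
    (fun k hk => E_left_mem hk) z
  have h2 := summable_logPrimary (D := D) (a := fun k => D.E (2 * k))
    (fun k hk => E_right_mem hk) z
  have hind : ∀ (p : ℤ → Prop) [DecidablePred p], Summable fun k : D.K =>
      if p k then logPrimary (D.γ k) z else 0 := by
    intro p _
    refine (hγ.indicator {k : D.K | p k}).congr fun k => ?_
    simp [Set.indicator]
  have s0 : Summable fun k : D.K => ((if D.σ k = 0 then logPrimary (D.γ k) z / 2 else 0)
      - logPrimary (D.E (2 * k - 1)) z / 4 - logPrimary (D.E (2 * k)) z / 4) := by
    refine Summable.sub (Summable.sub ?_ (h1.div_const 4)) (h2.div_const 4)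
    refine ((hind fun k => D.σ k = 0).div_const 2).congr fun k => ?_
    split_ifs <;> simp
  have hfp : D.fPlus z = exp (∑' k : D.K, if D.σ k = 1 then logPrimary (D.γ k) z else 0) := by
    rw [fPlus, tprod_primary_eq_exp (p := fun k => D.σ k = 1) hzγ,
      tsum_subtype_eq (p := fun k => D.σ k = 1) fun k => logPrimary (D.γ k) z]
  have hfm : D.fMinus z = exp (∑' k : D.K, if D.σ k = -1 then logPrimary (D.γ k) z else 0) := by
    rw [fMinus, tprod_primary_eq_exp (p := fun k => D.σ k = -1) hzγ,
      tsum_subtype_eq (p := fun k => D.σ k = -1) fun k => logPrimary (D.γ k) z]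
  rw [hdet, hsc, mul_assoc, mul_assoc, hfp, hfm, rootRatio, ← norm_pow, ← norm_mul, ← norm_mul,
    sq, ← exp_add, ← exp_add, ← exp_add, norm_exp, ← s0.tsum_add s0,
    ← (hind fun k => D.σ k = 1).tsum_add (hind fun k => D.σ k = -1),
    ← (s0.add s0).tsum_add ((hind fun k => D.σ k = 1).add (hind fun k => D.σ k = -1)),
    ← tsum_mul_left, ← (summable_logTerm z).tsum_add (D.summable_expCoeff.mul_left z.re)]
  congr 2
  rw [← reCLM_apply, reCLM.map_tsum
    ((s0.add s0).add ((hind fun k => D.σ k = 1).add (hind fun k => D.σ k = -1)))]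
  refine tsum_congr fun k => ?_
  have hterm : (if D.σ k = 0 then logPrimary (D.γ k) z / 2 else 0)
      - logPrimary (D.E (2 * k - 1)) z / 4 - logPrimary (D.E (2 * k)) z / 4 +
      ((if D.σ k = 0 then logPrimary (D.γ k) z / 2 else 0)
      - logPrimary (D.E (2 * k - 1)) z / 4 - logPrimary (D.E (2 * k)) z / 4) +
      ((if D.σ k = 1 then logPrimary (D.γ k) z else 0) +
        if D.σ k = -1 then logPrimary (D.γ k) z else 0) =
      logPrimary (D.γ k) z - logPrimary (D.E (2 * k - 1)) z / 2
        - logPrimary (D.E (2 * k)) z / 2 := by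
    rcases SignType.trichotomy (D.σ k) with h | h | h <;> simp [h] <;> ring
  rw [hterm, reCLM_apply, sub_re, sub_re, re_logPrimary, ← ofReal_ofNat, div_ofReal_re,
    div_ofReal_re, re_logPrimary, re_logPrimary, logTerm, expCoeff]
  ring

theorem det_B_ne_zero {z : ℂ} (hz : z.im ≠ 0) : (D.B z).det ≠ 0 := by
  rw [← norm_pos_iff, norm_det_B hz]
  positivity

theorem exists_logTerm_le (D : CandidateData) (k : ℤ) {ε : ℝ} (hε : 0 < ε) :
    ∃ C, 0 ≤ C ∧ ∀ z ∈ sector ε, 1 ≤ ‖z‖ → D.logTerm k z ≤ C := by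
  obtain ⟨C₁, h₁, H₁⟩ := exists_abs_logMod_sub_le (D.γ k) hε
  obtain ⟨C₂, h₂, H₂⟩ := exists_abs_logMod_sub_le (D.E (2 * k - 1)) hε
  obtain ⟨C₃, h₃, H₃⟩ := exists_abs_logMod_sub_le (D.E (2 * k)) hε
  refine ⟨C₁ + C₂ + C₃, by positivity, fun z hz hz1 => ?_⟩
  have a1 := abs_le.1 (H₁ z hz hz1)
  have a2 := abs_le.1 (H₂ z hz hz1)
  have a3 := abs_le.1 (H₃ z hz hz1)
  unfold logTerm
  linarith [a1.2, a2.1, a3.1]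

variable (D) in
theorem exists_tsum_logTerm_le_sqrt {ε : ℝ} (hε : 0 < ε) : ∃ C, 0 ≤ C ∧ ∀ z ∈ sector ε, 1 ≤ ‖z‖ →
    ∑' k : D.K, D.logTerm k z ≤ C * √‖z‖ := by
  classical
  obtain ⟨η, hη, h⟩ := D.eventually_linear_bound
  have hR := R_pos (D := D)
  choose C hC0 hC using fun k : D.K => D.exists_logTerm_le k hε
  set A := 2 / ε * D.R * (η ^ (-(3 / 2) : ℝ)) with hA
  set good : D.K → Prop := fun k =>
    ∀ x ∈ Set.Icc (D.E (2 * k - 1)) (D.E (2 * k)), η * (1 + |((k : ℤ) : ℝ)|) ≤ |x| with hgood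
  set C' : D.K → ℝ := fun k =>
    if good k then A * (1 + |((k : ℤ) : ℝ)|) ^ (-(3 / 2) : ℝ) else C k with hC'
  have hC'0 : ∀ k, 0 ≤ C' k := by
    intro k
    simp only [hC']
    split_ifs
    · positivity
    · exact hC0 k
  have hsum : Summable C' := by
    refine Summable.of_norm_bounded_eventually
      ((D.summable_rpow (s := 3 / 2) (by norm_num)).mul_left A) ?_
    filter_upwards [h] with k hk
    rw [Real.norm_of_nonneg (hC'0 k)]
    have : good k := hk
    simp only [hC', if_pos this]
    exact le_rfl
  refine ⟨∑' k, C' k, tsum_nonneg hC'0, fun z hz hz1 => ?_⟩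
  rw [← tsum_mul_right]
  refine (summable_logTerm z).tsum_le_tsum (fun k => ?_) (hsum.mul_right _)
  have hsq1 : 1 ≤ √‖z‖ := Real.one_le_sqrt.2 hz1
  by_cases hk : good k
  · simp only [hC', if_pos hk]
    have hpos : 0 < η * (1 + |((k : ℤ) : ℝ)|) := by positivity
    have key : ∀ e ∈ Set.Icc (D.E (2 * k - 1)) (D.E (2 * k)),
        logMod (D.γ k) z - logMod e z ≤ A * (1 + |((k : ℤ) : ℝ)|) ^ (-(3 / 2) : ℝ) * √‖z‖ := by
      intro e he
      have hγ := D.γ_mem k k.2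
      have h1 := hk _ hγ
      have h2 := hk _ he
      refine (logMod_sub_le hε hz hz1 (abs_pos.1 (hpos.trans_le h1))
        (abs_pos.1 (hpos.trans_le h2))).trans ?_
      refine mul_le_mul_of_nonneg_right ?_ (Real.sqrt_nonneg _)
      have h3 : |D.γ k|⁻¹ * (√|e|)⁻¹ ≤ (η * (1 + |((k : ℤ) : ℝ)|)) ^ (-(3 / 2) : ℝ) := by
        have h4 : (η * (1 + |((k : ℤ) : ℝ)|)) ^ (-(3 / 2) : ℝ) =
            (η * (1 + |((k : ℤ) : ℝ)|))⁻¹ * (√(η * (1 + |((k : ℤ) : ℝ)|)))⁻¹ := by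
          rw [Real.sqrt_eq_rpow, ← Real.rpow_neg hpos.le, ← Real.rpow_neg_one, ← Real.rpow_add hpos]
          norm_num
        rw [h4]
        gcongr
      calc 2 / ε * |D.γ k - e| * (|D.γ k|⁻¹ * (√|e|)⁻¹)
          ≤ 2 / ε * D.R * (η * (1 + |((k : ℤ) : ℝ)|)) ^ (-(3 / 2) : ℝ) := by
            gcongr
            exact abs_sub_le_R k.2 hγ he
        _ = _ := by rw [Real.mul_rpow hη.le (by positivity), hA]; ring
    have h1 := key _ (E_left_mem k.2)
    have h2 := key _ (E_right_mem k.2)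
    unfold logTerm
    linarith
  · simp only [hC', if_neg hk]
    have := hC k z hz hz1
    nlinarith [hC0 k]

end CandidateData

end NLSPeriodic

namespace NLSPeriodic

namespace CandidateData

variable {D : CandidateData}

variable (D) in
theorem exists_tsum_logTerm_le_log : ∃ C, ∀ y : ℝ, 1 ≤ |y| →
    ∑' k : D.K, D.logTerm k (y * I) ≤ Real.log (1 + y ^ 2) / 4 + C := by
  classical
  obtain ⟨N, hN0, hN⟩ := D.exists_two_R_le
  have hR := R_pos (D := D)
  choose C hC0 hC using fun k : D.K => D.exists_logTerm_le k one_pos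
  set P : D.K → Prop := fun k => N ≤ |(k : ℤ)| ∧ 1 + D.R ≤ D.E (2 * k - 1) with hP
  set Q : D.K → Prop := fun k => N ≤ |(k : ℤ)| ∧ D.E (2 * k) ≤ -(1 + D.R) with hQ
  have hfin : {k : D.K | ¬P k ∧ ¬Q k}.Finite := by
    have h1 : ∀ᶠ k : D.K in cofinite, N ≤ |(k : ℤ)| := by
      rw [eventually_cofinite]
      have : {k : ℤ | |k| < N}.Finite := (Set.finite_Ioo (-N) N).subset fun k hk => abs_lt.1 hk
      exact (this.preimage (Subtype.val_injective (p := (· ∈ D.K))).injOn).subset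
        fun k hk => not_le.1 hk
    have h2 : ∀ᶠ k : D.K in cofinite, P k ∨ Q k := by
      filter_upwards [h1, D.eventually_le_abs (2 + 2 * D.R)] with k hk hk2
      have h3 := hk2 _ (E_left_mem k.2)
      have h4 := gap_le_R k.2
      rcases abs_cases (D.E (2 * k - 1)) with ⟨h5, -⟩ | ⟨h5, -⟩
      · exact Or.inl ⟨hk, by linarith⟩
      · exact Or.inr ⟨hk, by linarith⟩
    rw [eventually_cofinite] at h2
    exact h2.subset fun k hk => by
      simp only [Set.mem_ofPred_eq, not_or] at hk ⊢
      exact hk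
  refine ⟨∑ k ∈ hfin.toFinset, C k, fun y hy => ?_⟩
  refine (summable_logTerm _).tsum_le_of_sum_le fun s => ?_
  have hlogm : ∀ k : D.K, D.γ k ≠ 0 → D.E (2 * k - 1) ≠ 0 → D.E (2 * k) ≠ 0 →
      D.logTerm k (y * I) = Real.log (1 + y ^ 2 / D.γ k ^ 2) / 2
        - Real.log (1 + y ^ 2 / D.E (2 * k - 1) ^ 2) / 4
        - Real.log (1 + y ^ 2 / D.E (2 * k) ^ 2) / 4 := by
    intro k h1 h2 h3
    rw [logTerm, logMod_mul_I h1, logMod_mul_I h2, logMod_mul_I h3]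
    ring
  have hPle : ∑ k ∈ s.filter P, D.logTerm k (y * I) ≤ Real.log (1 + y ^ 2) / 8 := by
    have h1 := sum_log_sub_le_half (e := fun k : D.K => D.E (2 * k - 1))
      (e' := fun k : D.K => D.E (2 * k)) y (s.filter P)
      (fun k hk => by
        obtain ⟨-, h1, h2⟩ := Finset.mem_filter.1 hk
        have h3 := gap_le_R k.2
        have h4 := D.gap_lt k k.2
        exact ⟨h4.le, by linarith⟩)
      (fun j hj k hk hjk => by
        obtain ⟨-, h1, h2⟩ := Finset.mem_filter.1 hk
        obtain ⟨-, h3, h4⟩ := Finset.mem_filter.1 hj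
        have h5 := hN j j.2 k k.2 h3 h1 hjk
        have h6 := gap_le_R k.2
        have h7 := gap_le_R j.2
        unfold mid at h5
        linarith)
    calc _ ≤ ∑ k ∈ s.filter P, (1 / 4 : ℝ) * (Real.log (1 + y ^ 2 / D.E (2 * k - 1) ^ 2)
          - Real.log (1 + y ^ 2 / D.E (2 * k) ^ 2)) := by
          refine Finset.sum_le_sum fun k hk => ?_
          obtain ⟨-, -, h2⟩ := Finset.mem_filter.1 hk
          have hγ := D.γ_mem k k.2
          have h4 := D.gap_lt k k.2
          have hγ1 := hγ.1
          rw [hlogm k (by intro h; linarith) (by intro h; linarith) (by intro h; linarith)]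
          have := log_one_add_sq_div_anti (y := y) (a := D.E (2 * k - 1)) (by linarith) hγ.1
          linarith
      _ ≤ _ := by rw [← Finset.mul_sum]; linarith
  have hQle : ∑ k ∈ (s.filter (¬P ·)).filter Q, D.logTerm k (y * I) ≤ Real.log (1 + y ^ 2) / 8 := by
    have h1 := sum_log_sub_le_half (ι := (D.K)ᵒᵈ)
      (e := fun k => -D.E (2 * (OrderDual.ofDual k : D.K)))
      (e' := fun k => -D.E (2 * (OrderDual.ofDual k : D.K) - 1)) y ((s.filter (¬P ·)).filter Q)
      (fun k hk => by
        obtain ⟨-, h1, h2⟩ := Finset.mem_filter.1 hk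
        have h3 := gap_le_R (OrderDual.ofDual k).2
        have h4 := D.gap_lt _ (OrderDual.ofDual k).2
        have h2 : D.E (2 * (OrderDual.ofDual k : D.K)) ≤ -(1 + D.R) := h2
        exact ⟨by linarith, by linarith⟩)
      (fun j hj k hk hjk => by
        obtain ⟨-, h1, h2⟩ := Finset.mem_filter.1 hk
        obtain ⟨-, h3, h4⟩ := Finset.mem_filter.1 hj
        have h5 := hN _ (OrderDual.ofDual k).2 _ (OrderDual.ofDual j).2 h1 h3
          (OrderDual.ofDual_lt_ofDual.2 hjk)
        have h6 := gap_le_R (OrderDual.ofDual k).2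
        have h7 := gap_le_R (OrderDual.ofDual j).2
        unfold mid at h5
        linarith)
    calc _ ≤ ∑ k ∈ (s.filter (¬P ·)).filter Q, (1 / 4 : ℝ) *
          (Real.log (1 + y ^ 2 / (-D.E (2 * k)) ^ 2)
          - Real.log (1 + y ^ 2 / (-D.E (2 * k - 1)) ^ 2)) := by
          refine Finset.sum_le_sum fun k hk => ?_
          obtain ⟨-, -, h2⟩ := Finset.mem_filter.1 hk
          have hγ := D.γ_mem k k.2
          have h4 := D.gap_lt k k.2
          have hγ1 := hγ.2
          rw [hlogm k (by intro h; linarith) (by intro h; linarith) (by intro h; linarith)]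
          have := log_one_add_sq_div_anti (y := y) (a := -D.E (2 * k)) (b := -D.γ k) (by linarith)
            (by linarith)
          simp only [neg_sq] at this ⊢
          linarith
      _ = (1 / 4 : ℝ) * ∑ k ∈ (s.filter (¬P ·)).filter Q,
          (Real.log (1 + y ^ 2 / (-D.E (2 * k)) ^ 2)
          - Real.log (1 + y ^ 2 / (-D.E (2 * k - 1)) ^ 2)) := by rw [← Finset.mul_sum]
      _ ≤ (1 / 4 : ℝ) * (Real.log (1 + y ^ 2) / 2) := by
          refine mul_le_mul_of_nonneg_left h1 (by norm_num)
      _ = _ := by ring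
  have hrest : ∑ k ∈ (s.filter (¬P ·)).filter (¬Q ·), D.logTerm k (y * I) ≤
      ∑ k ∈ hfin.toFinset, C k := by
    calc _ ≤ ∑ k ∈ (s.filter (¬P ·)).filter (¬Q ·), C k :=
          Finset.sum_le_sum fun k _ => hC k _ (mem_sector_one y) (by simpa using hy)
      _ ≤ _ := by
          refine Finset.sum_le_sum_of_subset_of_nonneg (fun k hk => ?_) fun k _ _ => hC0 k
          obtain ⟨h1, h2⟩ := Finset.mem_filter.1 hk
          obtain ⟨-, h3⟩ := Finset.mem_filter.1 h1
          exact hfin.mem_toFinset.2 ⟨h3, h2⟩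
  rw [← Finset.sum_filter_add_sum_filter_not s P,
    ← Finset.sum_filter_add_sum_filter_not (s.filter (¬P ·)) Q]
  linarith

theorem notMem_Icc_of_mem_band {n : ℤ} (hn : D.IsBand n) {y : ℝ} (hy : y ∈ D.band n) {k : ℤ}
    (hk : k ∈ D.K) : y ∉ Set.Icc (D.E (2 * k - 1)) (D.E (2 * k)) := by
  intro h
  rcases lt_or_ge k n with hlt | hge
  · have hK : n - 1 ∈ D.K := hn.elim (fun h' => D.consecutive.out hk h' ⟨by omega, by omega⟩) id
    have h1 := hy.1 hK
    have h2 : D.E (2 * k) ≤ D.E (2 * n - 2) := by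
      have h3 : 2 * n - 2 = 2 * (n - 1) := by ring
      rw [h3]
      rcases (by omega : k ≤ n - 1).eq_or_lt with rfl | hlt'
      · exact le_rfl
      · linarith [E_lt_of_lt hk hK hlt', D.gap_lt _ hK]
    linarith [h.2]
  · have hK : n ∈ D.K := hn.elim id (fun h' => D.consecutive.out h' hk ⟨by omega, by omega⟩)
    have h1 := hy.2 hK
    have h2 : D.E (2 * n - 1) ≤ D.E (2 * k - 1) := by
      rcases hge.eq_or_lt with rfl | hlt'
      · exact le_rfl
      · linarith [E_lt_of_lt hK hk hlt', D.gap_lt _ hK]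
    linarith [h.1]

/-- A scalar function by which solutions at times that differ by `L` are related. -/
structure IsGauge (D : CandidateData) (L : ℝ) (g : ℂ → ℂ) : Prop where
  holomorphic : DifferentiableOn ℂ g {z | z.im ≠ 0}
  ne_zero : ∀ z : ℂ, z.im ≠ 0 → g z ≠ 0
  boundary : ∀ y : ℝ, ∃ a b : ℂ, a ≠ 0 ∧ b ≠ 0 ∧ Tendsto g (𝓝[upperHalf] (y : ℂ)) (𝓝 a) ∧
    Tendsto g (𝓝[lowerHalf] (y : ℂ)) (𝓝 b) ∧
    (∀ n, D.IsBand n → y ∈ D.band n → a = b) ∧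
    (∀ n ∈ D.K, y ∈ D.gap n → a * b = exp (-4 * I * y ^ 2 * L))
  growth : ∃ c > 0, ∃ M > 0, ∀ z ∈ D.domain, ‖g z‖ ≤ M * Real.exp (c * ‖z‖ ^ 2) ∧
      ‖(g z)⁻¹‖ ≤ M * Real.exp (c * ‖z‖ ^ 2)

theorem isGauge_one (D : CandidateData) : D.IsGauge 0 fun _ => 1 where
  holomorphic := differentiableOn_const _
  ne_zero _ _ := one_ne_zero
  boundary y := ⟨1, 1, one_ne_zero, one_ne_zero, tendsto_const_nhds, tendsto_const_nhds,
    fun _ _ _ => rfl, fun _ _ _ => by simp⟩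
  growth := ⟨1, one_pos, 1, one_pos, fun z _ => by
    simp⟩

theorem SolvesScalarRHP.isGauge {L : ℝ} {r : ℂ → ℂ} (hr : D.SolvesScalarRHP L r) :
    D.IsGauge L fun z => exp (-2 * I * z ^ 2 * L) * r z where
  holomorphic := by
    refine DifferentiableOn.mul (by fun_prop) (hr.holomorphic.mono fun z hz h => ?_)
    exact hz (im_eq_zero_of_mem_closedGaps h)
  ne_zero z hz := mul_ne_zero (exp_ne_zero _)
    (hr.ne_zero z fun h => hz (im_eq_zero_of_mem_closedGaps h))
  boundary y := by
    have hexp : Tendsto (fun z : ℂ => exp (-2 * I * z ^ 2 * L)) (𝓝 (y : ℂ))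
        (𝓝 (exp (-2 * I * y ^ 2 * L))) :=
      (by fun_prop : Continuous fun z : ℂ => exp (-2 * I * z ^ 2 * L)).tendsto _
    by_cases hy : (y : ℂ) ∈ D.closedGaps
    · obtain ⟨a, b, hab, ha, hb⟩ := hr.exists_boundary hy
      refine ⟨_, _, mul_ne_zero (exp_ne_zero _) (left_ne_zero_of_mul_eq_one hab),
        mul_ne_zero (exp_ne_zero _) (right_ne_zero_of_mul_eq_one hab),
        (hexp.mono_left nhdsWithin_le_nhds).mul ha, (hexp.mono_left nhdsWithin_le_nhds).mul hb,
        fun n hn hyn => ?_, fun n _ _ => ?_⟩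
      · obtain ⟨k, hk, x, hx, hxy⟩ := hy
        obtain rfl : y = x := by exact_mod_cast hxy
        exact absurd hx (notMem_Icc_of_mem_band hn hyn hk)
      · rw [mul_mul_mul_comm, hab, mul_one, ← exp_add]
        ring_nf
    · have hc := ((hr.holomorphic _ hy).differentiableAt
        (D.isClosed_closedGaps.isOpen_compl.mem_nhds hy)).continuousAt
      have ht := hexp.mul hc.tendsto
      have hne := mul_ne_zero (exp_ne_zero (-2 * I * (y : ℂ) ^ 2 * L)) (hr.ne_zero _ hy)
      exact ⟨_, _, hne, hne, ht.mono_left nhdsWithin_le_nhds, ht.mono_left nhdsWithin_le_nhds,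
        fun _ _ _ => rfl, fun n hn hyn => absurd ⟨n, hn, y, Set.Ioo_subset_Icc_self hyn, rfl⟩ hy⟩
  growth := by
    obtain ⟨c, hc, M, hM, h⟩ := hr.exists_growth_inv
    have hexp : ∀ (s : ℝ) (z : ℂ), ‖exp (s * I * z ^ 2 * L)‖ ≤ Real.exp (|s| * |L| * ‖z‖ ^ 2) := by
      intro s z
      refine (norm_exp_le_exp_norm _).trans (Real.exp_le_exp.2 ?_)
      simp only [norm_mul, norm_pow, norm_I, norm_real, Real.norm_eq_abs, mul_one]
      apply le_of_eq; ring
    refine ⟨c + 2 * |L|, by positivity, M, hM, fun z hz => ⟨?_, ?_⟩⟩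
    · have h1 := hexp (-2) z
      rw [norm_mul]
      push_cast at h1
      calc _ ≤ Real.exp (|(-2 : ℝ)| * |L| * ‖z‖ ^ 2) * (M * Real.exp (c * ‖z‖ ^ 2)) := by
            gcongr; exact (h z hz).1
        _ = M * (Real.exp (c * ‖z‖ ^ 2) * Real.exp (2 * |L| * ‖z‖ ^ 2)) := by
            rw [abs_neg, abs_two]; ring
        _ = _ := by rw [← Real.exp_add]; ring_nf
    · have h1 := hexp 2 z
      rw [mul_inv, norm_mul, ← exp_neg]
      have h2 : -(-2 * I * z ^ 2 * L) = ((2 : ℝ) : ℂ) * I * z ^ 2 * L := by push_cast; ring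
      rw [h2]
      calc _ ≤ Real.exp (|(2 : ℝ)| * |L| * ‖z‖ ^ 2) * (M * Real.exp (c * ‖z‖ ^ 2)) := by
            gcongr; exact (h z hz).2
        _ = M * (Real.exp (c * ‖z‖ ^ 2) * Real.exp (2 * |L| * ‖z‖ ^ 2)) := by
            rw [abs_two]; ring
        _ = _ := by rw [← Real.exp_add]; ring_nf

end CandidateData

/-- The product `Φ₁ diag(a⁻¹, a) adj Φ₂`. -/
def gaugeProduct (A : Matrix (Fin 2) (Fin 2) ℂ) (a : ℂ) (B : Matrix (Fin 2) (Fin 2) ℂ) :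
    Matrix (Fin 2) (Fin 2) ℂ := A * !![a⁻¹, 0; 0, a] * B.adjugate

theorem exists_gaugeProduct_apply (i j : Fin 2) : ∃ k : Fin 2, ∃ s : ℂ, ‖s‖ = 1 ∧ ∀ A a B,
    gaugeProduct A a B i j = s * (A i 0 * a⁻¹ * B k 1 - A i 1 * a * B k 0) := by
  fin_cases j
  · refine ⟨1, 1, by simp, fun A a B => ?_⟩
    simp [gaugeProduct, Matrix.mul_apply, Matrix.adjugate_fin_two, Fin.sum_univ_two]
    ring
  · refine ⟨0, -1, by simp, fun A a B => ?_⟩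
    simp [gaugeProduct, Matrix.mul_apply, Matrix.adjugate_fin_two, Fin.sum_univ_two]
    ring

theorem norm_gaugeProduct_le {A B : Matrix (Fin 2) (Fin 2) ℂ} {a : ℂ} {α β κ : ℝ}
    (hA : ∀ i j, ‖A i j‖ ≤ α) (hB : ∀ i j, ‖B i j‖ ≤ β) (ha : ‖a‖ ≤ κ) (ha' : ‖a⁻¹‖ ≤ κ)
    (i j : Fin 2) : ‖gaugeProduct A a B i j‖ ≤ 2 * (α * κ * β) := by
  obtain ⟨k, s, hs, h⟩ := exists_gaugeProduct_apply i j
  have hα := (norm_nonneg _).trans (hA i 0)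
  have hβ := (norm_nonneg _).trans (hB k 0)
  have hκ := (norm_nonneg _).trans ha
  rw [h, norm_mul, hs, one_mul]
  refine (norm_sub_le _ _).trans ?_
  rw [norm_mul, norm_mul, norm_mul, norm_mul, two_mul]
  gcongr
  · exact hA i 0
  · exact hB k 1
  · exact hA i 1
  · exact hB k 0

theorem continuousAt_gaugeProduct {A B : Matrix (Fin 2) (Fin 2) ℂ} {a : ℂ} (ha : a ≠ 0) :
    ContinuousAt (fun p : Matrix (Fin 2) (Fin 2) ℂ × ℂ × Matrix (Fin 2) (Fin 2) ℂ =>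
      gaugeProduct p.1 p.2.1 p.2.2) (A, a, B) := by
  refine tendsto_pi_nhds.2 fun i => tendsto_pi_nhds.2 fun j => ?_
  obtain ⟨k, s, -, h⟩ := exists_gaugeProduct_apply i j
  simp only [h]
  have hA : ∀ i j, ContinuousAt (fun p : Matrix (Fin 2) (Fin 2) ℂ × ℂ × Matrix (Fin 2) (Fin 2) ℂ =>
      p.1 i j) (A, a, B) := fun i j => by fun_prop
  have hB : ∀ i j, ContinuousAt (fun p : Matrix (Fin 2) (Fin 2) ℂ × ℂ × Matrix (Fin 2) (Fin 2) ℂ =>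
      p.2.2 i j) (A, a, B) := fun i j => by fun_prop
  have h1 : ContinuousAt (fun p : Matrix (Fin 2) (Fin 2) ℂ × ℂ × Matrix (Fin 2) (Fin 2) ℂ =>
      p.2.1) (A, a, B) := by fun_prop
  exact continuousAt_const.mul ((((hA i 0).mul (h1.inv₀ ha)).mul (hB k 1)).sub
    (((hA i 1).mul h1).mul (hB k 0)))

namespace CandidateData

variable {D : CandidateData}

theorem gaugeProduct_jumpBand {n : ℤ} (hn : D.IsBand n) {y : ℝ} (hy : y ∈ D.band n)
    (A B : Matrix (Fin 2) (Fin 2) ℂ) (a : ℂ) :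
    gaugeProduct (A * D.jumpBand n y) a (B * D.jumpBand n y) = gaugeProduct A a B := by
  have hγ : ∀ k ∈ D.K, (y : ℂ) ≠ D.γ k := fun k hk h => by
    have h' : y = D.γ k := by exact_mod_cast h
    exact notMem_Icc_of_mem_band hn hy hk (h' ▸ D.γ_mem k hk)
  have hp := fPlus_ne_zero hγ
  have hm := fMinus_ne_zero hγ
  set c : ℂ := (-1 : ℂ) ^ (n + (D.m y : ℤ)) with hc
  have hc2 : c * c = 1 := by
    rw [hc, ← mul_zpow]; simp
  have key : D.jumpBand n y * !![a⁻¹, 0; 0, a] * (D.jumpBand n y).adjugate =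
      !![a⁻¹, 0; 0, a] := by
    rw [jumpBand, ← hc]
    have huv : D.fMinus y / D.fPlus y * (D.fPlus y / D.fMinus y) = 1 := by field_simp
    generalize D.fMinus y / D.fPlus y = u at *
    generalize D.fPlus y / D.fMinus y = v at *
    ext i j
    fin_cases i <;> fin_cases j <;>
      simp [Matrix.mul_apply, Matrix.adjugate_fin_two, Fin.sum_univ_two]
    · linear_combination a⁻¹ * u * v * hc2 + a⁻¹ * huv
    · linear_combination a * u * v * hc2 + a * huv
  unfold gaugeProduct
  rw [Matrix.adjugate_mul_distrib]
  calc A * D.jumpBand n y * !![a⁻¹, 0; 0, a] * ((D.jumpBand n y).adjugate * B.adjugate)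
      = A * (D.jumpBand n y * !![a⁻¹, 0; 0, a] * (D.jumpBand n y).adjugate) * B.adjugate := by
        simp only [Matrix.mul_assoc]
    _ = _ := by rw [key]

theorem gaugeProduct_jumpGap (n : ℤ) (x t y L : ℝ) (A B : Matrix (Fin 2) (Fin 2) ℂ) {a b : ℂ}
    (hb : b ≠ 0) (hab : a * b = exp (-4 * I * y ^ 2 * L)) :
    gaugeProduct (A * D.jumpGap n x t y) a (B * D.jumpGap n x (t + L) y) = gaugeProduct A b B := by
  set c : ℂ := (-1 : ℂ) ^ (n + (D.m y : ℤ)) * I with hc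
  have hc2 : c * c = -1 := by
    rw [hc, mul_mul_mul_comm, ← mul_zpow]; simp
  have key : D.jumpGap n x t y * !![a⁻¹, 0; 0, a] * (D.jumpGap n x (t + L) y).adjugate =
      !![b⁻¹, 0; 0, b] := by
    rw [jumpGap, jumpGap, ← hc]
    set w : ℂ := -2 * I * y * x - 4 * I * y ^ 2 * t with hw
    have hw' : -2 * I * y * x - 4 * I * y ^ 2 * ((t + L : ℝ) : ℂ) = w + -4 * I * y ^ 2 * L := by
      rw [hw]; push_cast; ring
    rw [hw']
    unfold expPauli3 pauli1
    rw [neg_add, exp_add, exp_add, exp_neg (-4 * I * y ^ 2 * L), ← hab, exp_neg w]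
    have hu : exp w ≠ 0 := exp_ne_zero w
    have ha : a ≠ 0 := by
      rintro rfl
      rw [zero_mul] at hab
      exact exp_ne_zero _ hab.symm
    generalize exp w = u at *
    ext i j
    fin_cases i <;> fin_cases j <;>
      simp [Matrix.mul_apply, Matrix.adjugate_fin_two, Fin.sum_univ_two]
    · field_simp
      linear_combination -hc2
    · field_simp
      linear_combination -hc2
  unfold gaugeProduct
  rw [Matrix.adjugate_mul_distrib]
  calc A * D.jumpGap n x t y * !![a⁻¹, 0; 0, a] * ((D.jumpGap n x (t + L) y).adjugate * B.adjugate)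
      = A * (D.jumpGap n x t y * !![a⁻¹, 0; 0, a] * (D.jumpGap n x (t + L) y).adjugate)
          * B.adjugate := by
        simp only [Matrix.mul_assoc]
    _ = _ := by rw [key]

/-- The gauge product of two solutions at times that differ by `L` extends to an entire function. -/
theorem exists_entire_gaugeProduct {x t L : ℝ} {Φ₁ Φ₂ : ℂ → Matrix (Fin 2) (Fin 2) ℂ}
    (h₁ : D.SolvesRHP x t Φ₁) (h₂ : D.SolvesRHP x (t + L) Φ₂) {g : ℂ → ℂ} (hg : D.IsGauge L g)
    (i j : Fin 2) : ∃ F : ℂ → ℂ, Differentiable ℂ F ∧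
      (∀ z : ℂ, z.im ≠ 0 → F z = gaugeProduct (Φ₁ z) (g z) (Φ₂ z) i j) ∧
      ∃ M c : ℝ, 0 ≤ c ∧ ∀ z, ‖F z‖ ≤ M * Real.exp (c * ‖z‖ ^ 2) := by
  have hd : DifferentiableOn ℂ (fun z => gaugeProduct (Φ₁ z) (g z) (Φ₂ z) i j) {z | z.im ≠ 0} := by
    obtain ⟨k, s, -, h⟩ := exists_gaugeProduct_apply i j
    simp only [h]
    exact (((h₁.holomorphic i 0).mul (hg.holomorphic.inv hg.ne_zero)).mul
      (h₂.holomorphic k 1)).sub (((h₁.holomorphic i 1).mul hg.holomorphic).mul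
      (h₂.holomorphic k 0)) |>.const_mul s
  obtain ⟨P₁, Q₁, -, -, hP₁, hQ₁, hb₁, hg₁⟩ := h₁.boundary
  obtain ⟨P₂, Q₂, -, -, hP₂, hQ₂, hb₂, hg₂⟩ := h₂.boundary
  obtain ⟨F, hF, hFeq⟩ := exists_entire_extension hd (S := D.edges) D.eventually_ne_edge
    (fun y hy => by
      obtain ⟨a, b, ha0, hb0, ha, hb, hband, hgap⟩ := hg.boundary y
      have t1 := (continuousAt_gaugeProduct (A := P₁ y) (B := P₂ y) ha0).tendsto.comp
        ((hP₁ y hy).prodMk_nhds (ha.prodMk_nhds (hP₂ y hy)))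
      have t2 := (continuousAt_gaugeProduct (A := Q₁ y) (B := Q₂ y) hb0).tendsto.comp
        ((hQ₁ y hy).prodMk_nhds (hb.prodMk_nhds (hQ₂ y hy)))
      have heq : gaugeProduct (P₁ y) a (P₂ y) = gaugeProduct (Q₁ y) b (Q₂ y) := by
        rcases exists_gap_or_band hy with ⟨n, hn, hyn⟩ | ⟨n, hn, hyn⟩
        · rw [hg₁ n hn y hyn, hg₂ n hn y hyn]
          exact gaugeProduct_jumpGap n x t y L _ _ hb0 (hgap n hn hyn)
        · rw [hb₁ n hn y hyn, hb₂ n hn y hyn, hband n hn hyn]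
          exact gaugeProduct_jumpBand hn hyn _ _ _
      rw [heq] at t1
      refine ⟨gaugeProduct (Q₁ y) b (Q₂ y) i j, ?_, ?_⟩
      · exact ((continuous_apply_apply i j).tendsto _).comp t1
      · exact ((continuous_apply_apply i j).tendsto _).comp t2)
    (fun e he => by
      obtain ⟨δ₁, hδ₁, C₁, hC₁⟩ := h₁.quartic e he
      obtain ⟨δ₂, hδ₂, C₂, hC₂⟩ := h₂.quartic e he
      obtain ⟨a, b, ha0, hb0, ha, hb, -, -⟩ := hg.boundary e
      set κ := max (max (‖a‖ + 1) (‖b‖ + 1)) (max (‖a⁻¹‖ + 1) (‖b⁻¹‖ + 1)) with hκ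
      have hκ1 : ‖a‖ < κ := lt_of_lt_of_le (lt_add_one _)
          ((le_max_left _ _).trans (le_max_left _ _))
      have hκ2 : ‖b‖ < κ := lt_of_lt_of_le (lt_add_one _)
          ((le_max_right _ _).trans (le_max_left _ _))
      have hκ3 : ‖a⁻¹‖ < κ :=
        lt_of_lt_of_le (lt_add_one _) ((le_max_left _ _).trans (le_max_right _ _))
      have hκ4 : ‖b⁻¹‖ < κ :=
        lt_of_lt_of_le (lt_add_one _) ((le_max_right _ _).trans (le_max_right _ _))
      have hev : ∀ᶠ z in 𝓝[{z : ℂ | z.im ≠ 0}] (e : ℂ), ‖g z‖ < κ ∧ ‖(g z)⁻¹‖ < κ := by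
        rw [nhdsWithin_im_ne_zero, eventually_sup]
        exact ⟨(ha.norm.eventually_lt_const hκ1).and ((ha.inv₀ ha0).norm.eventually_lt_const hκ3),
          (hb.norm.eventually_lt_const hκ2).and ((hb.inv₀ hb0).norm.eventually_lt_const hκ4)⟩
      rw [eventually_nhdsWithin_iff, Metric.eventually_nhds_iff] at hev
      obtain ⟨δ₃, hδ₃, hg₃⟩ := hev
      refine ⟨min δ₁ (min δ₂ δ₃), by positivity, 2 * (C₁ * κ * C₂), fun z hz hzδ => ?_⟩
      obtain ⟨z1, z2⟩ := lt_min_iff.1 hzδ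
      obtain ⟨z2, z3⟩ := lt_min_iff.1 z2
      obtain ⟨e1, e2⟩ := hg₃ (by rwa [dist_eq]) hz
      have hpos : 0 < ‖z - e‖ := norm_pos_iff.2 fun h => hz (by
        rw [sub_eq_zero.1 h, ofReal_im])
      refine (norm_gaugeProduct_le (hC₁ z hz z1) (hC₂ z hz z2) e1.le e2.le i j).trans_eq ?_
      have : ‖z - e‖ ^ (-(1 / 2) : ℝ) = ‖z - e‖ ^ (-(1 / 4) : ℝ) * ‖z - e‖ ^ (-(1 / 4) : ℝ) := by
        rw [← Real.rpow_add hpos]; norm_num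
      rw [this]; ring)
  refine ⟨F, hF, hFeq, ?_⟩
  obtain ⟨c₁, -, M₁, -, hM₁⟩ := h₁.growth
  obtain ⟨c₂, -, M₂, -, hM₂⟩ := h₂.growth
  obtain ⟨c₃, -, M₃, -, hM₃⟩ := hg.growth
  obtain ⟨M, c, hc, h⟩ := exists_growth_of_domain (D := D) (X := ∅) isClosed_empty (f := F)
    hF.differentiableOn (by simp) (M := 2 * (M₁ * M₃ * M₂)) (c := c₁ + c₃ + c₂) (fun z hz _ => by
      rw [hFeq z hz.1]
      refine (norm_gaugeProduct_le (hM₁ z hz) (hM₂ z hz) (hM₃ z hz).1 (hM₃ z hz).2 i j).trans_eq ?_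
      rw [add_mul, add_mul, Real.exp_add, Real.exp_add]; ring)
  exact ⟨M, c, hc, fun z => h z (Set.notMem_empty z)⟩

end CandidateData

end NLSPeriodic

namespace NLSPeriodic

theorem exists_bound_mul_of_large {F : ℂ → ℂ} (hF : Continuous F) {S : Set ℂ} {φ : ℂ → ℝ}
    (hφ : ∀ z, 1 ≤ φ z) {C ρ : ℝ} (h : ∀ z ∈ S, ρ ≤ ‖z‖ → ‖F z‖ ≤ C * φ z) :
    ∃ C', 0 ≤ C' ∧ ∀ z ∈ S, ‖F z‖ ≤ C' * φ z := by
  obtain ⟨K, hK⟩ := (isCompact_closedBall (0 : ℂ) ρ).exists_bound_of_continuousOn hF.continuousOn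
  refine ⟨max (max C K) 0, le_max_right _ _, fun z hz => ?_⟩
  have hφ0 : 0 ≤ φ z := zero_le_one.trans (hφ z)
  rcases le_total ρ ‖z‖ with h1 | h1
  · exact (h z hz h1).trans (mul_le_mul_of_nonneg_right
      ((le_max_left _ _).trans (le_max_left _ _)) hφ0)
  · have h2 := hK z (by simpa using h1)
    calc ‖F z‖ ≤ max (max C K) 0 := h2.trans ((le_max_right _ _).trans (le_max_left _ _))
      _ ≤ _ := le_mul_of_one_le_right (le_max_right _ _) (hφ z)

theorem eq_apply_zero_of_sublinear {F : ℂ → ℂ} (hF : Differentiable ℂ F) {n : ℕ} (hn : 1 ≤ n)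
    {M c : ℝ} (hg : ∀ z, ‖F z‖ ≤ M * Real.exp (c * ‖z‖ ^ n))
    (hsec : ∀ ε > 0, ∃ C ρ : ℝ, ∀ z ∈ sector ε, ρ ≤ ‖z‖ → ‖F z‖ ≤ C * Real.exp (C * √‖z‖))
    {C ρ : ℝ} (him : ∀ y : ℝ, ρ ≤ |y| → ‖F (y * I)‖ ≤ C * √|y|) (z : ℂ) : F z = F 0 := by
  set Q := dslope F 0 with hQ
  have hQd : Differentiable ℂ Q := by
    rw [← differentiableOn_univ, hQ, differentiableOn_dslope univ_mem]
    exact hF.differentiableOn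
  have hQeq : ∀ z : ℂ, z * Q z = F z - F 0 := fun z => by
    have := sub_smul_dslope F 0 z
    simpa using this
  have hQn : ∀ z : ℂ, 1 ≤ ‖z‖ → ‖Q z‖ ≤ ‖F z‖ + ‖F 0‖ := fun z hz => by
    have h1 : ‖z‖ * ‖Q z‖ ≤ ‖F z‖ + ‖F 0‖ := by
      rw [← norm_mul, hQeq]; exact norm_sub_le _ _
    exact (le_mul_of_one_le_left (norm_nonneg _) hz).trans h1
  have hexp : ∀ {a b : ℝ} {u : ℝ}, a ≤ b → 0 ≤ u → Real.exp (a * u) ≤ Real.exp (b * u) :=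
    fun h hu => Real.exp_le_exp.2 (mul_le_mul_of_nonneg_right h hu)
  have hone : ∀ {b : ℝ} {u : ℝ}, 0 ≤ b → 0 ≤ u → 1 ≤ Real.exp (b * u) :=
    fun h hu => Real.one_le_exp (mul_nonneg h hu)
  obtain ⟨M', -, hM'⟩ := exists_bound_mul_of_large hQd.continuous (S := Set.univ)
    (φ := fun z => Real.exp (|c| * ‖z‖ ^ n)) (C := |M| + ‖F 0‖) (ρ := 1)
    (fun z => hone (abs_nonneg _) (by positivity)) (fun z _ hz => by
      refine (hQn z hz).trans ?_
      rw [add_mul]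
      refine add_le_add ((hg z).trans ?_)
        (le_mul_of_one_le_right (norm_nonneg _) (hone (abs_nonneg _) (by positivity)))
      exact mul_le_mul (le_abs_self _) (hexp (le_abs_self _) (by positivity))
        (Real.exp_pos _).le (abs_nonneg _))
  have hQsec : ∀ ε > 0, ∃ C, ∀ z ∈ sector ε, ‖Q z‖ ≤ C * Real.exp (C * √‖z‖) := fun ε hε => by
    obtain ⟨C₁, ρ₁, h₁⟩ := hsec ε hε
    obtain ⟨C₂, hC₂, h₂⟩ := exists_bound_mul_of_large hQd.continuous (S := sector ε)
      (φ := fun z => Real.exp (|C₁| * √‖z‖)) (C := |C₁| + ‖F 0‖) (ρ := max ρ₁ 1)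
      (fun z => hone (abs_nonneg _) (by positivity)) (fun z hz hz1 => by
        refine (hQn z ((le_max_right _ _).trans hz1)).trans ?_
        rw [add_mul]
        refine add_le_add ((h₁ z hz ((le_max_left _ _).trans hz1)).trans ?_)
          (le_mul_of_one_le_right (norm_nonneg _) (hone (abs_nonneg _) (by positivity)))
        exact mul_le_mul (le_abs_self _) (hexp (le_abs_self _) (by positivity))
          (Real.exp_pos _).le (abs_nonneg _))
    refine ⟨max C₂ |C₁|, fun z hz => (h₂ z hz).trans ?_⟩
    exact mul_le_mul (le_max_left _ _) (hexp (le_max_right _ _) (by positivity))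
      (Real.exp_pos _).le (hC₂.trans (le_max_left _ _))
  have hQim : ∀ y : ℝ, max ρ 1 ≤ |y| → ‖Q (y * I)‖ ≤ (|C| + ‖F 0‖) / √|y| := fun y hy => by
    have h1 : 1 ≤ |y| := (le_max_right _ _).trans hy
    have hs : 1 ≤ √|y| := Real.one_le_sqrt.2 h1
    have hs2 : √|y| * √|y| = |y| := Real.mul_self_sqrt (abs_nonneg _)
    have h2 : ‖(y * I : ℂ)‖ = |y| := by simp
    have h3 : |y| * ‖Q (y * I)‖ ≤ |C| * √|y| + ‖F 0‖ * √|y| := by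
      rw [← h2, ← norm_mul, hQeq, h2]
      refine (norm_sub_le _ _).trans (add_le_add ?_ (le_mul_of_one_le_right (norm_nonneg _) hs))
      exact (him y ((le_max_left _ _).trans hy)).trans
        (mul_le_mul_of_nonneg_right (le_abs_self _) (by positivity))
    rw [le_div_iff₀ (by positivity)]
    have : √|y| * (‖Q (y * I)‖ * √|y|) ≤ √|y| * (|C| + ‖F 0‖) := by
      calc _ = √|y| * √|y| * ‖Q (y * I)‖ := by ring
        _ ≤ _ := by rw [hs2]; linarith
    exact le_of_mul_le_mul_left this (by positivity)
  obtain ⟨K, -, hK⟩ := exists_bound_of_large hQd.continuous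
    (S := Set.range fun y : ℝ => (y * I : ℂ))
    (ρ := max ρ 1) (C := |C| + ‖F 0‖) (by
      rintro _ ⟨y, rfl⟩ hy
      have h2 : ‖(y * I : ℂ)‖ = |y| := by simp
      rw [h2] at hy
      exact (hQim y hy).trans (div_le_self (by positivity)
        (Real.one_le_sqrt.2 ((le_max_right _ _).trans hy))))
  have hconst : ∀ z w, Q z = Q w := eq_of_sector_growth hQd hn (fun z => hM' z trivial) hQsec
    (fun y => hK _ ⟨y, rfl⟩)
  have hQ0 : Q 0 = 0 := by
    rw [← norm_eq_zero]
    refine le_antisymm (ge_of_tendsto (x := atTop) (f := fun y : ℝ => (|C| + ‖F 0‖) / √|y|) ?_ ?_)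
      (norm_nonneg _)
    · exact tendsto_const_nhds.div_atTop (Real.tendsto_sqrt_atTop.comp tendsto_abs_atTop_atTop)
    · filter_upwards [eventually_ge_atTop (max ρ 1)] with y hy
      rw [hconst 0 (y * I)]
      exact hQim y (hy.trans (le_abs_self _))
  have := hQeq z
  rw [hconst z 0, hQ0, mul_zero] at this
  exact (sub_eq_zero.1 this.symm)

theorem norm_mul_apply_le {A B : Matrix (Fin 2) (Fin 2) ℂ} {a b : ℝ} (hA : ∀ i j, ‖A i j‖ ≤ a)
    (hB : ∀ i j, ‖B i j‖ ≤ b) (i j : Fin 2) : ‖(A * B) i j‖ ≤ 2 * (a * b) := by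
  have ha : 0 ≤ a := (norm_nonneg _).trans (hA 0 0)
  rw [Matrix.mul_apply, Fin.sum_univ_two]
  refine (norm_add_le _ _).trans ?_
  rw [norm_mul, norm_mul, two_mul]
  exact add_le_add (mul_le_mul (hA _ _) (hB _ _) (norm_nonneg _) ha)
    (mul_le_mul (hA _ _) (hB _ _) (norm_nonneg _) ha)

theorem norm_adjugate_apply_le {A : Matrix (Fin 2) (Fin 2) ℂ} {a : ℝ} (hA : ∀ i j, ‖A i j‖ ≤ a)
    (i j : Fin 2) : ‖A.adjugate i j‖ ≤ a := by
  rw [Matrix.adjugate_fin_two]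
  fin_cases i <;> fin_cases j <;> simp [hA]

theorem norm_U_apply_le (i j : Fin 2) : ‖U i j‖ ≤ 1 := by
  fin_cases i <;> fin_cases j <;> simp [U]

theorem det_U : U.det = 2 * I := by
  rw [U, Matrix.det_fin_two_of]; ring

theorem norm_one_add_apply_le {A : Matrix (Fin 2) (Fin 2) ℂ} {δ : ℝ} (hA : ∀ i j, ‖A i j‖ ≤ δ)
    (i j : Fin 2) : ‖(1 + A) i j‖ ≤ 1 + δ := by
  rw [Matrix.add_apply]
  refine (norm_add_le _ _).trans (add_le_add ?_ (hA i j))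
  fin_cases i <;> fin_cases j <;> simp

theorem norm_det_one_add_sub_one_le {A : Matrix (Fin 2) (Fin 2) ℂ} {δ : ℝ}
    (hA : ∀ i j, ‖A i j‖ ≤ δ) (hδ : δ ≤ 1 / 8) : ‖(1 + A).det - 1‖ ≤ 1 / 2 := by
  have hδ0 : 0 ≤ δ := (norm_nonneg _).trans (hA 0 0)
  have h : (1 + A).det - 1 = A 0 0 + A 1 1 + A 0 0 * A 1 1 - A 0 1 * A 1 0 := by
    rw [Matrix.det_fin_two]
    simp [Matrix.add_apply]
    ring
  have h1 : ‖A 0 0 * A 1 1‖ ≤ δ * δ := by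
    rw [norm_mul]; exact mul_le_mul (hA _ _) (hA _ _) (norm_nonneg _) hδ0
  have h2 : ‖A 0 1 * A 1 0‖ ≤ δ * δ := by
    rw [norm_mul]; exact mul_le_mul (hA _ _) (hA _ _) (norm_nonneg _) hδ0
  rw [h]
  have h3 := norm_sub_le (A 0 0 + A 1 1 + A 0 0 * A 1 1) (A 0 1 * A 1 0)
  have h4 := norm_add_le (A 0 0 + A 1 1) (A 0 0 * A 1 1)
  have h5 := norm_add_le (A 0 0) (A 1 1)
  have h6 := hA 0 0
  have h7 := hA 1 1
  nlinarith

namespace CandidateData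

variable {D : CandidateData}

theorem exists_B_eq (z : ℂ) : ∃ a b : ℂ, D.B z = !![a, 0; 0, b] := by
  unfold B
  split_ifs
  · exact ⟨I * D.scalarFactor z * D.fMinus z, I * D.scalarFactor z * D.fPlus z, by
      ext i j; fin_cases i <;> fin_cases j <;> simp⟩
  · exact ⟨D.scalarFactor z * D.fPlus z, D.scalarFactor z * D.fMinus z, by
      ext i j; fin_cases i <;> fin_cases j <;> simp⟩

theorem SolvesRHP.exists_asymptotics {x t : ℝ} {Φ : ℂ → Matrix (Fin 2) (Fin 2) ℂ}
    (h : D.SolvesRHP x t Φ) {ε : ℝ} (hε : 0 < ε) : ∃ C ρ : ℝ, 1 ≤ ρ ∧ ∀ z ∈ sector ε, ρ ≤ ‖z‖ →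
      C / ‖z‖ ≤ 1 / 8 ∧ ∃ A : Matrix (Fin 2) (Fin 2) ℂ, (∀ i j, ‖A i j‖ ≤ C / ‖z‖) ∧
        Φ z = U * (1 + A) * D.B z ∧ ‖(D.B z).det‖ ≤ ‖(Φ z).det‖ ∧
        ‖(Φ z).det‖ ≤ 3 * ‖(D.B z).det‖ := by
  obtain ⟨C, ρ, hρ, h⟩ := h.asymptotics ε hε
  refine ⟨C, max 1 (max ρ (8 * C)), le_max_left _ _, fun z hz hzρ => ?_⟩
  obtain ⟨A, hA, hΦ⟩ := h z hz (((le_max_left _ _).trans (le_max_right _ _)).trans hzρ)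
  have h1 : 1 ≤ ‖z‖ := (le_max_left _ _).trans hzρ
  have h2 : 8 * C ≤ ‖z‖ := ((le_max_right _ _).trans (le_max_right _ _)).trans hzρ
  have h3 : C / ‖z‖ ≤ 1 / 8 := by
    rw [div_le_div_iff₀ (by linarith) (by norm_num)]; linarith
  have h4 := norm_det_one_add_sub_one_le hA h3
  have h5 : ‖(Φ z).det‖ = 2 * ‖(1 + A).det‖ * ‖(D.B z).det‖ := by
    rw [hΦ, Matrix.det_mul, Matrix.det_mul, det_U]; simp
  have h6 : ‖(1 + A).det‖ ≤ 1 + 1 / 2 := by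
    have := norm_le_norm_add_norm_sub' (1 + A).det 1
    rw [norm_one] at this; linarith
  have h7 : 1 / 2 ≤ ‖(1 + A).det‖ := by
    have := norm_sub_norm_le (1 : ℂ) (1 + A).det
    rw [norm_one, norm_sub_rev] at this; linarith
  refine ⟨h3, A, hA, hΦ, ?_, ?_⟩ <;> rw [h5] <;> nlinarith [norm_nonneg (D.B z).det]

theorem gaugeProduct_one (A : Matrix (Fin 2) (Fin 2) ℂ) : gaugeProduct A 1 A = A.det • 1 := by
  rw [gaugeProduct, inv_one, ← Matrix.one_fin_two, mul_one, Matrix.mul_adjugate]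

theorem im_ne_zero_of_mem_sector {ε : ℝ} (hε : 0 < ε) {z : ℂ} (hz : z ∈ sector ε)
    (h0 : 0 < ‖z‖) : z.im ≠ 0 := by
  have : 0 < |z.im| := (mul_pos hε h0).trans_le hz
  exact abs_pos.1 this

theorem SolvesRHP.exists_det_eq {x t : ℝ} {Φ : ℂ → Matrix (Fin 2) (Fin 2) ℂ}
    (h : D.SolvesRHP x t Φ) : ∃ c : ℂ, c ≠ 0 ∧ ∃ κ : ℝ, ∀ z : ℂ, z.im ≠ 0 →
      (Φ z).det = c * exp (κ * z) := by
  obtain ⟨d, hd, hdΦ, M, c, hc, hdg⟩ := exists_entire_gaugeProduct (L := 0) h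
    (by rwa [add_zero]) (isGauge_one D) 0 0
  replace hdΦ : ∀ z : ℂ, z.im ≠ 0 → d z = (Φ z).det := fun z hz => by
    rw [hdΦ z hz, gaugeProduct_one]; simp
  set κ : ℝ := ∑' k : D.K, D.expCoeff k with hκ
  set F : ℂ → ℂ := fun z => d z * exp (-(κ * z)) with hF
  have hFd : Differentiable ℂ F := by fun_prop
  have hFd' : ∀ z, d z = F z * exp (κ * z) := fun z => by
    rw [hF]; dsimp only; rw [mul_assoc, ← exp_add, neg_add_cancel, exp_zero, mul_one]
  have hFnorm : ∀ z : ℂ, ‖F z‖ = ‖d z‖ * Real.exp (-(z.re * κ)) := fun z => by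
    rw [hF]; dsimp only; rw [norm_mul, norm_exp]; simp [mul_comm]
  have hbound : ∀ ε > 0, ∃ ρ : ℝ, 1 ≤ ρ ∧ ∀ z ∈ sector ε, ρ ≤ ‖z‖ → F z ≠ 0 ∧
      ‖F z‖ ≤ 3 / 2 * Real.exp (∑' k : D.K, D.logTerm k z) := fun ε hε => by
    obtain ⟨C, ρ, hρ, H⟩ := h.exists_asymptotics hε
    refine ⟨ρ, hρ, fun z hz hzρ => ?_⟩
    have him := im_ne_zero_of_mem_sector hε hz (by linarith)
    obtain ⟨-, A, -, -, h1, h2⟩ := H z hz hzρ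
    refine ⟨mul_ne_zero ?_ (exp_ne_zero _), ?_⟩
    · rw [hdΦ z him, ← norm_pos_iff]
      exact (norm_pos_iff.2 (det_B_ne_zero him)).trans_le h1
    · rw [norm_det_B him, Real.exp_add] at h2
      rw [hFnorm, hdΦ z him]
      calc _ ≤ _ := mul_le_mul_of_nonneg_right h2 (Real.exp_pos _).le
        _ = 3 / 2 * Real.exp (∑' k : D.K, D.logTerm k z) *
            (Real.exp (z.re * κ) * Real.exp (-(z.re * κ))) := by ring
        _ = _ := by rw [← Real.exp_add, add_neg_cancel, Real.exp_zero, mul_one]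
  obtain ⟨ρ₁, hρ₁, H₁⟩ := hbound 1 one_pos
  have hconst : ∀ z, F z = F 0 := by
    obtain ⟨C₁, hC₁⟩ := D.exists_tsum_logTerm_le_log
    refine eq_apply_zero_of_sublinear hFd (n := 2) (by norm_num)
      (M := |M| * Real.exp |κ|) (c := c + |κ|) ?_ ?_ (C := 3 / 2 * (Real.exp C₁ * 2)) (ρ := ρ₁) ?_
    · intro z
      rw [hFnorm, mul_assoc, add_mul, Real.exp_add]
      have h1 : -(z.re * κ) ≤ |κ| + |κ| * ‖z‖ ^ 2 := by
        have h2 : -(z.re * κ) ≤ ‖z‖ * |κ| := by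
          refine (neg_le_abs _).trans ?_
          rw [abs_mul]
          exact mul_le_mul_of_nonneg_right (abs_re_le_norm z) (abs_nonneg _)
        nlinarith [abs_nonneg κ, sq_nonneg (‖z‖ - 1), sq_nonneg ‖z‖]
      calc ‖d z‖ * Real.exp (-(z.re * κ))
          ≤ (|M| * Real.exp (c * ‖z‖ ^ 2)) * Real.exp (|κ| + |κ| * ‖z‖ ^ 2) := by
            refine mul_le_mul ((hdg z).trans ?_) (Real.exp_le_exp.2 h1) (Real.exp_pos _).le
              (by positivity)
            exact mul_le_mul_of_nonneg_right (le_abs_self _) (Real.exp_pos _).le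
        _ = _ := by rw [Real.exp_add]; ring
    · intro ε hε
      obtain ⟨ρ, hρ, H⟩ := hbound ε hε
      obtain ⟨C, hC, H'⟩ := D.exists_tsum_logTerm_le_sqrt hε
      refine ⟨C + 3 / 2, ρ, fun z hz hzρ => (H z hz hzρ).2.trans ?_⟩
      refine mul_le_mul (by linarith) (Real.exp_le_exp.2 ((H' z hz (hρ.trans hzρ)).trans ?_))
        (Real.exp_pos _).le (by positivity)
      exact mul_le_mul_of_nonneg_right (by linarith) (Real.sqrt_nonneg _)
    · intro y hy
      have hy1 := hρ₁.trans hy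
      refine (H₁ _ (mem_sector_one y) (by simpa using hy)).2.trans ?_
      rw [mul_assoc]
      refine mul_le_mul_of_nonneg_left ?_ (by norm_num)
      have h2 : Real.exp (Real.log (1 + y ^ 2) / 4) ≤ 2 * √|y| := by
        have h3 : Real.log (1 + y ^ 2) / 4 ≤ Real.log (2 * √|y|) := by
          have h4 : 1 + y ^ 2 ≤ (2 * √|y|) ^ 4 := by
            have h5 : (2 * √|y|) ^ 4 = 16 * ((√|y|) ^ 2) ^ 2 := by ring
            rw [h5, Real.sq_sqrt (abs_nonneg _), sq_abs]
            have : 1 ≤ y ^ 2 := by rw [← sq_abs]; nlinarith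
            linarith
          have h6 := Real.log_le_log (by positivity) h4
          rw [Real.log_pow] at h6
          push_cast at h6
          linarith
        calc _ ≤ _ := Real.exp_le_exp.2 h3
          _ = _ := Real.exp_log (mul_pos two_pos (Real.sqrt_pos.2 (by linarith)))
      calc _ ≤ Real.exp (Real.log (1 + y ^ 2) / 4 + C₁) := Real.exp_le_exp.2 (hC₁ y hy1)
        _ = Real.exp C₁ * Real.exp (Real.log (1 + y ^ 2) / 4) := by rw [Real.exp_add, mul_comm]
        _ ≤ Real.exp C₁ * (2 * √|y|) := mul_le_mul_of_nonneg_left h2 (Real.exp_pos _).le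
        _ = _ := by ring
  refine ⟨F 0, ?_, κ, fun z hz => ?_⟩
  · have := (H₁ (ρ₁ * I) (mem_sector_one ρ₁) (by simp [le_abs_self])).1
    rwa [hconst] at this
  · rw [← hdΦ z hz, hFd', hconst z]

end CandidateData

end NLSPeriodic

namespace NLSPeriodic

theorem norm_mul_diag_sub_apply_le {A A' : Matrix (Fin 2) (Fin 2) ℂ} {a b : ℂ} {δ δ' η : ℝ}
    (hA : ∀ i j, ‖A i j‖ ≤ δ) (hA' : ∀ i j, ‖A' i j‖ ≤ δ') (ha : ‖a - 1‖ ≤ η) (hb : ‖b - 1‖ ≤ η)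
    (hη : η ≤ 1) (i j : Fin 2) :
    ‖((1 + A) * !![a, 0; 0, b] - (1 + A')) i j‖ ≤ η + 2 * δ + δ' := by
  have hδ : 0 ≤ δ := (norm_nonneg _).trans (hA 0 0)
  have hη0 : 0 ≤ η := (norm_nonneg _).trans ha
  have key : ∀ {u : ℂ} (_ : ‖u - 1‖ ≤ η) (i j : Fin 2), ‖A i j * u‖ ≤ 2 * δ := fun {u} hu i j => by
    have h1 : ‖u‖ ≤ 2 := by
      have := norm_le_norm_add_norm_sub' u 1
      rw [norm_one] at this; linarith
    rw [norm_mul, mul_comm 2]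
    exact mul_le_mul (hA i j) h1 (norm_nonneg _) hδ
  fin_cases i <;> fin_cases j
  · have h : ((1 + A) * !![a, 0; 0, b] - (1 + A')) 0 0 = (a - 1) + A 0 0 * a - A' 0 0 := by
      simp [Matrix.mul_apply, Fin.sum_univ_two]; ring
    change ‖((1 + A) * !![a, 0; 0, b] - (1 + A')) 0 0‖ ≤ _
    rw [h]
    exact (norm_sub_le _ _).trans (add_le_add ((norm_add_le _ _).trans
      (add_le_add ha (key ha 0 0))) (hA' 0 0))
  · have h : ((1 + A) * !![a, 0; 0, b] - (1 + A')) 0 1 = A 0 1 * b - A' 0 1 := by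
      simp [Matrix.mul_apply, Fin.sum_univ_two]
    change ‖((1 + A) * !![a, 0; 0, b] - (1 + A')) 0 1‖ ≤ _
    rw [h]
    have := (norm_sub_le _ _).trans (add_le_add (key hb 0 1) (hA' 0 1))
    linarith
  · have h : ((1 + A) * !![a, 0; 0, b] - (1 + A')) 1 0 = A 1 0 * a - A' 1 0 := by
      simp [Matrix.mul_apply, Fin.sum_univ_two]
    change ‖((1 + A) * !![a, 0; 0, b] - (1 + A')) 1 0‖ ≤ _
    rw [h]
    have := (norm_sub_le _ _).trans (add_le_add (key ha 1 0) (hA' 1 0))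
    linarith
  · have h : ((1 + A) * !![a, 0; 0, b] - (1 + A')) 1 1 = (b - 1) + A 1 1 * b - A' 1 1 := by
      simp [Matrix.mul_apply, Fin.sum_univ_two]; ring
    change ‖((1 + A) * !![a, 0; 0, b] - (1 + A')) 1 1‖ ≤ _
    rw [h]
    exact (norm_sub_le _ _).trans (add_le_add ((norm_add_le _ _).trans
      (add_le_add hb (key hb 1 1))) (hA' 1 1))

theorem gaugeProduct_sub {A A' B : Matrix (Fin 2) (Fin 2) ℂ} {a β β' : ℂ}
    (hB : B = !![β, 0; 0, β']) :
    gaugeProduct (U * (1 + A) * B) a (U * (1 + A') * B) - (U * (1 + A') * B).det • 1 =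
      B.det • (U * ((1 + A) * !![a⁻¹, 0; 0, a] - (1 + A')) * ((1 + A').adjugate * U.adjugate)) := by
  have h1 : B * !![a⁻¹, 0; 0, a] * B.adjugate = B.det • !![a⁻¹, 0; 0, a] := by
    have : B * !![a⁻¹, 0; 0, a] = !![a⁻¹, 0; 0, a] * B := by
      rw [hB]
      ext i j; fin_cases i <;> fin_cases j <;> simp [mul_comm]
    rw [this, mul_assoc, Matrix.mul_adjugate, Matrix.mul_smul, mul_one]
  have h2 : (U * (1 + A') * B).det • (1 : Matrix (Fin 2) (Fin 2) ℂ) =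
      B.det • (U * (1 + A') * ((1 + A').adjugate * U.adjugate)) := by
    rw [← Matrix.adjugate_mul_distrib, Matrix.mul_adjugate, Matrix.det_mul (U * (1 + A')) B,
      smul_smul, mul_comm B.det]
  rw [h2, gaugeProduct, Matrix.adjugate_mul_distrib, Matrix.adjugate_mul_distrib]
  calc _ = U * (1 + A) * (B * !![a⁻¹, 0; 0, a] * B.adjugate) * ((1 + A').adjugate * U.adjugate)
        - B.det • (U * (1 + A') * ((1 + A').adjugate * U.adjugate)) := by
        simp only [mul_assoc]
    _ = _ := by
        rw [h1, Matrix.mul_smul, Matrix.smul_mul, ← smul_sub, ← sub_mul, mul_sub, mul_assoc U]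

theorem eq_mul_of_gaugeProduct_eq {A B : Matrix (Fin 2) (Fin 2) ℂ} {a : ℂ} (ha : a ≠ 0)
    (hB : B.det ≠ 0) (h : gaugeProduct A a B = B.det • 1) : A = B * !![a, 0; 0, a⁻¹] := by
  have h1 : A * !![a⁻¹, 0; 0, a] = B := by
    have := congrArg (· * B) h
    simp only [gaugeProduct, mul_assoc, Matrix.adjugate_mul, Matrix.smul_mul, one_mul,
      Matrix.mul_smul, mul_one] at this
    exact smul_right_injective _ hB this
  have h2 : !![a⁻¹, 0; 0, a] * !![a, 0; 0, a⁻¹] = (1 : Matrix (Fin 2) (Fin 2) ℂ) := by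
    ext i j; fin_cases i <;> fin_cases j <;> simp [ha]
  rw [← h1, mul_assoc, h2, mul_one]

namespace CandidateData

variable {D : CandidateData}

theorem SolvesRHP.eq_mul_gauge {x t L : ℝ} {Φ₁ Φ₂ : ℂ → Matrix (Fin 2) (Fin 2) ℂ} {g : ℂ → ℂ}
    (h₁ : D.SolvesRHP x t Φ₁) (h₂ : D.SolvesRHP x (t + L) Φ₂) (hg : D.IsGauge L g)
    (hga : ∀ ε > 0, ∃ C ρ : ℝ, ∀ z ∈ sector ε, ρ ≤ ‖z‖ → ‖g z - 1‖ ≤ C / ‖z‖) {z : ℂ}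
    (hz : z.im ≠ 0) : Φ₁ z = Φ₂ z * !![g z, 0; 0, (g z)⁻¹] := by
  obtain ⟨c, hc, κ, hdet⟩ := h₂.exists_det_eq
  have hdet0 : (Φ₂ z).det ≠ 0 := by
    rw [hdet z hz]; exact mul_ne_zero hc (exp_ne_zero _)
  refine eq_mul_of_gaugeProduct_eq (hg.ne_zero z hz) hdet0 ?_
  ext i j
  obtain ⟨F, hF, hFeq, M, C, hC, hFg⟩ := exists_entire_gaugeProduct h₁ h₂ hg i j
  set H : ℂ → ℂ := fun z => F z * (c⁻¹ * exp (-(κ * z))) with hH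
  have hHd : Differentiable ℂ H := by fun_prop
  have hHdet : ∀ z : ℂ, z.im ≠ 0 → F z = H z * (Φ₂ z).det := fun z hz => by
    rw [hdet z hz, hH]
    dsimp only
    calc F z = F z * ((c⁻¹ * c) * exp (-(κ * z) + κ * z)) := by
          rw [inv_mul_cancel₀ hc, neg_add_cancel, exp_zero, mul_one, mul_one]
      _ = _ := by rw [exp_add]; ring
  have hlim : H z = (1 : Matrix (Fin 2) (Fin 2) ℂ) i j := by
    refine eq_of_sector_limit hHd (n := 2) (by norm_num) (M := |M| * ‖c⁻¹‖ * Real.exp |κ|)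
      (c := C + |κ|) (fun z => ?_) (fun ε hε => ?_) z
    · have h1 : ‖exp (-(κ * z))‖ ≤ Real.exp (|κ| + |κ| * ‖z‖ ^ 2) := by
        refine (norm_exp_le_exp_norm _).trans (Real.exp_le_exp.2 ?_)
        rw [norm_neg, norm_mul, norm_real, Real.norm_eq_abs]
        nlinarith [abs_nonneg κ, sq_nonneg (‖z‖ - 1), sq_nonneg ‖z‖]
      have h2 : ‖F z‖ ≤ |M| * Real.exp (C * ‖z‖ ^ 2) :=
        (hFg z).trans (mul_le_mul_of_nonneg_right (le_abs_self _) (Real.exp_pos _).le)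
      calc ‖H z‖ = ‖F z‖ * (‖c⁻¹‖ * ‖exp (-(κ * z))‖) := by rw [hH]; simp only [norm_mul]
        _ ≤ (|M| * Real.exp (C * ‖z‖ ^ 2)) * (‖c⁻¹‖ * Real.exp (|κ| + |κ| * ‖z‖ ^ 2)) := by
            gcongr
        _ = _ := by rw [add_mul, Real.exp_add, Real.exp_add]; ring
    · obtain ⟨C₁, ρ₁, hρ₁, H₁⟩ := h₁.exists_asymptotics hε
      obtain ⟨C₂, ρ₂, hρ₂, H₂⟩ := h₂.exists_asymptotics hε
      obtain ⟨C₃, ρ₃, H₃⟩ := hga ε hε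
      refine ⟨16 * (2 * C₃ + 2 * C₁ + C₂), max (max ρ₁ ρ₂) (max ρ₃ (2 * C₃)), fun z hz hzρ => ?_⟩
      obtain ⟨h12, h3⟩ := max_le_iff.1 hzρ
      obtain ⟨hz1, hz2⟩ := max_le_iff.1 h12
      obtain ⟨hz3, hz4⟩ := max_le_iff.1 h3
      have him := im_ne_zero_of_mem_sector hε hz (by linarith)
      obtain ⟨-, A₁, hA₁, hΦ₁, -, -⟩ := H₁ z hz hz1
      obtain ⟨hC₂, A₂, hA₂, hΦ₂, hB, -⟩ := H₂ z hz hz2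
      have hg1 := H₃ z hz hz3
      have hpos : 0 < ‖z‖ := by linarith
      have hη : C₃ / ‖z‖ ≤ 1 / 2 := by
        rw [div_le_div_iff₀ hpos two_pos]; linarith
      have hg0 := hg.ne_zero z him
      have hginv : ‖(g z)⁻¹ - 1‖ ≤ 2 * (C₃ / ‖z‖) := by
        have h1 : 1 / 2 ≤ ‖g z‖ := by
          have := norm_sub_norm_le (1 : ℂ) (g z)
          rw [norm_one, norm_sub_rev] at this; linarith
        have h2 : ‖(g z)⁻¹ - 1‖ * ‖g z‖ = ‖g z - 1‖ := by
          rw [← norm_mul, sub_mul, inv_mul_cancel₀ hg0, one_mul, norm_sub_rev]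
        nlinarith [norm_nonneg ((g z)⁻¹ - 1)]
      have hη0 : 0 ≤ C₃ / ‖z‖ := (norm_nonneg _).trans hg1
      obtain ⟨β, β', hBeq⟩ := D.exists_B_eq z
      have hsub := congrFun (congrFun (gaugeProduct_sub (A := A₁) (A' := A₂) (a := g z) hBeq) i) j
      rw [← hΦ₁, ← hΦ₂, Matrix.sub_apply, Matrix.smul_apply, Matrix.smul_apply, smul_eq_mul,
        smul_eq_mul, ← hFeq z him, hHdet z him, mul_comm (H z), ← mul_sub] at hsub
      have hdet2 : 0 < ‖(Φ₂ z).det‖ := (norm_pos_iff.2 (det_B_ne_zero him)).trans_le hB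
      have hE := norm_mul_diag_sub_apply_le hA₁ hA₂ (a := (g z)⁻¹) (b := g z)
        hginv (by linarith) (by linarith)
      have hP := norm_mul_apply_le (norm_mul_apply_le norm_U_apply_le hE)
        (norm_mul_apply_le (norm_adjugate_apply_le (norm_one_add_apply_le hA₂))
          (norm_adjugate_apply_le norm_U_apply_le)) i j
      set e := 2 * (C₃ / ‖z‖) + 2 * (C₁ / ‖z‖) + C₂ / ‖z‖ with he
      have he0 : 0 ≤ e := (norm_nonneg _).trans (hE 0 0)
      have hfin : ‖(Φ₂ z).det‖ * ‖H z - (1 : Matrix (Fin 2) (Fin 2) ℂ) i j‖ ≤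
          ‖(Φ₂ z).det‖ * (16 * e) := by
        rw [← norm_mul, hsub, norm_mul]
        refine mul_le_mul hB (hP.trans ?_) (norm_nonneg _) (norm_nonneg _)
        nlinarith
      refine (le_of_mul_le_mul_left hfin hdet2).trans_eq ?_
      rw [he]; ring
  rw [← hFeq z hz, hHdet z hz, hlim, Matrix.smul_apply, smul_eq_mul, mul_comm]

theorem SolvesScalarRHP.exists_gauge_asymptotics {L : ℝ} {r : ℂ → ℂ} (hr : D.SolvesScalarRHP L r)
    {ε : ℝ} (hε : 0 < ε) : ∃ C ρ : ℝ, ∀ z ∈ sector ε, ρ ≤ ‖z‖ →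
      ‖exp (-2 * I * z ^ 2 * L) * r z - 1‖ ≤ C / ‖z‖ := by
  obtain ⟨C, ρ, -, h⟩ := hr.asymptotics ε hε
  refine ⟨C, ρ, fun z hz hzρ => ?_⟩
  obtain ⟨w, hw, hrz⟩ := h z hz hzρ
  rw [hrz, ← mul_assoc, ← exp_add]
  have : -2 * I * z ^ 2 * L + 2 * I * z ^ 2 * L = 0 := by ring
  rwa [this, exp_zero, one_mul, add_sub_cancel_left]

theorem Reconstructs.tendsto_apply {Φ : ℂ → Matrix (Fin 2) (Fin 2) ℂ} {q : ℂ}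
    (h : D.Reconstructs Φ q) : Tendsto (fun y : ℝ => 2 * (I * (y * I)) *
      (U⁻¹ * Φ (y * I) * (D.B (y * I))⁻¹) 0 1) atTop (𝓝 q) := by
  have hl : Tendsto (fun y : ℝ => (y * I : ℂ)) atTop (Bornology.cobounded ℂ ⊓ 𝓟 (sector 1)) := by
    refine tendsto_inf.2 ⟨?_, tendsto_principal.2 (Eventually.of_forall mem_sector_one)⟩
    rw [← tendsto_norm_atTop_iff_cobounded]
    simpa using tendsto_abs_atTop_atTop
  have := ((continuous_apply_apply (0 : Fin 2) (1 : Fin 2)).tendsto _).comp ((h 1 one_pos).comp hl)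
  simp only [Matrix.of_apply, Matrix.cons_val', Matrix.cons_val_zero, Matrix.cons_val_one] at this
  refine this.congr fun y => ?_
  have key : ∀ (w : ℂ) (N : Matrix (Fin 2) (Fin 2) ℂ),
      (w • (pauli3 * N - N * pauli3)) 0 1 = 2 * w * N 0 1 := fun w N => by
    simp [pauli3, Matrix.mul_apply, Fin.sum_univ_two, Matrix.vecMul, dotProduct]
    ring
  exact key _ _

/-- If the scalar Riemann–Hilbert problem of period `L` is solvable, then the reconstructed
potential has the temporal period `L`. -/
theorem SolvesScalarRHP.potential_add_period {L : ℝ} {r : ℂ → ℂ} (hr : D.SolvesScalarRHP L r)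
    {x t : ℝ} {Φ₁ Φ₂ : ℂ → Matrix (Fin 2) (Fin 2) ℂ} (h₁ : D.SolvesRHP x t Φ₁)
    (h₂ : D.SolvesRHP x (t + L) Φ₂) {q₁ q₂ : ℂ} (hq₁ : D.Reconstructs Φ₁ q₁)
    (hq₂ : D.Reconstructs Φ₂ q₂) : q₂ = q₁ := by
  set g : ℂ → ℂ := fun z => exp (-2 * I * z ^ 2 * L) * r z with hg
  have hga : ∀ ε > 0, ∃ C ρ : ℝ, ∀ z ∈ sector ε, ρ ≤ ‖z‖ → ‖g z - 1‖ ≤ C / ‖z‖ :=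
    fun ε hε => hr.exists_gauge_asymptotics hε
  have hg1 : Tendsto (fun y : ℝ => (g (y * I))⁻¹) atTop (𝓝 1) := by
    obtain ⟨C, ρ, h⟩ := hga 1 one_pos
    have h1 : Tendsto (fun y : ℝ => g (y * I)) atTop (𝓝 1) := by
      refine tendsto_iff_norm_sub_tendsto_zero.2 (squeeze_zero' (.of_forall fun _ => norm_nonneg _)
        (g := fun y : ℝ => C / |y|) ?_ (tendsto_const_nhds.div_atTop tendsto_abs_atTop_atTop))
      filter_upwards [eventually_ge_atTop ρ] with y hy
      have h2 : ‖(y * I : ℂ)‖ = |y| := by simp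
      rw [← h2]
      exact h _ (mem_sector_one y) (by rw [h2]; exact hy.trans (le_abs_self _))
    simpa using h1.inv₀ one_ne_zero
  have h1 := hq₂.tendsto_apply.mul hg1
  rw [mul_one] at h1
  refine tendsto_nhds_unique (h1.congr' ?_) hq₁.tendsto_apply
  filter_upwards [eventually_gt_atTop 0] with y hy
  have him : (y * I : ℂ).im ≠ 0 := by simpa using hy.ne'
  have hcomm : !![g (y * I), 0; 0, (g (y * I))⁻¹] * (D.B (y * I))⁻¹ =
      (D.B (y * I))⁻¹ * !![g (y * I), 0; 0, (g (y * I))⁻¹] := by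
    have hu : IsUnit (D.B (y * I)).det := (det_B_ne_zero him).isUnit
    obtain ⟨a, b, hB⟩ := D.exists_B_eq (y * I)
    have h2 : D.B (y * I) * !![g (y * I), 0; 0, (g (y * I))⁻¹] =
        !![g (y * I), 0; 0, (g (y * I))⁻¹] * D.B (y * I) := by
      rw [hB]
      ext i j; fin_cases i <;> fin_cases j <;> simp [mul_comm]
    calc _ = (D.B (y * I))⁻¹ * (D.B (y * I) * !![g (y * I), 0; 0, (g (y * I))⁻¹]) *
          (D.B (y * I))⁻¹ := by rw [← mul_assoc, Matrix.nonsing_inv_mul _ hu, one_mul]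
      _ = _ := by rw [h2, mul_assoc, mul_assoc, Matrix.mul_nonsing_inv _ hu, mul_one]
  have h3 : U⁻¹ * Φ₁ (y * I) * (D.B (y * I))⁻¹ =
      U⁻¹ * Φ₂ (y * I) * (D.B (y * I))⁻¹ * !![g (y * I), 0; 0, (g (y * I))⁻¹] := by
    rw [h₁.eq_mul_gauge h₂ hr.isGauge hga him, ← mul_assoc,
      mul_assoc (U⁻¹ * _), hcomm, mul_assoc (U⁻¹ * _)]
  rw [h3, mul_assoc]
  congr 1
  set N := U⁻¹ * Φ₂ (y * I) * (D.B (y * I))⁻¹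
  simp [Matrix.mul_apply, Fin.sum_univ_two]

end CandidateData

end NLSPeriodic

end

theorem mainTheorem6 (D : NLSPeriodic.CandidateData)
    (Φ : ℝ → ℝ → ℂ → Matrix (Fin 2) (Fin 2) ℂ)
    (hΦ : ∀ x t : ℝ, D.SolvesRHP x t (Φ x t))
    (q : ℝ → ℝ → ℂ)
    (hq : ∀ x t : ℝ, D.Reconstructs (Φ x t) (q x t))
    (L₂ : ℝ) (hL₂ : 0 < L₂)
    (r₂ : ℂ → ℂ) (hr₂ : D.SolvesScalarRHP L₂ r₂) :
    ∀ x t : ℝ, q x (t + L₂) = q x t := by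
  intro x t
  exact hr₂.potential_add_period (hΦ x t) (hΦ x (t + L₂)) (hq x t) (hq x (t + L₂))
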